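/- All graphs are finite and may have loops and multiple edges. A graph is \emph{eulerian} if it is connected and every vertex has even valency (loops count twice). A \emph{signed graph} is a graph $G$ with a signature $\sigma\colon E(G)\to\{+1,-1\}$; subgraphs inherit the signature, and an eulerian signed graph is \emph{odd} if it has an odd number of negative edges. Regard each edge as consisting of two half-edges, one at each of its ends (both at the same vertex for a loop). An orientation of $G$ directs each half-edge either out of or towards its end-vertex so that exactly one half-edge of every positive edge is directed out of its end-vertex, whereas the two half-edges of every negative edge are both directed out of, or both directed towards, their end-vertices. For an integer $k$, a \emph{nowhere-zero $k$-flow} on $G$ is a function $\xi\colon E(G)\to\{\pm1,\dots,\pm(k-1)\}$ such that, under some orientation of $G$, at every vertex the sum of the values on the half-edges directed out of it equals the sum of the values on the half-edges directed towards it. The \emph{flow number} $\Phi(G)$ is the smallest $k$ for which $G$ has a nowhere-zero $k$-flow, if there is one. \textbf{Theorem.} Let $G$ be a connected signed eulerian graph. Then $\Phi(G)=3$ if and only if $G$ is \emph{triply odd}, that is, $G$ contains three pairwise edge-disjoint odd eulerian subgraphs $G_1,G_2,G_3$ with $E(G)=E(G_1)\cup E(G_2)\cup E(G_3)$ that have a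 vertex in common. -/

import Mathlib

/-!
Signed multigraphs (loops and parallel edges allowed) are modelled by a multigraph
`G : Graph α β` together with a signature `σ : β → ℤˣ`; only the values of `σ` on the edges of
`G` matter, and a subgraph `H ≤ G` carries the same signature `σ`.
-/

namespace Graph

variable {α β : Type*}

/-- `G` is connected: it has a vertex, and any two vertices are joined by a walk. -/
def IsConnected (G : Graph α β) : Prop :=
  G.vertexSet.Nonempty ∧
    ∀ x ∈ G.vertexSet, ∀ y ∈ G.vertexSet, Relation.ReflTransGen G.Adj x y

/-- The valency of `x`: the number of edges incident with `x`, loops being counted twice. -/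
noncomputable def valency (G : Graph α β) (x : α) : ℕ :=
  (G.incidenceSet x).ncard + (G.loopSet x).ncard

/-- An eulerian graph: finite, connected, and with all valencies even. -/
structure IsEulerian (G : Graph α β) : Prop where
  finite_vertexSet : G.vertexSet.Finite
  finite_edgeSet : G.edgeSet.Finite
  isConnected : G.IsConnected
  even_valency : ∀ x ∈ G.vertexSet, Even (G.valency x)

/-- The set of negative edges of the signed graph `(G, σ)`. -/
def negEdges (G : Graph α β) (σ : β → ℤˣ) : Set β :=
  {e | e ∈ G.edgeSet ∧ σ e = -1}

/-- An odd eulerian signed graph: one with an odd number of negative edges. -/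
def IsOddEulerian (G : Graph α β) (σ : β → ℤˣ) : Prop :=
  G.IsEulerian ∧ Odd (G.negEdges σ).ncard

/-- An orientation (bidirection) of the signed graph `(G, σ)`. Every edge `e` consists of the two
half-edges `(e, false)` and `(e, true)`, where `(e, b)` is attached to the end-vertex `ends e b`
and is directed out of it if `out e b = true`, and towards it if `out e b = false`.
Exactly one half-edge of a positive edge is directed out of its end-vertex, while the half-edges
of a negative edge are both directed out of, or both directed towards, their end-vertices. -/
structure Orientation (G : Graph α β) (σ : β → ℤˣ) where
  ends : β → Bool → α
  out : β → Bool → Bool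
  isLink : ∀ e ∈ G.edgeSet, G.IsLink e (ends e false) (ends e true)
  compatible : ∀ e ∈ G.edgeSet, (out e false = out e true ↔ σ e = -1)

namespace Orientation

variable {G : Graph α β} {σ : β → ℤˣ}

/-- The half-edges at `v` directed out of `v`. -/
def outHalfEdges (O : G.Orientation σ) (v : α) : Set (β × Bool) :=
  {h | h.1 ∈ G.edgeSet ∧ O.ends h.1 h.2 = v ∧ O.out h.1 h.2 = true}

/-- The half-edges at `v` directed towards `v`. -/
def inHalfEdges (O : G.Orientation σ) (v : α) : Set (β × Bool) :=
  {h | h.1 ∈ G.edgeSet ∧ O.ends h.1 h.2 = v ∧ O.out h.1 h.2 = false}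

/-- `ξ` is a flow with respect to the orientation `O` of a finite signed graph:
Kirchhoff's law holds at each vertex. -/
def IsFlow {A : Type*} [AddCommGroup A] (O : G.Orientation σ) (ξ : β → A) : Prop :=
  ∀ v ∈ G.vertexSet,
    (∑ᶠ h ∈ O.outHalfEdges v, ξ h.1) - (∑ᶠ h ∈ O.inHalfEdges v, ξ h.1) = 0

end Orientation

/-- The signed graph `(G, σ)` has a nowhere-zero `k`-flow: under some orientation it has an integer
flow with values in `{±1, …, ±(k - 1)}`. (Reversing an edge and negating its value preserves
flows, so the choice of the orientation is immaterial.) -/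
def HasNowhereZeroFlow (G : Graph α β) (σ : β → ℤˣ) (k : ℕ) : Prop :=
  ∃ (O : G.Orientation σ) (ξ : β → ℤ),
    O.IsFlow ξ ∧ ∀ e ∈ G.edgeSet, ξ e ≠ 0 ∧ |ξ e| < (k : ℤ)

/-- The flow number of `(G, σ)` exists and equals `k`: `k` is the smallest integer for which there
is a nowhere-zero `k`-flow. -/
def HasFlowNumber (G : Graph α β) (σ : β → ℤˣ) (k : ℕ) : Prop :=
  IsLeast {m : ℕ | G.HasNowhereZeroFlow σ m} k

/-- `(G, σ)` is triply odd: its edge set is partitioned by three odd eulerian subgraphs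
that have a vertex in common. -/
def IsTriplyOdd (G : Graph α β) (σ : β → ℤˣ) : Prop :=
  ∃ H : Fin 3 → Graph α β,
    (∀ i, H i ≤ G) ∧
    (∀ i, (H i).IsOddEulerian σ) ∧
    Pairwise (fun i j => Disjoint (H i).edgeSet (H j).edgeSet) ∧
    (⋃ i, (H i).edgeSet) = G.edgeSet ∧
    ∃ v, ∀ i, v ∈ (H i).vertexSet

end Graph

/-! The easy half rests on a fact about odd eulerian graphs: values ±1 on the half-edges, compatible
with the signature, can be balanced everywhere except at one prescribed vertex, where the excess is
2 or -2 at will (`StubGraph.exists_excess_two`). With the common vertex of the three parts as the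
exceptional one and multipliers 1, 1, 2, the excesses 2 + 2 - 4 cancel and a nowhere-zero 3-flow
results. An eulerian graph has a nowhere-zero 2-flow exactly when its number of negative edges is
even (`StubGraph.exists_isTwoFlow`, `StubGraph.IsTwoFlow.cnt_sgn`), so flow number three means: odd,
with a 3-flow.

For the converse, take an odd graph with a 3-flow and induct on the number of pairs of half-edges at
a common vertex. A proper balanced set of half-edges at a vertex, with an even number of values ±2,
is split off; vertices of valency two are suppressed; cuts of two edges are removed. What resists
(`IsThreeFlow.vertex_cases`) has at every vertex two half-edges of value 2c and four of value -c,
and a switching makes all edges negative. The flow has then done its work: what remains is a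
six-regular graph with all edges negative, an odd number of them, and no cut of fewer than four
edges (`IsCore`).

The core is studied in the signed double cover. Three edge-disjoint odd closed trails through `v`
lift to six edge-disjoint trails between the two lifts of `v`, so `v` must be such that every set
separating its lifts is left by at least six edges. Such a `v` exists (`IsCore.exists_root`):
one-sided sets left by only four edges have supports of even size and can be uncrossed, whereas the
number of vertices is odd, so some vertex escapes all these supports.

Next every vertex other than `v` is replaced by a triangle of positive edges, which makes it a
configuration of four-valent vertices (`IsRooted`). A four-valent vertex can be eliminated by
pairing its half-edges in three ways. At most one pairing spoils the connectivity away from the root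
(`IsRooted.conn_unique`), and, for a suitably chosen vertex, at most one spoils the separation of
the lifts of the root (`IsRooted.sep_unique_of_notMem`, `IsRooted.sep_unique_of_full`); hence some
pairing preserves both. In the end the root carries three loops, all negative by the separation
condition, and undoing the eliminations turns them into the three odd parts. -/

open Classical in
/-- The number of elements of a finite type with a given property. -/
noncomputable def cnt {S : Type*} [Fintype S] (p : S → Prop) : ℕ := ∑ s, if p s then 1 else 0

/-! ### Cardinalities as sums of indicators -/

section cnt

variable {S : Type*} [Fintype S]

theorem cnt_eq_card (p : S → Prop) [DecidablePred p] :
    cnt p = (Finset.univ.filter p).card := by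
  classical
  rw [cnt, Finset.card_filter]
  exact Finset.sum_congr rfl fun s _ => by split_ifs <;> rfl

theorem cnt_congr {p q : S → Prop} (h : ∀ s, p s ↔ q s) : cnt p = cnt q := by
  classical
  exact Finset.sum_congr rfl fun s _ => by simp [h]

theorem cnt_mono {p q : S → Prop} (h : ∀ s, p s → q s) : cnt p ≤ cnt q := by
  classical
  refine Finset.sum_le_sum fun s _ => ?_
  by_cases hp : p s
  · simp [hp, h s hp]
  · simp [hp]

theorem cnt_comp_involutive {f : S → S} (hf : ∀ s, f (f s) = s) (p : S → Prop) :
    cnt (fun s => p (f s)) = cnt p := by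
  classical
  exact Equiv.sum_comp (Function.Involutive.toPerm f hf) (fun s => if p s then 1 else 0)

theorem cnt_comp_equiv {T : Type*} [Fintype T] (e : T ≃ S) (p : S → Prop) :
    cnt (fun t => p (e t)) = cnt p := by
  classical
  exact Equiv.sum_comp e (fun s => if p s then 1 else 0)

theorem cnt_add_cnt_not (p q : S → Prop) :
    cnt (fun s => p s ∧ q s) + cnt (fun s => p s ∧ ¬ q s) = cnt p := by
  classical
  simp only [cnt, ← Finset.sum_add_distrib]
  refine Finset.sum_congr rfl fun s _ => ?_
  by_cases hp : p s <;> by_cases hq : q s <;> simp [hp, hq]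

theorem cnt_subtype (P : S → Prop) [Fintype {s // P s}] (p : S → Prop) :
    cnt (fun s : {s // P s} => p s.1) = cnt (fun s => P s ∧ p s) := by
  classical
  rw [cnt_eq_card, cnt_eq_card, ← Finset.card_map (Function.Embedding.subtype P)]
  congr 1
  ext s
  simp
  tauto

theorem cnt_pos {p : S → Prop} : 0 < cnt p ↔ ∃ s, p s := by
  classical
  rw [cnt_eq_card, Finset.card_pos]
  simp [Finset.Nonempty]

theorem cnt_eq_zero {p : S → Prop} : cnt p = 0 ↔ ∀ s, ¬ p s := by
  have := cnt_pos (p := p)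
  constructor
  · intro h s hs
    have := this.2 ⟨s, hs⟩
    omega
  · intro h
    by_contra h0
    obtain ⟨s, hs⟩ := this.1 (by omega)
    exact h s hs

theorem cnt_true : cnt (fun _ : S => True) = Fintype.card S := by simp [cnt]

/-- A set on which a fixed-point-free involution acts has even cardinality. -/
theorem even_cnt_of_involution {p : S → Prop} (f : S → S) (hp : ∀ s, p s → p (f s))
    (hf : ∀ s, p s → f (f s) = s) (hne : ∀ s, p s → f s ≠ s) : Even (cnt p) := by
  classical
  rw [cnt_eq_card, ← ZMod.natCast_eq_zero_iff_even, Finset.card_eq_sum_ones, Nat.cast_sum]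
  refine Finset.sum_involution (fun s _ => f s) ?_ ?_ ?_ ?_
  · intro s _
    decide
  · intro s hs _
    exact hne s (by simpa using hs)
  · intro s hs
    simpa using hp s (by simpa using hs)
  · intro s hs
    exact hf s (by simpa using hs)

theorem cnt_prod_bool (p : S × Bool → Prop) :
    cnt p = cnt (fun s => p (s, false)) + cnt (fun s => p (s, true)) := by
  classical
  simp only [cnt, Fintype.sum_prod_type, Fintype.sum_bool, Finset.sum_add_distrib]
  omega

theorem cnt_fiber {V : Type*} [Fintype V] (f : S → V) (p : S → Prop) :
    cnt p = ∑ x, cnt (fun s => f s = x ∧ p s) := by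
  classical
  simp only [cnt]
  rw [Finset.sum_comm]
  refine Finset.sum_congr rfl fun s _ => ?_
  by_cases hp : p s <;> simp [hp]

theorem cnt_of_equiv {T : Type*} [Fintype T] {P : S → Prop} (e : T ≃ {s // P s}) (p : S → Prop) :
    cnt (fun s => P s ∧ p s) = cnt (fun t => p (e t).1) := by
  classical
  rw [← cnt_subtype, ← cnt_comp_equiv e]

end cnt

/-! ### Half-edge graphs and cuts of the signed double cover -/

/-- A signed multigraph given by its half-edges ("stubs"): each stub is attached to a vertex and
matched with the other half of its edge; `sgn` is `true` on the halves of negative edges. -/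
structure StubGraph (S V : Type*) where
  vert : S → V
  mate : S → S
  sgn : S → Bool
  mate_mate : ∀ s, mate (mate s) = s
  mate_ne : ∀ s, mate s ≠ s
  sgn_mate : ∀ s, sgn (mate s) = sgn s

namespace StubGraph

variable {S V : Type*} (G : StubGraph S V)

/-- Interchange of the two lifts of every vertex. -/
def star (X : Set (V × Bool)) : Set (V × Bool) := {z | (z.1, !z.2) ∈ X}

theorem mem_star {X : Set (V × Bool)} {z : V × Bool} : z ∈ star X ↔ (z.1, !z.2) ∈ X := Iff.rfl

theorem star_star (X : Set (V × Bool)) : star (star X) = X := by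
  ext z
  simp [mem_star]

/-- `X` contains at most one of the two lifts of each vertex. -/
def OneSided (X : Set (V × Bool)) : Prop := ∀ z ∈ X, (z.1, !z.2) ∉ X

/-- The vertex at the other end of a stub of the signed double cover. -/
def far (p : S × Bool) : V × Bool := (G.vert (G.mate p.1), xor p.2 (G.sgn p.1))

/-- The vertex at the near end of a stub of the signed double cover. -/
def near (p : S × Bool) : V × Bool := (G.vert p.1, p.2)

/-- The mate of a stub of the signed double cover. -/
def coverMate (p : S × Bool) : S × Bool := (G.mate p.1, xor p.2 (G.sgn p.1))

theorem coverMate_coverMate (p : S × Bool) : G.coverMate (G.coverMate p) = p := by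
  obtain ⟨s, b⟩ := p
  simp [coverMate, G.mate_mate, G.sgn_mate]

theorem coverMate_ne (p : S × Bool) : G.coverMate p ≠ p := by
  obtain ⟨s, b⟩ := p
  simp [coverMate, G.mate_ne]

theorem near_coverMate (p : S × Bool) : G.near (G.coverMate p) = G.far p := rfl

theorem far_coverMate (p : S × Bool) : G.far (G.coverMate p) = G.near p := by
  rw [← near_coverMate, coverMate_coverMate]

variable [Fintype S]

/-- The number of edges of the signed double cover from `A` to `B`. -/
noncomputable def e (A B : Set (V × Bool)) : ℕ := cnt fun p => G.near p ∈ A ∧ G.far p ∈ B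

/-- The number of edges of the signed double cover leaving `X`. -/
noncomputable def d (X : Set (V × Bool)) : ℕ := G.e X Xᶜ

/-- The valency of a vertex. -/
noncomputable def deg (x : V) : ℕ := cnt fun s => G.vert s = x

theorem e_comm (A B : Set (V × Bool)) : G.e A B = G.e B A := by
  rw [e, e, ← cnt_comp_involutive G.coverMate_coverMate]
  exact cnt_congr fun p => by rw [near_coverMate, far_coverMate, and_comm]

theorem d_compl (X : Set (V × Bool)) : G.d Xᶜ = G.d X := by
  rw [d, compl_compl, e_comm, d]

/-- Interchanging the two lifts of every vertex is an automorphism of the double cover: it commutes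
with `near` and `far`. -/
theorem e_star (A B : Set (V × Bool)) : G.e (star A) (star B) = G.e A B := by
  rw [e, e, ← cnt_comp_involutive (f := fun p : S × Bool => (p.1, !p.2)) (by simp)]
  refine cnt_congr fun p => ?_
  simp [near, far, mem_star]

theorem d_star (X : Set (V × Bool)) : G.d (star X) = G.d X := by
  rw [d, d, ← G.e_star X]
  rfl

/-- Submodularity of the cut function. -/
theorem d_inter_add_d_union_le (A B : Set (V × Bool)) :
    G.d (A ∩ B) + G.d (A ∪ B) ≤ G.d A + G.d B := by
  classical
  simp only [d, e, cnt, ← Finset.sum_add_distrib]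
  refine Finset.sum_le_sum fun p _ => ?_
  by_cases h1 : G.near p ∈ A <;> by_cases h2 : G.near p ∈ B <;> by_cases h3 : G.far p ∈ A <;>
    by_cases h4 : G.far p ∈ B <;> simp [h1, h2, h3, h4]

/-- Posimodularity of the cut function. -/
theorem d_diff_add_d_diff_le (A B : Set (V × Bool)) :
    G.d (A \ B) + G.d (B \ A) ≤ G.d A + G.d B := by
  have h := G.d_inter_add_d_union_le A Bᶜ
  rw [d_compl, ← G.d_compl (A ∪ Bᶜ)] at h
  have : (A ∪ Bᶜ)ᶜ = B \ A := by
    ext z; simp [and_comm]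
  rw [this] at h
  exact h

/-- The elements of `X` whose other lift is not in `X`. -/
def oneSidedPart (X : Set (V × Bool)) : Set (V × Bool) := X \ star X

theorem oneSided_oneSidedPart (X : Set (V × Bool)) : OneSided (oneSidedPart X) := by
  rintro z ⟨-, hz⟩ ⟨h, -⟩
  exact hz h

/-- Posimodularity for `X` and `star X`: the two differences are exchanged by `star`, so they have
equal cuts, and so have `X` and `star X`. -/
theorem d_oneSidedPart_le (X : Set (V × Bool)) : G.d (oneSidedPart X) ≤ G.d X := by
  have h := G.d_diff_add_d_diff_le X (star X)
  have h2 : star X \ X = star (oneSidedPart X) := by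
    ext z
    simp [oneSidedPart, mem_star]
  rw [h2, d_star, d_star] at h
  unfold oneSidedPart at h ⊢
  omega

/-- In a graph with even valencies every cut of the double cover is even. -/
theorem even_d [Fintype V] (hdeg : ∀ x, Even (G.deg x)) (X : Set (V × Bool)) : Even (G.d X) := by
  -- The half-edges at `X` number a sum of valencies, which is even; those of edges inside `X` come
  -- in mated pairs, so the leaving ones are even in number too.
  have h1 := cnt_add_cnt_not (fun p : S × Bool => G.near p ∈ X) (fun p => G.far p ∈ X)
  have h2 : Even (cnt fun p => G.near p ∈ X ∧ G.far p ∈ X) := by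
    refine even_cnt_of_involution G.coverMate ?_ (fun p _ => G.coverMate_coverMate p)
      (fun p _ => G.coverMate_ne p)
    intro p hp
    rw [near_coverMate, far_coverMate]
    exact hp.symm
  have h3 : Even (cnt fun p => G.near p ∈ X) := by
    rw [cnt_prod_bool, cnt_fiber G.vert, cnt_fiber G.vert (fun s : S => G.near (s, true) ∈ X)]
    have key : ∀ b, Even (∑ x, cnt fun s : S => G.vert s = x ∧ G.near (s, b) ∈ X) := by
      intro b
      refine Finset.even_sum _ fun x _ => ?_
      by_cases hx : (x, b) ∈ X
      · have h0 : (cnt fun s : S => G.vert s = x ∧ G.near (s, b) ∈ X) = G.deg x := by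
          refine cnt_congr fun s => ?_
          simp only [near, and_iff_left_iff_imp]
          rintro rfl
          exact hx
        rw [h0]
        exact hdeg x
      · have h0 : (cnt fun s : S => G.vert s = x ∧ G.near (s, b) ∈ X) = 0 := by
          refine cnt_eq_zero.2 ?_
          rintro s ⟨rfl, h⟩
          exact hx h
        rw [h0]
        exact Even.zero
    exact (key false).add (key true)
  have h4 : G.d X = cnt fun p => G.near p ∈ X ∧ ¬ G.far p ∈ X := rfl
  rw [h4]
  rw [← h1] at h3
  exact (Nat.even_add.1 h3).1 h2

end StubGraph

/-- For an involution `f` on `H`, twice the size of a subset `a` of `H` agrees modulo `4` with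
twice the number of elements of `a` whose image is not in `a`. -/
theorem two_mul_cnt_mod_four {S : Type*} [Fintype S] {H a : S → Prop} {f : S → S}
    (hH : ∀ s, H s → H (f s)) (hf : ∀ s, H s → f (f s) = s) (hne : ∀ s, H s → f s ≠ s) :
    (2 * cnt fun s => H s ∧ a s) % 4 = (2 * cnt fun s => H s ∧ a s ∧ ¬ a (f s)) % 4 := by
  have h1 := cnt_add_cnt_not (fun s => H s ∧ a s) (fun s => a (f s))
  have h2 : Even (cnt fun s => (H s ∧ a s) ∧ a (f s)) := by
    refine even_cnt_of_involution f ?_ (fun s hs => hf s hs.1.1) (fun s hs => hne s hs.1.1)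
    rintro s ⟨⟨h, h'⟩, h''⟩
    exact ⟨⟨hH s h, h''⟩, by rwa [hf s h]⟩
  have h3 : (cnt fun s => (H s ∧ a s) ∧ ¬ a (f s)) = cnt fun s => H s ∧ a s ∧ ¬ a (f s) :=
    cnt_congr fun s => and_assoc
  obtain ⟨k, hk⟩ := h2
  omega

/-! ### Odd colourings and the elimination of a vertex -/

namespace StubGraph

variable {S V : Type*} (G : StubGraph S V)

/-- Every stub is joined to the vertex `v` by a walk inside its own colour class. -/
def Reaches {C : Type*} (τ : S → C) (v : V) : Prop :=
  ∀ P : S → Prop, (∀ s, G.vert s = v → P s) → (∀ s, P s → P (G.mate s)) →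
    (∀ s t, G.vert s = G.vert t → τ s = τ t → P s → P t) → ∀ s, P s

/-- `τ` colours the edges such that each of the three classes is an odd eulerian subgraph
through `v`. -/
structure IsOddColouring [Fintype S] (τ : S → Fin 3) (v : V) : Prop where
  mate : ∀ s, τ (G.mate s) = τ s
  even : ∀ x i, Even (cnt fun s => G.vert s = x ∧ τ s = i)
  -- Half-edges are counted, two for each edge, so an odd number of negative edges reads as 2 modulo
  -- 4.
  odd : ∀ i, (cnt fun s => G.sgn s = true ∧ τ s = i) % 4 = 2
  reaches : G.Reaches τ v

/-- The edges can be partitioned into three odd eulerian subgraphs with a common vertex. -/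
def Good [Fintype S] : Prop := ∃ τ v, G.IsOddColouring τ v

/-- `f` is a pairing of the stubs at the vertex `x`, which carries no loops. -/
structure IsPairing (x : V) (f : S → S) : Prop where
  noloop : ∀ s, G.vert s = x → G.vert (G.mate s) ≠ x
  maps : ∀ s, G.vert s = x → G.vert (f s) = x
  invol : ∀ s, G.vert s = x → f (f s) = s
  ne : ∀ s, G.vert s = x → f s ≠ s

variable {G} {x : V} {f : S → S}

open Classical in
/-- Elimination of the vertex `x` along a pairing of its stubs: every pair of edges entering
`x` through paired stubs is replaced by a single edge. -/
noncomputable def elim (h : G.IsPairing x f) :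
    StubGraph {s // G.vert s ≠ x} {y // y ≠ x} where
  vert s := ⟨G.vert s.1, s.2⟩
  mate s := if hs : G.vert (G.mate s.1) = x then
      ⟨G.mate (f (G.mate s.1)), h.noloop _ (h.maps _ hs)⟩ else ⟨G.mate s.1, hs⟩
  sgn s := if G.vert (G.mate s.1) = x then xor (G.sgn s.1) (G.sgn (f (G.mate s.1)))
    else G.sgn s.1
  mate_mate s := by
    by_cases hs : G.vert (G.mate s.1) = x
    · simp [hs, G.mate_mate, h.maps _ hs, h.invol _ hs]
    · simp [hs, G.mate_mate, s.2]
  mate_ne s := by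
    by_cases hs : G.vert (G.mate s.1) = x
    · simp only [hs, dite_true, ne_eq, Subtype.ext_iff]
      intro h1
      apply h.ne _ hs
      rw [← G.mate_mate (f _), h1]
    · simp only [hs, dite_false, ne_eq, Subtype.ext_iff]
      exact G.mate_ne s.1
  sgn_mate s := by
    by_cases hs : G.vert (G.mate s.1) = x
    · simp [hs, G.mate_mate, h.maps _ hs, h.invol _ hs, G.sgn_mate, Bool.xor_comm]
    · simp [hs, G.mate_mate, s.2, G.sgn_mate]

theorem elim_mate_of_eq (h : G.IsPairing x f) (s : {s // G.vert s ≠ x})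
    (hs : G.vert (G.mate s.1) = x) : ((elim h).mate s).1 = G.mate (f (G.mate s.1)) := by
  simp [elim, hs]

theorem elim_mate_of_ne (h : G.IsPairing x f) (s : {s // G.vert s ≠ x})
    (hs : G.vert (G.mate s.1) ≠ x) : ((elim h).mate s).1 = G.mate s.1 := by
  simp [elim, hs]

variable [Fintype S]

theorem deg_elim (h : G.IsPairing x f) [Fintype {s // G.vert s ≠ x}] (y : {y // y ≠ x}) :
    (elim h).deg y = G.deg y.1 := by
  have h1 := cnt_subtype (fun s => G.vert s ≠ x) (fun s => G.vert s = y.1)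
  rw [deg, deg]
  have h2 : (cnt fun s => (elim h).vert s = y)
      = cnt fun s : {s // G.vert s ≠ x} => G.vert s.1 = y.1 :=
    cnt_congr fun s => by simp [elim, Subtype.ext_iff]
  rw [h2, h1]
  exact cnt_congr fun s => ⟨fun h => h.2, fun h => ⟨h ▸ y.2, h⟩⟩

/-- A merged edge has the product of the two signs, so parity is kept. In half-edges: negative edges
at `x` count twice before, and afterwards there is one half-edge for each half-edge at `x` whose
sign differs from that of its partner. The two counts agree modulo 4 by `two_mul_cnt_mod_four`. -/
theorem cnt_sgn_elim (h : G.IsPairing x f) [Fintype {s // G.vert s ≠ x}] {p : S → Prop}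
    (hm : ∀ s, p s → p (G.mate s)) (hf : ∀ s, G.vert s = x → p s → p (f s)) :
    (cnt fun s => (elim h).sgn s = true ∧ p s.1) % 4 = (cnt fun s => G.sgn s = true ∧ p s) % 4 := by
  classical
  have hm' : ∀ s, p (G.mate s) ↔ p s := fun s => ⟨fun hs => by simpa [G.mate_mate] using hm _ hs, hm s⟩
  let g : S → Bool := fun s => if G.vert (G.mate s) = x then
    xor (G.sgn s) (G.sgn (f (G.mate s))) else G.sgn s
  have h2 := cnt_subtype (fun s => G.vert s ≠ x) (fun s => g s = true ∧ p s)
  have h3 : (cnt fun s => (elim h).sgn s = true ∧ p s.1)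
      = cnt fun s : {s // G.vert s ≠ x} => g s.1 = true ∧ p s.1 :=
    cnt_congr fun s => Iff.rfl
  rw [h3, h2]
  have s1 := cnt_add_cnt_not (fun s => G.sgn s = true ∧ p s) (fun s => G.vert s = x)
  have s2 := cnt_add_cnt_not (fun s => (G.sgn s = true ∧ p s) ∧ ¬ G.vert s = x)
    (fun s => G.vert (G.mate s) = x)
  have t1 := cnt_add_cnt_not (fun s => G.vert s ≠ x ∧ g s = true ∧ p s)
    (fun s => G.vert (G.mate s) = x)
  have e1 : (cnt fun s => ((G.sgn s = true ∧ p s) ∧ ¬ G.vert s = x) ∧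
        G.vert (G.mate s) = x)
      = cnt fun s => (G.vert s = x ∧ p s) ∧ G.sgn s = true := by
    rw [← cnt_comp_involutive G.mate_mate]
    refine cnt_congr fun s => ?_
    rw [G.mate_mate, hm', G.sgn_mate]
    have := h.noloop s
    tauto
  have e2 : (cnt fun s => (G.sgn s = true ∧ p s) ∧ G.vert s = x)
      = cnt fun s => (G.vert s = x ∧ p s) ∧ G.sgn s = true :=
    cnt_congr fun s => by tauto
  have e3 : (cnt fun s => (G.vert s ≠ x ∧ g s = true ∧ p s) ∧ G.vert (G.mate s) = x)
      = cnt fun s => (G.vert s = x ∧ p s) ∧ xor (G.sgn s) (G.sgn (f s)) = true := by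
    rw [← cnt_comp_involutive G.mate_mate]
    refine cnt_congr fun s => ?_
    simp only [g]
    rw [G.mate_mate, hm', G.sgn_mate]
    have := h.noloop s
    by_cases hs : G.vert s = x
    · simp only [hs, if_true]
      tauto
    · simp [hs]
  have e4 : (cnt fun s => ((G.sgn s = true ∧ p s) ∧ ¬ G.vert s = x) ∧
        ¬ G.vert (G.mate s) = x)
      = cnt fun s => (G.vert s ≠ x ∧ g s = true ∧ p s) ∧ ¬ G.vert (G.mate s) = x := by
    refine cnt_congr fun s => ?_
    by_cases hs : G.vert (G.mate s) = x
    · simp [hs]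
    · simp only [g, hs, if_false]
      tauto
  have maps : ∀ s, G.vert s = x ∧ p s → G.vert (f s) = x ∧ p (f s) :=
    fun s hs => ⟨h.maps s hs.1, hf s hs.1 hs.2⟩
  have key := two_mul_cnt_mod_four (a := fun s => G.sgn s = true) maps
    (fun s hs => h.invol s hs.1) (fun s hs => h.ne s hs.1)
  have u1 := cnt_add_cnt_not
    (fun s => (G.vert s = x ∧ p s) ∧ xor (G.sgn s) (G.sgn (f s)) = true)
    (fun s => G.sgn s = true)
  have u2 : (cnt fun s => ((G.vert s = x ∧ p s) ∧ xor (G.sgn s) (G.sgn (f s)) = true)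
        ∧ G.sgn s = true)
      = cnt fun s => (G.vert s = x ∧ p s) ∧ G.sgn s = true ∧ ¬ G.sgn (f s) = true := by
    refine cnt_congr fun s => ?_
    cases G.sgn s <;> cases G.sgn (f s) <;> simp
  have u3 : (cnt fun s => ((G.vert s = x ∧ p s) ∧ xor (G.sgn s) (G.sgn (f s)) = true)
        ∧ ¬ G.sgn s = true)
      = cnt fun s => (G.vert s = x ∧ p s) ∧ G.sgn s = true ∧ ¬ G.sgn (f s) = true := by
    classical
    rw [cnt_eq_card, cnt_eq_card]
    refine Finset.card_bij (fun s _ => f s) ?_ ?_ ?_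
    · intro s hs
      simp only [Finset.mem_filter, Finset.mem_univ, true_and] at hs ⊢
      refine ⟨maps s hs.1.1, ?_⟩
      rw [h.invol s hs.1.1.1]
      obtain ⟨⟨-, h1⟩, h2⟩ := hs
      revert h1 h2
      cases G.sgn s <;> cases G.sgn (f s) <;> simp
    · intro s hs t ht hst
      simp only [Finset.mem_filter, Finset.mem_univ, true_and] at hs ht
      rw [← h.invol s hs.1.1.1, hst, h.invol t ht.1.1.1]
    · intro t ht
      simp only [Finset.mem_filter, Finset.mem_univ, true_and] at ht
      refine ⟨f t, ?_, h.invol t ht.1.1⟩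
      simp only [Finset.mem_filter, Finset.mem_univ, true_and]
      rw [h.invol t ht.1.1]
      refine ⟨⟨maps t ht.1, ?_⟩, ht.2.2⟩
      obtain ⟨-, h1, h2⟩ := ht
      revert h1 h2
      cases G.sgn t <;> cases G.sgn (f t) <;> simp
  omega

/-- The two edges behind a merged edge inherit its colour. At `x` each colour then appears in whole
pairs, and a walk along a merged edge becomes a walk through `x` inside the same colour. -/
theorem good_of_elim (h : G.IsPairing x f) [Fintype {s // G.vert s ≠ x}]
    (hg : (elim h).Good) : G.Good := by
  classical
  obtain ⟨τ, v, hτ⟩ := hg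
  let ρ : S → Fin 3 := fun s => if hs : G.vert s = x then τ ⟨G.mate s, h.noloop s hs⟩
    else τ ⟨s, hs⟩
  have ρ_ne : ∀ s : {s // G.vert s ≠ x}, ρ s.1 = τ s := fun s => by simp [ρ, s.2]
  have ρ_mate : ∀ s, ρ (G.mate s) = ρ s := by
    intro s
    by_cases hs : G.vert s = x
    · simp [ρ, hs, h.noloop s hs]
    · by_cases hs' : G.vert (G.mate s) = x
      · simp [ρ, hs, hs', G.mate_mate]
      · have := hτ.mate ⟨s, hs⟩
        simpa [ρ, hs, hs', elim] using this
  have ρ_f : ∀ s, G.vert s = x → ρ (f s) = ρ s := by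
    intro s hs
    have := hτ.mate ⟨G.mate s, h.noloop s hs⟩
    simpa [ρ, hs, h.maps s hs, elim, G.mate_mate] using this
  refine ⟨ρ, v.1, ρ_mate, ?_, ?_, ?_⟩
  · intro y i
    by_cases hy : y = x
    · subst hy
      refine even_cnt_of_involution f ?_ (fun s hs => h.invol s hs.1) (fun s hs => h.ne s hs.1)
      rintro s ⟨hs, rfl⟩
      exact ⟨h.maps s hs, ρ_f s hs⟩
    · have h1 := hτ.even ⟨y, hy⟩ i
      have h2 := cnt_subtype (fun s => G.vert s ≠ x) (fun s => G.vert s = y ∧ ρ s = i)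
      have h3 : (cnt fun s => (elim h).vert s = ⟨y, hy⟩ ∧ τ s = i)
          = cnt fun s : {s // G.vert s ≠ x} => G.vert s.1 = y ∧ ρ s.1 = i :=
        cnt_congr fun s => by rw [ρ_ne]; simp [elim]
      rw [h3, h2] at h1
      convert h1 using 1
      exact cnt_congr fun s => ⟨fun h => ⟨h.1 ▸ hy, h⟩, fun h => h.2⟩
  · intro i
    rw [← hτ.odd i, ← cnt_sgn_elim h (p := fun s => ρ s = i)]
    · exact congrArg (· % 4) (cnt_congr fun s => by rw [ρ_ne])
    · exact fun s hs => by rw [ρ_mate, hs]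
    · exact fun s hs hi => by rw [ρ_f s hs, hi]
  · intro P hv hm hs
    have key : ∀ s : {s // G.vert s ≠ x}, P s.1 := by
      refine hτ.reaches (fun s => P s.1) ?_ ?_ ?_
      · intro s hs
        exact hv s.1 (congrArg Subtype.val hs)
      · intro s hPs
        by_cases hs' : G.vert (G.mate s.1) = x
        · rw [elim_mate_of_eq h s hs']
          refine hm _ (hs (G.mate s.1) _ ?_ ?_ (hm _ hPs))
          · rw [hs', h.maps _ hs']
          · rw [ρ_f _ hs']
        · rw [elim_mate_of_ne h s hs']
          exact hm _ hPs
      · intro s t hst hτst hPs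
        refine hs s.1 t.1 (congrArg Subtype.val hst) ?_ hPs
        rw [ρ_ne, ρ_ne, hτst]
    intro s
    by_cases hs' : G.vert s = x
    · rw [← G.mate_mate s]
      exact hm _ (key ⟨G.mate s, h.noloop s hs'⟩)
    · exact key ⟨s, hs'⟩

/-! ### Cuts before and after elimination -/

/-- The edges of the double cover leaving `X` that are not incident with a lift of `x`. -/
noncomputable def base (G : StubGraph S V) (x : V) (X : Set (V × Bool)) : ℕ :=
  cnt fun p : S × Bool => (G.vert p.1 ≠ x ∧ G.vert (G.mate p.1) ≠ x) ∧ G.near p ∈ X ∧ G.far p ∉ X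

open Classical in
-- Without loops at `x` no edge joins two lifts of `x`, so each edge at a lift of `x` can be read
-- off from its end there, whichever end lies in `X`.
theorem d_eq_base_add (hl : ∀ s, G.vert s = x → G.vert (G.mate s) ≠ x) (X : Set (V × Bool)) :
    G.d X = G.base x X
      + (if (x, false) ∈ X then cnt fun s => G.vert s = x ∧ G.far (s, false) ∉ X
          else cnt fun s => G.vert s = x ∧ G.far (s, false) ∈ X)
      + (if (x, true) ∈ X then cnt fun s => G.vert s = x ∧ G.far (s, true) ∉ X
          else cnt fun s => G.vert s = x ∧ G.far (s, true) ∈ X) := by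
  have s1 := cnt_add_cnt_not (fun p : S × Bool => G.near p ∈ X ∧ G.far p ∉ X)
    (fun p => G.vert p.1 = x)
  have s2 := cnt_add_cnt_not (fun p : S × Bool => (G.near p ∈ X ∧ G.far p ∉ X) ∧ ¬ G.vert p.1 = x)
    (fun p => G.vert (G.mate p.1) = x)
  have e1 : (cnt fun p : S × Bool => ((G.near p ∈ X ∧ G.far p ∉ X) ∧ ¬ G.vert p.1 = x) ∧
      ¬ G.vert (G.mate p.1) = x) = G.base x X := cnt_congr fun p => by tauto
  have e2 : (cnt fun p : S × Bool => ((G.near p ∈ X ∧ G.far p ∉ X) ∧ ¬ G.vert p.1 = x) ∧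
      G.vert (G.mate p.1) = x) = cnt fun p : S × Bool => G.vert p.1 = x ∧ G.near p ∉ X ∧
        G.far p ∈ X := by
    rw [← cnt_comp_involutive G.coverMate_coverMate]
    refine cnt_congr fun p => ?_
    rw [near_coverMate, far_coverMate]
    have h1 : G.vert (G.coverMate p).1 = G.vert (G.mate p.1) := rfl
    have h2 : G.mate (G.coverMate p).1 = p.1 := G.mate_mate p.1
    rw [h1, h2]
    have := hl p.1
    tauto
  have e3 := cnt_prod_bool (fun p : S × Bool => G.vert p.1 = x ∧ G.near p ∉ X ∧ G.far p ∈ X)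
  have e4 := cnt_prod_bool (fun p : S × Bool => (G.near p ∈ X ∧ G.far p ∉ X) ∧ G.vert p.1 = x)
  dsimp only at e3 e4
  have key : ∀ b, (if (x, b) ∈ X then cnt fun s => G.vert s = x ∧ G.far (s, b) ∉ X
          else cnt fun s => G.vert s = x ∧ G.far (s, b) ∈ X)
      = (cnt fun s => (G.near (s, b) ∈ X ∧ G.far (s, b) ∉ X) ∧ G.vert s = x) +
        cnt fun s => G.vert s = x ∧ G.near (s, b) ∉ X ∧ G.far (s, b) ∈ X := by
    intro b
    split_ifs with hb
    · have h0 : (cnt fun s => G.vert s = x ∧ G.near (s, b) ∉ X ∧ G.far (s, b) ∈ X) = 0 := by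
        refine cnt_eq_zero.2 ?_
        rintro s ⟨rfl, h, -⟩
        exact h hb
      rw [h0, add_zero]
      refine cnt_congr fun s => ⟨?_, fun h => ⟨h.2, h.1.2⟩⟩
      rintro ⟨rfl, h⟩
      exact ⟨⟨hb, h⟩, rfl⟩
    · have h0 : (cnt fun s => (G.near (s, b) ∈ X ∧ G.far (s, b) ∉ X) ∧ G.vert s = x) = 0 := by
        refine cnt_eq_zero.2 ?_
        rintro s ⟨⟨h, -⟩, rfl⟩
        exact hb h
      rw [h0, zero_add]
      refine cnt_congr fun s => ⟨?_, fun h => ⟨h.1, h.2.2⟩⟩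
      rintro ⟨rfl, h⟩
      exact ⟨rfl, hb, h⟩
  rw [key, key]
  have e0 : G.d X = cnt fun p : S × Bool => G.near p ∈ X ∧ G.far p ∉ X := rfl
  omega

/-- The restriction of a set of lifts to the vertices other than `x`. -/
def restr (x : V) (X : Set (V × Bool)) : Set ({y // y ≠ x} × Bool) := {z | (z.1.1, z.2) ∈ X}

/-- A merged edge leaves the set exactly when the far ends of its two halves lie on different sides;
the lifts of `x` themselves no longer matter. -/
theorem d_elim (h : G.IsPairing x f) [Fintype {s // G.vert s ≠ x}] (X : Set (V × Bool)) :
    (elim h).d (restr x X) = G.base x X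
      + (cnt fun s => G.vert s = x ∧ G.far (s, false) ∈ X ∧ G.far (f s, false) ∉ X)
      + cnt fun s => G.vert s = x ∧ G.far (s, true) ∈ X ∧ G.far (f s, true) ∉ X := by
  classical
  let g : S × Bool → V × Bool := fun p => if G.vert (G.mate p.1) = x then
    G.far (f (G.mate p.1), xor p.2 (G.sgn p.1)) else G.far p
  have key : ∀ b, (cnt fun s : {s // G.vert s ≠ x} =>
      (elim h).near (s, b) ∈ restr x X ∧ (elim h).far (s, b) ∉ restr x X)
      = cnt fun s => G.vert s ≠ x ∧ G.near (s, b) ∈ X ∧ g (s, b) ∉ X := by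
    intro b
    rw [← cnt_subtype (fun s => G.vert s ≠ x) (fun s => G.near (s, b) ∈ X ∧ g (s, b) ∉ X)]
    refine cnt_congr fun s => ?_
    by_cases hs : G.vert (G.mate s.1) = x <;>
      simp [near, far, restr, g, elim, hs]
  have s0 : (elim h).d (restr x X) = cnt fun p : S × Bool => G.vert p.1 ≠ x ∧ G.near p ∈ X ∧
      g p ∉ X := by
    rw [cnt_prod_bool (fun p : S × Bool => G.vert p.1 ≠ x ∧ G.near p ∈ X ∧ g p ∉ X), ← key, ← key]
    exact cnt_prod_bool fun p => (elim h).near p ∈ restr x X ∧ (elim h).far p ∉ restr x X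
  have s2 := cnt_add_cnt_not (fun p : S × Bool => G.vert p.1 ≠ x ∧ G.near p ∈ X ∧ g p ∉ X)
    (fun p => G.vert (G.mate p.1) = x)
  have e1 : (cnt fun p : S × Bool => (G.vert p.1 ≠ x ∧ G.near p ∈ X ∧ g p ∉ X) ∧
      ¬ G.vert (G.mate p.1) = x) = G.base x X := by
    refine cnt_congr fun p => ?_
    by_cases hs : G.vert (G.mate p.1) = x
    · simp [hs]
    · simp only [g, hs, if_false]
      tauto
  have e2 : (cnt fun p : S × Bool => (G.vert p.1 ≠ x ∧ G.near p ∈ X ∧ g p ∉ X) ∧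
      G.vert (G.mate p.1) = x) = cnt fun p : S × Bool => G.vert p.1 = x ∧ G.far p ∈ X ∧
        G.far (f p.1, p.2) ∉ X := by
    rw [← cnt_comp_involutive G.coverMate_coverMate]
    refine cnt_congr fun p => ?_
    rw [near_coverMate]
    have h1 : G.vert (G.coverMate p).1 = G.vert (G.mate p.1) := rfl
    have h2 : G.mate (G.coverMate p).1 = p.1 := G.mate_mate p.1
    rw [h1, h2]
    by_cases hp : G.vert p.1 = x
    · have h3 : g (G.coverMate p) = G.far (f p.1, p.2) := by
        simp only [g, h2, hp, if_true]
        simp [coverMate, G.sgn_mate]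
      rw [h3]
      have := h.noloop p.1 hp
      tauto
    · tauto
  have e3 := cnt_prod_bool (fun p : S × Bool => G.vert p.1 = x ∧ G.far p ∈ X ∧
    G.far (f p.1, p.2) ∉ X)
  dsimp only at e3
  omega

end StubGraph

/-! ### Patterns on four stubs -/

/-- The number of `true` entries of a pattern. -/
def num (p : Fin 4 → Bool) : ℕ := ∑ i, (p i).toNat

/-- The three fixed-point-free involutions of the Klein four-group on `Fin 4`. -/
def pairing : Fin 3 → Fin 4 → Fin 4 := ![![1, 0, 3, 2], ![2, 3, 0, 1], ![3, 2, 1, 0]]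

/-- The number of pairs separated by a pattern. -/
def sepNum (j : Fin 3) (p : Fin 4 → Bool) : ℕ := ∑ i, (p i && !p (pairing j i)).toNat

theorem pairing_pairing : ∀ j i, pairing j (pairing j i) = i := by decide

theorem pairing_ne : ∀ j i, pairing j i ≠ i := by decide

theorem num_le_four : ∀ p, num p ≤ 4 := by decide

theorem num_not : ∀ p : Fin 4 → Bool, num (fun i => !p i) + num p = 4 := by decide

/-- A single entry is never hidden inside a pair, so for such patterns elimination costs the same as
leaving the vertex outside. -/
theorem sepNum_eq_num : ∀ j p, num p ≤ 1 → sepNum j p = num p := by decide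

theorem sepNum_not : ∀ j p, sepNum j (fun i => !p i) = sepNum j p := by decide

theorem sepNum_add_num_le : ∀ j p, sepNum j p + num p ≤ 4 := by decide

theorem eq_not_of_num : ∀ p q : Fin 4 → Bool, num p = 2 → num q = 2 →
    (∀ i, (p i && q i) = false) → ∀ i, q i = !p i := by decide

/-- Unseparated patterns of size two are pairs of the respective perfect matchings, and pairs of
different perfect matchings of four points meet in exactly one point. -/
theorem num_and_or : ∀ j k : Fin 3, j ≠ k → ∀ p q : Fin 4 → Bool, num p = 2 → num q = 2 →
    sepNum j p = 0 → sepNum k q = 0 →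
    num (fun i => p i && q i) = 1 ∧ num (fun i => p i || q i) = 3 := by decide

theorem num_or_of_disjoint : ∀ p q : Fin 4 → Bool, (∀ i, (p i && q i) = false) →
    num (fun i => p i || q i) = num p + num q := by decide

theorem num_mono : ∀ p q : Fin 4 → Bool, (∀ i, p i = true → q i = true) → num p ≤ num q := by
  decide

namespace StubGraph

variable {S V : Type*} {G : StubGraph S V}

/-! ### Cuts in terms of the patterns at a four-valent vertex -/

section Pattern

variable {x : V} (e : Fin 4 ≃ {s // G.vert s = x})

open Classical in
/-- The pairing of the four stubs at `x` of a given type. -/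
noncomputable def pairFun (j : Fin 3) (s : S) : S :=
  if hs : G.vert s = x then (e (pairing j (e.symm ⟨s, hs⟩))).1 else s

theorem pairFun_apply (j : Fin 3) (i : Fin 4) : pairFun e j (e i).1 = (e (pairing j i)).1 := by
  simp [pairFun, (e i).2]

theorem isPairing_pairFun (hl : ∀ s, G.vert s = x → G.vert (G.mate s) ≠ x) (j : Fin 3) :
    G.IsPairing x (pairFun e j) := by
  have key : ∀ s, G.vert s = x → ∃ i, s = (e i).1 := fun s hs => ⟨e.symm ⟨s, hs⟩, by simp⟩
  refine ⟨hl, ?_, ?_, ?_⟩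
  · intro s hs
    obtain ⟨i, rfl⟩ := key s hs
    rw [pairFun_apply]
    exact (e _).2
  · intro s hs
    obtain ⟨i, rfl⟩ := key s hs
    rw [pairFun_apply, pairFun_apply, pairing_pairing]
  · intro s hs
    obtain ⟨i, rfl⟩ := key s hs
    rw [pairFun_apply]
    intro h
    exact pairing_ne j i (e.injective (Subtype.ext h))

open Classical in
/-- The pattern of `X` at a lift of `x`: which edges at that lift lead into `X`. -/
noncomputable def pat (X : Set (V × Bool)) (b : Bool) : Fin 4 → Bool :=
  fun i => decide (G.far ((e i).1, b) ∈ X)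

theorem pat_eq_true {X : Set (V × Bool)} {b : Bool} {i : Fin 4} :
    pat e X b i = true ↔ G.far ((e i).1, b) ∈ X := by simp [pat]

theorem pat_inter (X Y : Set (V × Bool)) (b : Bool) :
    pat e (X ∩ Y) b = fun i => pat e X b i && pat e Y b i := by
  ext i
  rw [Bool.eq_iff_iff, Bool.and_eq_true, pat_eq_true, pat_eq_true, pat_eq_true]
  rfl

theorem pat_union (X Y : Set (V × Bool)) (b : Bool) :
    pat e (X ∪ Y) b = fun i => pat e X b i || pat e Y b i := by
  ext i
  rw [Bool.eq_iff_iff, Bool.or_eq_true, pat_eq_true, pat_eq_true, pat_eq_true]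
  rfl

theorem far_not (p : S × Bool) : G.far (p.1, !p.2) = ((G.far p).1, !(G.far p).2) := by
  simp [far]

/-- Change the membership of the two lifts of `x` in `X` to prescribed values. -/
def adj (x : V) (X : Set (V × Bool)) (α β : Prop) : Set (V × Bool) :=
  {z | (z.1 ≠ x ∧ z ∈ X) ∨ (z = (x, false) ∧ α) ∨ (z = (x, true) ∧ β)}

theorem mem_adj {X : Set (V × Bool)} {α β : Prop} {z : V × Bool} (hz : z.1 ≠ x) :
    z ∈ adj x X α β ↔ z ∈ X := by
  have h1 : z ≠ (x, false) := by rintro rfl; exact hz rfl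
  have h2 : z ≠ (x, true) := by rintro rfl; exact hz rfl
  simp [adj, hz, h1, h2]

theorem adj_false_mem (X : Set (V × Bool)) (α β : Prop) : (x, false) ∈ adj x X α β ↔ α := by
  simp [adj]

theorem adj_true_mem (X : Set (V × Bool)) (α β : Prop) : (x, true) ∈ adj x X α β ↔ β := by
  simp [adj]

theorem oneSided_adj {X : Set (V × Bool)} {α β : Prop} (hX : OneSided X) (h : ¬ (α ∧ β)) :
    OneSided (adj x X α β) := by
  rintro ⟨y, b⟩ hz hz'
  by_cases hy : y = x
  · subst hy
    cases b
    · exact h ⟨(adj_false_mem ..).1 hz, (adj_true_mem ..).1 hz'⟩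
    · exact h ⟨(adj_false_mem ..).1 hz', (adj_true_mem ..).1 hz⟩
  · rw [mem_adj hy] at hz
    rw [mem_adj hy] at hz'
    exact hX _ hz hz'

theorem pat_congr (hl : ∀ s, G.vert s = x → G.vert (G.mate s) ≠ x) {X Y : Set (V × Bool)}
    (h : ∀ z : V × Bool, z.1 ≠ x → (z ∈ X ↔ z ∈ Y)) (b : Bool) : pat e X b = pat e Y b := by
  ext i
  rw [pat, pat]
  congr 1
  rw [h]
  exact hl _ (e i).2

variable [Fintype S]

theorem base_congr {X Y : Set (V × Bool)}
    (h : ∀ z : V × Bool, z.1 ≠ x → (z ∈ X ↔ z ∈ Y)) : G.base x X = G.base x Y := by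
  refine cnt_congr fun p => and_congr_right fun hp => ?_
  rw [h (G.near p) hp.1, h (G.far p) hp.2]

theorem base_inter_add_base_union_le (X Y : Set (V × Bool)) :
    G.base x (X ∩ Y) + G.base x (X ∪ Y) ≤ G.base x X + G.base x Y := by
  classical
  simp only [base, cnt, ← Finset.sum_add_distrib]
  refine Finset.sum_le_sum fun p _ => ?_
  by_cases h0 : G.vert p.1 ≠ x ∧ G.vert (G.mate p.1) ≠ x
  · by_cases h1 : G.near p ∈ X <;> by_cases h2 : G.near p ∈ Y <;> by_cases h3 : G.far p ∈ X <;>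
      by_cases h4 : G.far p ∈ Y <;> simp [h0, h1, h2, h3, h4]
  · simp [h0]

theorem cnt_stubs (p : S → Prop) (q : Fin 4 → Bool) (h : ∀ i, p (e i).1 ↔ q i = true) :
    (cnt fun s => G.vert s = x ∧ p s) = num q := by
  classical
  rw [cnt_of_equiv e, num, cnt]
  refine Finset.sum_congr rfl fun i _ => ?_
  by_cases hi : q i = true
  · simp [h i, hi]
  · simp [h i, hi]

open Classical in
theorem d_eq_num (hl : ∀ s, G.vert s = x → G.vert (G.mate s) ≠ x) (X : Set (V × Bool)) :
    G.d X = G.base x X + (if (x, false) ∈ X then 4 - num (pat e X false) else num (pat e X false))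
      + (if (x, true) ∈ X then 4 - num (pat e X true) else num (pat e X true)) := by
  rw [d_eq_base_add hl]
  have h1 : ∀ b, (cnt fun s => G.vert s = x ∧ G.far (s, b) ∈ X) = num (pat e X b) :=
    fun b => cnt_stubs e _ _ fun i => (pat_eq_true e).symm
  have h2 : ∀ b, (cnt fun s => G.vert s = x ∧ G.far (s, b) ∉ X) = 4 - num (pat e X b) := by
    intro b
    have := num_not (pat e X b)
    rw [cnt_stubs e _ (fun i => !pat e X b i) fun i => by rw [← pat_eq_true e]; simp]
    omega
  rw [h1, h1, h2, h2]

open Classical in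
-- Neither `base` nor the patterns depend on the lifts of `x` in the set, so the four placements of
-- these lifts can be compared directly; the best one costs `min n (4 - n)` at a lift with pattern
-- of size `n`.
theorem d_adj (hl : ∀ s, G.vert s = x → G.vert (G.mate s) ≠ x) (X : Set (V × Bool)) (α β : Prop) :
    G.d (adj x X α β) = G.base x X + (if α then 4 - num (pat e X false) else num (pat e X false))
      + (if β then 4 - num (pat e X true) else num (pat e X true)) := by
  have h0 : ∀ z : V × Bool, z.1 ≠ x → (z ∈ adj x X α β ↔ z ∈ X) := fun z hz => mem_adj hz
  rw [d_eq_num e hl, pat_congr e hl h0, pat_congr e hl h0, base_congr h0]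
  simp only [adj_false_mem, adj_true_mem]

/-- The cut of `X` after the elimination of `x` with pairing `j`. -/
noncomputable def dSplit (j : Fin 3) (X : Set (V × Bool)) : ℕ :=
  G.base x X + sepNum j (pat e X false) + sepNum j (pat e X true)

theorem d_elim_pairFun (hl : ∀ s, G.vert s = x → G.vert (G.mate s) ≠ x) (j : Fin 3)
    [Fintype {s // G.vert s ≠ x}] (X : Set (V × Bool)) :
    (elim (isPairing_pairFun e hl j)).d (restr x X) = dSplit e j X := by
  rw [d_elim, dSplit]
  have h1 : ∀ b, (cnt fun s => G.vert s = x ∧ G.far (s, b) ∈ X ∧ G.far (pairFun e j s, b) ∉ X)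
      = sepNum j (pat e X b) := by
    intro b
    rw [cnt_stubs e _ (fun i => pat e X b i && !pat e X b (pairing j i))]
    · rfl
    · intro i
      rw [pairFun_apply]
      simp [pat]
  rw [h1, h1]

/-! ### Uncrossing for the cuts after elimination -/

section dSplit

variable (hl : ∀ s, G.vert s = x → G.vert (G.mate s) ≠ x) (j : Fin 3) (X Y : Set (V × Bool))
include hl

theorem dSplit_congr {X Y : Set (V × Bool)} (h : ∀ z : V × Bool, z.1 ≠ x → (z ∈ X ↔ z ∈ Y)) :
    dSplit e j X = dSplit e j Y := by
  rw [dSplit, dSplit, base_congr h, pat_congr e hl h, pat_congr e hl h]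

theorem dSplit_inter_add_union_le :
    dSplit e j (X ∩ Y) + dSplit e j (X ∪ Y) ≤ dSplit e j X + dSplit e j Y := by
  classical
  simp only [← d_elim_pairFun e hl]
  exact d_inter_add_d_union_le _ (restr x X) (restr x Y)

theorem dSplit_diff_add_diff_le :
    dSplit e j (X \ Y) + dSplit e j (Y \ X) ≤ dSplit e j X + dSplit e j Y := by
  classical
  simp only [← d_elim_pairFun e hl]
  exact d_diff_add_d_diff_le _ (restr x X) (restr x Y)

theorem dSplit_star : dSplit e j (star X) = dSplit e j X := by
  classical
  simp only [← d_elim_pairFun e hl]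
  exact d_star _ (restr x X)

theorem dSplit_compl : dSplit e j Xᶜ = dSplit e j X := by
  classical
  simp only [← d_elim_pairFun e hl]
  exact d_compl _ (restr x X)

theorem dSplit_oneSidedPart_le : dSplit e j (oneSidedPart X) ≤ dSplit e j X := by
  classical
  simp only [← d_elim_pairFun e hl]
  exact d_oneSidedPart_le _ (restr x X)

end dSplit

end Pattern

end StubGraph

/-- Pairs contained in the pattern contribute an even number of entries. -/
theorem sepNum_mod_two : ∀ j p, sepNum j p % 2 = num p % 2 := by decide

/-- Elimination is cheaper than both positions of the vertex only for a pattern that consists of one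
of the pairs. This makes a violated condition single out a pairing. -/
theorem num_eq_two_of_lt : ∀ j p, sepNum j p < num p → sepNum j p < 4 - num p →
    num p = 2 ∧ sepNum j p = 0 := by decide

theorem num_and_add_num_or : ∀ p q : Fin 4 → Bool,
    num (fun i => p i && q i) + num (fun i => p i || q i) = num p + num q := by decide

/-- A substitute for submodularity when two sets are measured with different pairings: placing the
vertex optimally for the intersection and for the union loses at most two. -/
theorem min_num_and_add_min_num_or_le : ∀ j k : Fin 3, j ≠ k → ∀ p q, min (num fun i => p i && q i)
      (4 - num fun i => p i && q i) + min (num fun i => p i || q i) (4 - num fun i => p i || q i)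
    ≤ sepNum j p + sepNum k q + 2 := by decide +kernel

theorem eq_of_num_eq : ∀ p t : Fin 4 → Bool, (∀ i, p i = true → t i = true) → num p = num t →
    p = t := by decide

/-- Two points are paired by only one of the three pairings. -/
theorem not_sepNum_eq_zero : ∀ j k : Fin 3, j ≠ k → ∀ t, num t = 2 → sepNum j t = 0 →
    sepNum k t ≠ 0 := by decide

/-! ### Rooted graphs and the obstructions to eliminating a vertex -/

namespace StubGraph

variable {S V : Type*} {G : StubGraph S V}

/-- The two lifts of every vertex of `W`. -/
def lifts (W : Set V) : Set (V × Bool) := {z | z.1 ∈ W}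

theorem mem_lifts {W : Set V} {z : V × Bool} : z ∈ lifts W ↔ z.1 ∈ W := Iff.rfl

theorem oneSided_pat {x : V} (e : Fin 4 ≃ {s // G.vert s = x}) {X : Set (V × Bool)}
    (hX : OneSided X) (i : Fin 4) : (pat e X false i && pat e X true i) = false := by
  rw [Bool.eq_false_iff, Ne, Bool.and_eq_true, pat_eq_true, pat_eq_true]
  rintro ⟨h1, h2⟩
  have := hX _ h1
  rw [← far_not] at this
  exact this h2

theorem pat_lifts {x : V} (e : Fin 4 ≃ {s // G.vert s = x}) (W : Set V) :
    pat e (lifts W) true = pat e (lifts W) false := rfl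

variable [Fintype S]

theorem even_cnt_vert [Fintype V] (hdeg : ∀ x, Even (G.deg x)) (p : V → Prop) :
    Even (cnt fun s => p (G.vert s)) := by
  rw [cnt_fiber G.vert]
  refine Finset.even_sum _ fun x _ => ?_
  by_cases hx : p x
  · have h0 : (cnt fun s : S => G.vert s = x ∧ p (G.vert s)) = G.deg x := by
      refine cnt_congr fun s => ?_
      simp only [and_iff_left_iff_imp]
      rintro rfl
      exact hx
    rw [h0]
    exact hdeg x
  · have h0 : (cnt fun s : S => G.vert s = x ∧ p (G.vert s)) = 0 := by
      refine cnt_eq_zero.2 ?_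
      rintro s ⟨rfl, h⟩
      exact hx h
    rw [h0]
    exact Even.zero

theorem d_lifts (W : Set V) :
    G.d (lifts W) = 2 * cnt fun s => G.vert s ∈ W ∧ G.vert (G.mate s) ∉ W := by
  have h : G.d (lifts W) = cnt fun p : S × Bool => G.near p ∈ lifts W ∧ G.far p ∉ lifts W := rfl
  rw [h, cnt_prod_bool, two_mul]
  rfl

theorem even_cnt_cut [Fintype V] (hdeg : ∀ x, Even (G.deg x)) (W : Set V) :
    Even (cnt fun s => G.vert s ∈ W ∧ G.vert (G.mate s) ∉ W) := by
  have h1 := cnt_add_cnt_not (fun s => G.vert s ∈ W) (fun s => G.vert (G.mate s) ∈ W)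
  have h2 : Even (cnt fun s => G.vert s ∈ W ∧ G.vert (G.mate s) ∈ W) := by
    refine even_cnt_of_involution G.mate ?_ (fun s _ => G.mate_mate s) (fun s _ => G.mate_ne s)
    rintro s ⟨h, h'⟩
    exact ⟨h', by rwa [G.mate_mate]⟩
  have h3 := even_cnt_vert hdeg (fun x => x ∈ W)
  rw [← h1] at h3
  exact (Nat.even_add.1 h3).1 h2

/-- The cut of `W` in the graph itself is even, and each of its edges has two lifts. -/
theorem four_dvd_d_lifts [Fintype V] (hdeg : ∀ x, Even (G.deg x)) (W : Set V) :
    4 ∣ G.d (lifts W) := by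
  obtain ⟨k, hk⟩ := even_cnt_cut hdeg W
  rw [d_lifts, hk]
  exact ⟨k, by ring⟩

theorem e_lifts_singleton {x : V} (e : Fin 4 ≃ {s // G.vert s = x}) (X : Set (V × Bool)) :
    G.e (lifts {x}) X = num (pat e X false) + num (pat e X true) := by
  have h : G.e (lifts {x}) X = cnt fun p : S × Bool => G.vert p.1 = x ∧ G.far p ∈ X := rfl
  rw [h, cnt_prod_bool, ← cnt_stubs e (fun s => G.far (s, false) ∈ X),
    ← cnt_stubs e (fun s => G.far (s, true) ∈ X)]
  · exact fun i => (pat_eq_true e).symm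
  · exact fun i => (pat_eq_true e).symm

/-- Expands cuts along a partition into blocks, so that relations between cuts become linear
arithmetic in the numbers of edges between blocks. -/
theorem e_fiber {n : ℕ} (ℓ : V × Bool → Fin n) (I J : Finset (Fin n)) :
    G.e {z | ℓ z ∈ I} {z | ℓ z ∈ J}
      = ∑ i ∈ I, ∑ j ∈ J, G.e {z | ℓ z = i} {z | ℓ z = j} := by
  classical
  simp only [e, cnt, Set.mem_ofPred_eq]
  rw [Finset.sum_congr rfl fun i _ => Finset.sum_comm, Finset.sum_comm]
  refine Finset.sum_congr rfl fun p _ => ?_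
  by_cases h1 : ℓ (G.near p) ∈ I
  · by_cases h2 : ℓ (G.far p) ∈ J
    · rw [Finset.sum_eq_single (ℓ (G.near p)), Finset.sum_eq_single (ℓ (G.far p))]
      · simp [h1, h2]
      · intro j _ hj
        simp [hj.symm]
      · exact fun h => absurd h2 h
      · intro i _ hi
        simp [hi.symm]
      · exact fun h => absurd h1 h
    · simp only [h1, h2, and_false, if_false]
      symm
      refine Finset.sum_eq_zero fun i _ => Finset.sum_eq_zero fun j hj => ?_
      rw [if_neg]
      rintro ⟨-, rfl⟩
      exact h2 hj
  · simp only [h1, false_and, if_false]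
    symm
    refine Finset.sum_eq_zero fun i hi => Finset.sum_eq_zero fun j hj => ?_
    rw [if_neg]
    rintro ⟨rfl, -⟩
    exact h1 hi

/-- A four-regular signed graph except for a root `v` of valency six, with the connectivity
conditions under which it splits into three odd closed trails through `v`. -/
structure IsRooted [Fintype V] (G : StubGraph S V) (v : V) : Prop where
  deg_root : G.deg v = 6
  deg_ne : ∀ x, x ≠ v → G.deg x = 4
  -- `sep` leaves room for six trails between the lifts of the root, two for each odd closed trail.
  -- In `conn` the bound 8 means four edges, as each edge has two lifts. `par` says that the number
  -- of negative edges is odd under every switching.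
  sep : ∀ X, (v, false) ∈ X → (v, true) ∉ X → 6 ≤ G.d X
  conn : ∀ W : Set V, W.Nonempty → v ∉ W → 8 ≤ G.d (lifts W)
  par : ∀ c : V → Bool, G.d {z | z.2 = c z.1} % 4 = 2

namespace IsRooted

variable [Fintype V] {v x : V}

theorem even_deg (h : G.IsRooted v) (y : V) : Even (G.deg y) := by
  by_cases hy : y = v
  · rw [hy, h.deg_root]; decide
  · rw [h.deg_ne y hy]; decide

/-- All four half-edges at `x` are needed for the four edges that leave `{x}`. -/
theorem noloop (h : G.IsRooted v) (hx : x ≠ v) (s : S) (hs : G.vert s = x) :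
    G.vert (G.mate s) ≠ x := by
  intro hs'
  have h1 := h.conn {x} ⟨x, rfl⟩ (fun h => hx h.symm)
  rw [d_lifts] at h1
  have h2 := cnt_add_cnt_not (fun s => G.vert s = x) (fun s => G.vert (G.mate s) = x)
  have h3 : 0 < cnt fun s => G.vert s = x ∧ G.vert (G.mate s) = x := cnt_pos.2 ⟨s, hs, hs'⟩
  have h4 := h.deg_ne x hx
  rw [deg] at h4
  simp only [Set.mem_singleton_iff] at h1
  omega

theorem exists_equiv (h : G.IsRooted v) (hx : x ≠ v) :
    Nonempty (Fin 4 ≃ {s // G.vert s = x}) := by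
  classical
  have h4 := h.deg_ne x hx
  rw [deg, cnt_eq_card, ← Fintype.card_subtype] at h4
  exact ⟨(Fintype.equivFinOfCardEq h4).symm⟩

variable (e : Fin 4 ≃ {s // G.vert s = x})

/-- At most one pairing violates the connectivity condition. -/
theorem conn_unique (h : G.IsRooted v) (hx : x ≠ v) {j k : Fin 3} (hjk : j ≠ k) {A B : Set V}
    (hA : x ∉ A) (hA0 : A.Nonempty) (hAv : v ∉ A) (hA8 : dSplit e j (lifts A) < 8)
    (hB : x ∉ B) (hB0 : B.Nonempty) (hBv : v ∉ B) (hB8 : dSplit e k (lifts B) < 8) : False := by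
  classical
  have hl := h.noloop hx
  -- The first two bounds are the connectivity condition for `W` and for `insert x W`; the residue
  -- comes from `four_dvd_d_lifts`.
  have key : ∀ W : Set V, x ∉ W → v ∉ W → (W.Nonempty → 8 ≤ G.base x (lifts W) +
      2 * num (pat e (lifts W) false)) ∧
      8 ≤ G.base x (lifts W) + 2 * (4 - num (pat e (lifts W) false)) ∧
      (G.base x (lifts W) + 2 * num (pat e (lifts W) false)) % 4 = 0 := by
    intro W hxW hvW
    have e1 : G.d (lifts W) = G.base x (lifts W) + 2 * num (pat e (lifts W) false) := by
      rw [d_eq_num e hl, if_neg, if_neg, pat_lifts]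
      · ring
      · exact hxW
      · exact hxW
    have e2 : G.d (lifts (insert x W)) = G.base x (lifts W) +
        2 * (4 - num (pat e (lifts W) false)) := by
      have h0 : ∀ z : V × Bool, z.1 ≠ x → (z ∈ lifts (insert x W) ↔ z ∈ lifts W) := by
        intro z hz
        simp [mem_lifts, hz]
      rw [d_eq_num e hl, if_pos, if_pos, pat_lifts, base_congr h0, pat_congr e hl h0]
      · ring
      · exact Set.mem_insert _ _
      · exact Set.mem_insert _ _
    refine ⟨fun hW => ?_, ?_, ?_⟩
    · rw [← e1]
      exact h.conn W hW hvW
    · rw [← e2]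
      exact h.conn _ ⟨x, Set.mem_insert _ _⟩ (by simp [hvW, hx.symm])
    · rw [← e1]
      exact Nat.mod_eq_zero_of_dvd (four_dvd_d_lifts h.even_deg W)
  -- A violation is cheaper than both positions of `x`, so the pattern is a pair of `j`; then `base`
  -- is at least 4, less than 8 and divisible by 4.
  have ext : ∀ (j : Fin 3) (W : Set V), x ∉ W → W.Nonempty → v ∉ W → dSplit e j (lifts W) < 8 →
      num (pat e (lifts W) false) = 2 ∧ sepNum j (pat e (lifts W) false) = 0 ∧
      G.base x (lifts W) = 4 := by
    intro j W hW hW0 hWv hW8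
    obtain ⟨k1, k2, k3⟩ := key W hW hWv
    have k1 := k1 hW0
    rw [dSplit, pat_lifts] at hW8
    obtain ⟨h1, h2⟩ := num_eq_two_of_lt j (pat e (lifts W) false) (by omega) (by omega)
    exact ⟨h1, h2, by omega⟩
  obtain ⟨a1, a2, a3⟩ := ext j A hA hA0 hAv hA8
  obtain ⟨b1, b2, b3⟩ := ext k B hB hB0 hBv hB8
  obtain ⟨n1, n2⟩ := num_and_or j k hjk _ _ a1 b1 a2 b2
  have hI : lifts (A ∩ B) = lifts A ∩ lifts B := rfl
  have hU : lifts (A ∪ B) = lifts A ∪ lifts B := rfl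
  rw [← pat_inter, ← hI] at n1
  rw [← pat_union, ← hU] at n2
  have sub := base_inter_add_base_union_le (G := G) (x := x) (lifts A) (lifts B)
  rw [← hI, ← hU] at sub
  have hne : (A ∩ B).Nonempty := by
    by_contra h0
    rw [Set.not_nonempty_iff_eq_empty] at h0
    have : num (pat e (lifts (A ∩ B)) false) = 0 := by
      rw [h0]
      have : pat e (lifts (∅ : Set V)) false = fun _ => false := by
        ext i
        simp [pat, lifts]
      rw [this]
      rfl
    omega
  -- The pattern sizes 1 and 3 force both bases to be at least 6, with `x` outside the intersection
  -- and inside the union; but submodularity bounds their sum by 4 + 4.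
  obtain ⟨k1, -, -⟩ := key (A ∩ B) (fun h => hA h.1) (fun h => hAv h.1)
  obtain ⟨-, k2, -⟩ := key (A ∪ B) (by rintro (h | h); exacts [hA h, hB h])
    (by rintro (h | h); exacts [hAv h, hBv h])
  have := k1 hne
  omega

theorem six_le_d_adj (h : G.IsRooted v) (hx : x ≠ v) {X : Set (V × Bool)} (hX : (v, false) ∈ X)
    (hX' : (v, true) ∉ X) (α β : Prop) : 6 ≤ G.d (adj x X α β) :=
  h.sep _ ((mem_adj hx.symm).2 hX) fun h' => hX' ((mem_adj hx.symm).1 h')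

theorem even_dSplit (h : G.IsRooted v) (hx : x ≠ v) (j : Fin 3) (X : Set (V × Bool)) :
    Even (dSplit e j X) := by
  classical
  rw [← d_elim_pairFun e (h.noloop hx)]
  refine even_d _ (fun y => ?_) _
  rw [deg_elim]
  exact h.even_deg _

/-- A set violating the separation condition after elimination can be uncrossed with `T` and `star
T`. The result is a one-sided set containing `T`, and maximality of `T` makes every one-sided
placement of `x` cost at least eight. Only a pair of `j` at each lift of `x`, and no slack
elsewhere, reconciles this with the violation. -/
theorem exists_extension (h : G.IsRooted v) (hx : x ≠ v) {T : Set (V × Bool)}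
    (hvT : (v, false) ∈ T) (hT1 : OneSided T) (hT6 : G.d T = 6)
    (hmax : ∀ Y, T ⊆ Y → OneSided Y → G.d Y = 6 → Y ⊆ T) (hxT : ∀ z ∈ T, z.1 ≠ x)
    (j : Fin 3) {X : Set (V × Bool)} (hX : (v, false) ∈ X) (hX' : (v, true) ∉ X)
    (hX6 : dSplit e j X < 6) :
    ∃ Y, T ⊆ Y ∧ OneSided Y ∧ (∀ z ∈ Y, z.1 ≠ x) ∧ G.base x Y = 4 ∧
      ∀ b, num (pat e Y b) = 2 ∧ sepNum j (pat e Y b) = 0 := by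
  classical
  have hl := h.noloop hx
  have hvT' : (v, true) ∉ T := hT1 _ hvT
  have hadj : ∀ Z : Set (V × Bool), (∀ z ∈ Z, z.1 ≠ x) → adj x Z False False = Z := by
    intro Z hZ
    ext z
    simp only [adj, and_false, or_false, Set.mem_ofPred_eq]
    exact ⟨fun h => h.2, fun h => ⟨hZ z h, h⟩⟩
  have dT := d_adj e hl T False False
  rw [hadj T hxT, hT6] at dT
  simp only [if_false] at dT
  -- With two edges from `T` to a lift of `x`, adding that lift would not raise the cut, against the
  -- maximality of `T`.
  have hn0 : num (pat e T false) ≤ 1 := by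
    by_contra hn
    have h1 := d_adj e hl T True False
    have h2 := h.six_le_d_adj hx hvT hvT' True False
    simp only [if_true, if_false] at h1
    have h3 := hmax (adj x T True False) (fun z hz => (mem_adj (hxT z hz)).2 hz)
      (oneSided_adj hT1 (by simp)) (by omega)
    exact hxT (x, false) (h3 ((adj_false_mem ..).2 trivial)) rfl
  have hn1 : num (pat e T true) ≤ 1 := by
    by_contra hn
    have h1 := d_adj e hl T False True
    have h2 := h.six_le_d_adj hx hvT hvT' False True
    simp only [if_true, if_false] at h1
    have h3 := hmax (adj x T False True) (fun z hz => (mem_adj (hxT z hz)).2 hz)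
      (oneSided_adj hT1 (by simp)) (by omega)
    exact hxT (x, true) (h3 ((adj_true_mem ..).2 trivial)) rfl
  -- Patterns of subsets of `T` have at most one entry, so the elimination does not change their
  -- cuts.
  have small : ∀ Z : Set (V × Bool), Z ⊆ T →
      dSplit e j Z = G.d (adj x Z False False) := by
    intro Z hZ
    have hp : ∀ b, num (pat e Z b) ≤ num (pat e T b) := by
      intro b
      refine num_mono _ _ fun i hi => ?_
      rw [pat_eq_true] at hi ⊢
      exact hZ hi
    have p0 := hp false
    have p1 := hp true
    rw [dSplit, d_adj e hl, sepNum_eq_num, sepNum_eq_num]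
    · simp
    · omega
    · omega
  have small6 : ∀ Z : Set (V × Bool), Z ⊆ T → (v, false) ∈ Z → 6 ≤ dSplit e j Z := by
    intro Z hZ hv
    rw [small Z hZ]
    exact h.six_le_d_adj hx hv (fun h => hvT' (hZ h)) _ _
  have dsT : dSplit e j T = 6 := by rw [small T subset_rfl, hadj T hxT, hT6]
  -- Uncrossing with `T` passes to `X ∪ T`, and uncrossing with `star T` then removes the lifts
  -- opposite to `T`. Each time the set given up is, up to `star`, a subset of `T` that contains
  -- `(v, false)`, and so costs at least six.
  have h1 := dSplit_inter_add_union_le e hl j X T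
  have h2 := small6 (X ∩ T) Set.inter_subset_right ⟨hX, hvT⟩
  have h3 := dSplit_diff_add_diff_le e hl j (X ∪ T) (star T)
  rw [dSplit_star e hl] at h3
  have h4 : dSplit e j (star T \ (X ∪ T)) = dSplit e j (T \ star (X ∪ T)) := by
    rw [← dSplit_star e hl]
    congr 1
    ext z
    simp [mem_star]
  have h5 := small6 (T \ star (X ∪ T)) Set.sdiff_subset
    ⟨hvT, by rintro (h | h); exacts [hX' h, hvT' h]⟩
  have h6 := dSplit_oneSidedPart_le e hl j ((X ∪ T) \ star T)
  set X4 := oneSidedPart ((X ∪ T) \ star T) with hX4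
  have hTX4 : T ⊆ X4 := by
    intro z hz
    refine ⟨⟨Or.inr hz, hT1 z hz⟩, ?_⟩
    rintro ⟨-, h⟩
    apply h
    rw [mem_star]
    simpa using hz
  have hX41 : OneSided X4 := oneSided_oneSidedPart _
  set Y := adj x X4 False False with hY
  have hYX4 : ∀ z : V × Bool, z.1 ≠ x → (z ∈ Y ↔ z ∈ X4) := fun z hz => mem_adj hz
  have hxY : ∀ z ∈ Y, z.1 ≠ x := by
    intro z hz
    simp only [hY, adj, and_false, or_false] at hz
    exact hz.1
  have hTY : T ⊆ Y := fun z hz => (hYX4 z (hxT z hz)).2 (hTX4 hz)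
  have hY1 : OneSided Y := oneSided_adj hX41 (by simp)
  have hY6 : dSplit e j Y < 6 := by
    rw [dSplit_congr e hl j hYX4]
    omega
  have hvY : (v, false) ∈ Y := hTY hvT
  have hvY' : (v, true) ∉ Y := hY1 _ hvY
  -- Cuts are even and at least six. A cut of exactly six would give `Y = T` by maximality, but `T`
  -- costs six after elimination and `Y` costs less.
  have big : ∀ α β : Prop, ¬ (α ∧ β) → 8 ≤ G.d (adj x Y α β) := by
    intro α β hαβ
    have b1 := h.six_le_d_adj hx hvY hvY' α β
    have b2 : Even (G.d (adj x Y α β)) := even_d _ h.even_deg _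
    by_contra hlt
    have b3 : G.d (adj x Y α β) = 6 := by
      obtain ⟨k, hk⟩ := b2
      omega
    have b4 := hmax _ (fun z hz => (mem_adj (hxT z hz)).2 (hTY hz)) (oneSided_adj hY1 hαβ) b3
    have b5 : Y = T := by
      refine Set.Subset.antisymm (fun z hz => b4 ((mem_adj (hxY z hz)).2 hz)) hTY
    rw [b5, dsT] at hY6
    exact lt_irrefl _ hY6
  have g1 := big False False (by simp)
  have g2 := big True False (by simp)
  have g3 := big False True (by simp)
  have ev : Even (G.d (adj x Y False False)) := even_d _ h.even_deg _
  rw [d_adj e hl] at g1 g2 g3 ev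
  simp only [if_true, if_false] at g1 g2 g3 ev
  have hdis := num_or_of_disjoint _ _ (oneSided_pat e hY1)
  have hle := num_le_four (fun i => pat e Y false i || pat e Y true i)
  rw [dSplit] at hY6
  have m0 := sepNum_mod_two j (pat e Y false)
  have m1 := sepNum_mod_two j (pat e Y true)
  obtain ⟨k, hk⟩ := ev
  -- The disjoint patterns have together at most four entries, so `base` is at least 4; by parity
  -- the eliminated cut is at most 4, hence `base` is 4 and nothing is separated. The placements of
  -- `x` then force both pattern sizes to be 2.
  refine ⟨Y, hTY, hY1, hxY, by omega, ?_⟩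
  intro b
  cases b <;> constructor <;> omega

end IsRooted

end StubGraph

open Classical in
/-- The index of the first of five propositions that holds, or `5`. -/
noncomputable def label (a b c d e : Prop) : Fin 6 :=
  if a then 0 else if b then 1 else if c then 2 else if d then 3 else if e then 4 else 5

theorem label_eq_iff {a b c d e : Prop} (ab : a → ¬ b) (ac : a → ¬ c) (ad : a → ¬ d)
    (ae : a → ¬ e) (bc : b → ¬ c) (bd : b → ¬ d) (be : b → ¬ e) (cd : c → ¬ d) (ce : c → ¬ e)
    (de : d → ¬ e) : (label a b c d e = 0 ↔ a) ∧ (label a b c d e = 1 ↔ b) ∧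
      (label a b c d e = 2 ↔ c) ∧ (label a b c d e = 3 ↔ d) ∧ (label a b c d e = 4 ↔ e) := by
  unfold label
  by_cases ha : a
  · simp [ha, ab ha, ac ha, ad ha, ae ha]
  by_cases hb : b
  · simp [ha, hb, bc hb, bd hb, be hb]
  by_cases hc : c
  · simp [ha, hb, hc, cd hc, ce hc]
  by_cases hd : d
  · simp [ha, hb, hc, hd, de hd]
  by_cases he : e
  · simp [ha, hb, hc, hd, he]
  · simp [ha, hb, hc, hd, he]

/-! ### Uniqueness of the pairing that violates separation -/

namespace StubGraph

variable {S V : Type*} {G : StubGraph S V} [Fintype S]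

namespace IsRooted

variable [Fintype V] {v x : V} (e : Fin 4 ≃ {s // G.vert s = x})

/-- The case of `sep_unique` where both lifts of `x` are outside a maximal tight set. -/
theorem sep_unique_of_notMem (h : G.IsRooted v) (hx : x ≠ v) {T : Set (V × Bool)}
    (hvT : (v, false) ∈ T) (hT1 : OneSided T) (hT6 : G.d T = 6)
    (hmax : ∀ Y, T ⊆ Y → OneSided Y → G.d Y = 6 → Y ⊆ T) (hxT : ∀ z ∈ T, z.1 ≠ x)
    {j k : Fin 3} (hjk : j ≠ k) {A B : Set (V × Bool)}
    (hA : (v, false) ∈ A) (hA' : (v, true) ∉ A) (hA6 : dSplit e j A < 6)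
    (hB : (v, false) ∈ B) (hB' : (v, true) ∉ B) (hB6 : dSplit e k B < 6) : False := by
  classical
  have hl := h.noloop hx
  obtain ⟨Y, hTY, hY1, hxY, hYb, hYn⟩ :=
    h.exists_extension e hx hvT hT1 hT6 hmax hxT j hA hA' hA6
  obtain ⟨Z, hTZ, hZ1, hxZ, hZb, hZn⟩ :=
    h.exists_extension e hx hvT hT1 hT6 hmax hxT k hB hB' hB6
  have hvY' : (v, true) ∉ Y := hY1 _ (hTY hvT)
  have hvZ' : (v, true) ∉ Z := hZ1 _ (hTZ hvT)
  have hno : ∀ X : Set (V × Bool), (∀ z ∈ X, z.1 ≠ x) → G.d X = G.base x X +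
      num (pat e X false) + num (pat e X true) := by
    intro X hX
    rw [d_eq_num e hl, if_neg fun h => hX _ h rfl, if_neg fun h => hX _ h rfl]
  have pI : ∀ b, num (pat e (Y ∩ Z) b) = 1 ∧ num (pat e (Y ∪ Z) b) = 3 := by
    intro b
    rw [pat_inter, pat_union]
    exact num_and_or j k hjk _ _ (hYn b).1 (hZn b).1 (hYn b).2 (hZn b).2
  -- The intersection with `x` outside, and the union with both lifts of `x` inside, each exceed
  -- their base by 1 + 1. So both bases are at least 4, and they sum to at most 8: both sets are
  -- left by exactly six edges. The second is not one-sided, so maximality of `T` is applied to its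
  -- one-sided part.
  have sub := base_inter_add_base_union_le (G := G) (x := x) Y Z
  have dI := hno (Y ∩ Z) fun z hz => hxY z hz.1
  rw [(pI false).1, (pI true).1] at dI
  have dI6 := h.sep (Y ∩ Z) ⟨hTY hvT, hTZ hvT⟩ fun h => hvY' h.1
  have dU := d_adj e hl (Y ∪ Z) True True
  rw [(pI false).2, (pI true).2] at dU
  simp only [if_true] at dU
  have hU' : (v, true) ∉ Y ∪ Z := by rintro (h | h); exacts [hvY' h, hvZ' h]
  have dU6 := h.six_le_d_adj hx (X := Y ∪ Z) (Or.inl (hTY hvT)) hU' True True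
  have hIT : Y ∩ Z ⊆ T := hmax _ (fun z hz => ⟨hTY hz, hTZ hz⟩)
    (fun z hz hz' => hY1 z hz.1 hz'.1) (by omega)
  set U := adj x (Y ∪ Z) True True with hUdef
  have hU : ∀ z : V × Bool, z.1 ≠ x → (z ∈ U ↔ z ∈ Y ∪ Z) := fun z hz => mem_adj hz
  have hTP : T ⊆ oneSidedPart U := by
    intro z hz
    refine ⟨(hU z (hxT z hz)).2 (Or.inl (hTY hz)), fun hz' => ?_⟩
    rw [mem_star, hU _ (by exact hxT z hz)] at hz'
    rcases hz' with hz' | hz'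
    · exact hY1 z (hTY hz) hz'
    · exact hZ1 z (hTZ hz) hz'
  have hP6 := h.sep (oneSidedPart U) (hTP hvT) (oneSided_oneSidedPart U _ (hTP hvT))
  have hP := G.d_oneSidedPart_le U
  have hPT : oneSidedPart U ⊆ T := hmax _ hTP (oneSided_oneSidedPart U) (by omega)
  -- the two sets differ from `T` by opposite lifts of the same set
  set W := Y \ T with hW
  have hYW : Y = T ∪ W := by
    rw [hW, Set.union_sdiff_cancel hTY]
  -- The one-sided part of `U` lies in `T`, so anything beyond `T` occurs together with its opposite
  -- lift; as `Y` and `Z` are one-sided, the two lifts belong to different sets.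
  have swap : ∀ z, z ∈ Y ∪ Z → z ∉ T → (z.1, !z.2) ∈ Y ∪ Z := by
    intro z hz hzT
    have hzx : z.1 ≠ x := by rcases hz with hz | hz; exacts [hxY z hz, hxZ z hz]
    by_contra hs
    apply hzT
    apply hPT
    refine ⟨(hU z hzx).2 hz, ?_⟩
    rw [mem_star, hU _ (by exact hzx)]
    exact hs
  have hZW : Z = T ∪ star W := by
    ext z
    constructor
    · intro hz
      by_cases hzT : z ∈ T
      · exact Or.inl hzT
      · right
        rw [mem_star]
        rcases swap z (Or.inr hz) hzT with h1 | h1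
        · exact ⟨h1, fun h2 => hZ1 z hz (hTZ h2)⟩
        · exact absurd h1 (hZ1 z hz)
    · rintro (hz | hz)
      · exact hTZ hz
      · rw [mem_star] at hz
        have h1 := swap _ (Or.inl hz.1) hz.2
        simp only [Bool.not_not] at h1
        rcases h1 with h1 | h1
        · have := hY1 _ hz.1
          simp only [Bool.not_not] at this
          exact absurd h1 this
        · exact h1
  have hWY : W ⊆ Y := Set.sdiff_subset
  have hW1 : OneSided W := fun z hz hz' => hY1 z (hWY hz) (hWY hz')
  have hTW : ∀ z ∈ W, z ∉ T := fun z hz => hz.2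
  have hTsW : ∀ z ∈ W, (z.1, !z.2) ∉ T := fun z hz hz' => hY1 z (hWY hz) (hTY hz')
  have hxW : ∀ z ∈ W, z.1 ≠ x := fun z hz => hxY z (hWY hz)
  have hIeq : Y ∩ Z = T := Set.Subset.antisymm hIT fun z hz => ⟨hTY hz, hTZ hz⟩
  have nT : ∀ b, num (pat e T b) = 1 := fun b => by rw [← hIeq]; exact (pI b).1
  have nW : ∀ b, num (pat e W b) = 1 := by
    intro b
    have h1 := (hYn b).1
    rw [hYW, pat_union, num_or_of_disjoint, nT] at h1
    · omega
    · intro i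
      rw [Bool.eq_false_iff, Ne, Bool.and_eq_true, pat_eq_true, pat_eq_true]
      rintro ⟨h1, h2⟩
      exact hTW _ h2 h1
  have dY : G.d Y = 8 := by rw [hno Y hxY, hYb, (hYn _).1, (hYn _).1]
  have dZ : G.d Z = 8 := by rw [hno Z hxZ, hZb, (hZn _).1, (hZn _).1]
  -- the partition of the double cover into blocks
  let ℓ : V × Bool → Fin 6 := fun z =>
    label (z ∈ T) ((z.1, !z.2) ∈ T) (z ∈ W) ((z.1, !z.2) ∈ W) (z.1 = x)
  have hℓ : ∀ z, (ℓ z = 0 ↔ z ∈ T) ∧ (ℓ z = 1 ↔ (z.1, !z.2) ∈ T) ∧ (ℓ z = 2 ↔ z ∈ W) ∧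
      (ℓ z = 3 ↔ (z.1, !z.2) ∈ W) ∧ (ℓ z = 4 ↔ z.1 = x) := by
    intro z
    refine label_eq_iff (hT1 z) (fun h h' => hTW z h' h) (fun h h' => ?_) (hxT z)
      (fun h h' => hTsW z h' h) (fun h h' => hTW _ h' h) (fun h => hxT (z.1, !z.2) h) (hW1 z) (hxW z)
      (fun h => hxW (z.1, !z.2) h)
    have := hTsW _ h'
    simp only [Bool.not_not] at this
    exact this h
  have ℓT := fun z => (hℓ z).1
  have ℓT' := fun z => (hℓ z).2.1
  have ℓW := fun z => (hℓ z).2.2.1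
  have ℓW' := fun z => (hℓ z).2.2.2.1
  have ℓx := fun z => (hℓ z).2.2.2.2
  have ℓs : ∀ z : V × Bool, ℓ z = 5 ↔ ℓ (z.1, !z.2) = 5 := by
    intro z
    have aux : ∀ a : Fin 6, a = 5 ↔ a ≠ 0 ∧ a ≠ 1 ∧ a ≠ 2 ∧ a ≠ 3 ∧ a ≠ 4 := by decide
    rw [aux, aux]
    simp only [Ne, ℓT, ℓT', ℓW, ℓW', ℓx, Bool.not_not]
    tauto
  have bT : {z | ℓ z = 0} = T := by ext z; simp [ℓT]
  have bT' : {z | ℓ z = 1} = star T := by ext z; simp [ℓT', mem_star]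
  have bW : {z | ℓ z = 2} = W := by ext z; simp [ℓW]
  have bW' : {z | ℓ z = 3} = star W := by ext z; simp [ℓW', mem_star]
  have bx : {z | ℓ z = 4} = lifts {x} := by ext z; simp [ℓx, mem_lifts]
  set R : Set (V × Bool) := {z | ℓ z = 5} with hR
  have sR : star R = R := by
    ext z
    rw [mem_star]
    exact (ℓs z).symm
  have sx : star (lifts {x}) = lifts {x} := rfl
  have cut : ∀ (I : Finset (Fin 6)) (X : Set (V × Bool)), (∀ z, z ∈ X ↔ ℓ z ∈ I) →
      G.d X = ∑ i ∈ I, ∑ j ∈ Iᶜ, G.e {z | ℓ z = i} {z | ℓ z = j} := by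
    intro I X hX
    rw [← e_fiber, d]
    congr 1
    · ext z; exact hX z
    · ext z; simp [hX z]
  have q1 := cut {0} T (by simp [ℓT])
  have q2 := cut {0, 2} Y (fun z => by rw [hYW]; simp [ℓT, ℓW])
  have q3 := cut {0, 3} Z (fun z => by rw [hZW]; simp [ℓT, ℓW', mem_star])
  have q4 := cut {2} W (by simp [ℓW])
  have q5 := cut {5} R (by simp [hR])
  rw [show ({0} : Finset (Fin 6))ᶜ = {1, 2, 3, 4, 5} by decide] at q1
  rw [show ({0, 2} : Finset (Fin 6))ᶜ = {1, 3, 4, 5} by decide] at q2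
  rw [show ({0, 3} : Finset (Fin 6))ᶜ = {1, 2, 4, 5} by decide] at q3
  rw [show ({2} : Finset (Fin 6))ᶜ = {0, 1, 3, 4, 5} by decide] at q4
  rw [show ({5} : Finset (Fin 6))ᶜ = {0, 1, 2, 3, 4} by decide] at q5
  simp only [Finset.sum_insert (by decide : (0 : Fin 6) ∉ ({2} : Finset (Fin 6))),
    Finset.sum_insert (by decide : (0 : Fin 6) ∉ ({3} : Finset (Fin 6))),
    Finset.sum_insert (by decide : (1 : Fin 6) ∉ ({2, 3, 4, 5} : Finset (Fin 6))),
    Finset.sum_insert (by decide : (2 : Fin 6) ∉ ({3, 4, 5} : Finset (Fin 6))),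
    Finset.sum_insert (by decide : (3 : Fin 6) ∉ ({4, 5} : Finset (Fin 6))),
    Finset.sum_insert (by decide : (4 : Fin 6) ∉ ({5} : Finset (Fin 6))),
    Finset.sum_insert (by decide : (1 : Fin 6) ∉ ({3, 4, 5} : Finset (Fin 6))),
    Finset.sum_insert (by decide : (1 : Fin 6) ∉ ({2, 4, 5} : Finset (Fin 6))),
    Finset.sum_insert (by decide : (2 : Fin 6) ∉ ({4, 5} : Finset (Fin 6))),
    Finset.sum_insert (by decide : (0 : Fin 6) ∉ ({1, 3, 4, 5} : Finset (Fin 6))),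
    Finset.sum_insert (by decide : (0 : Fin 6) ∉ ({1, 2, 3, 4} : Finset (Fin 6))),
    Finset.sum_insert (by decide : (1 : Fin 6) ∉ ({2, 3, 4} : Finset (Fin 6))),
    Finset.sum_insert (by decide : (2 : Fin 6) ∉ ({3, 4} : Finset (Fin 6))),
    Finset.sum_insert (by decide : (3 : Fin 6) ∉ ({4} : Finset (Fin 6))),
    Finset.sum_singleton, bT, bT', bW, bW', bx, ← hR] at q1 q2 q3 q4 q5
  have y1 : G.e (star T) (star W) = G.e T W := G.e_star T W
  have y2 : G.e (star T) W = G.e T (star W) := by rw [← G.e_star, star_star]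
  have y3 : G.e (star T) (lifts {x}) = G.e T (lifts {x}) := by rw [← G.e_star T, sx]
  have y4 : G.e (star T) R = G.e T R := by rw [← G.e_star T, sR]
  have y5 : G.e (star W) (lifts {x}) = G.e W (lifts {x}) := by rw [← G.e_star W, sx]
  have y6 : G.e (star W) R = G.e W R := by rw [← G.e_star W, sR]
  have c1 := G.e_comm W T
  have c2 := G.e_comm W (star T)
  have c3 := G.e_comm (star W) T
  have c4 := G.e_comm (star W) (star T)
  have c5 := G.e_comm R T
  have c6 := G.e_comm R (star T)
  have c7 := G.e_comm R W
  have c8 := G.e_comm R (star W)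
  have c0 := G.e_comm (star W) W
  have c9 := G.e_comm R (lifts {x})
  have x1 : G.e T (lifts {x}) = 2 := by
    rw [e_comm, e_lifts_singleton e, nT, nT]
  have x2 : G.e W (lifts {x}) = 2 := by
    rw [e_comm, e_lifts_singleton e, nW, nW]
  have hpat : ∀ i, pat e (Y) true i = !pat e Y false i :=
    eq_not_of_num _ _ (hYn false).1 (hYn true).1 (oneSided_pat e hY1)
  -- The patterns of `Y` at the two lifts of `x` are complementary, so every neighbour of `x` has a
  -- lift in `Y`, while `R` consists of vertices neither lift of which lies there.
  have x3 : G.e (lifts {x}) R = 0 := by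
    refine cnt_eq_zero.2 ?_
    rintro ⟨s, b⟩ ⟨hs, hs'⟩
    have hs : G.vert s = x := hs
    obtain ⟨i, rfl⟩ : ∃ i, s = (e i).1 := ⟨e.symm ⟨s, hs⟩, by simp⟩
    have h1 : ∀ b, G.far ((e i).1, b) ∈ Y → ℓ (G.far ((e i).1, b)) ≠ 5 := by
      intro b hb h5
      rw [hYW] at hb
      rcases hb with hb | hb
      · rw [← ℓT, h5] at hb; simp at hb
      · rw [← ℓW, h5] at hb; simp at hb
    have h2 : ∀ b, ℓ (G.far ((e i).1, b)) = 5 → ℓ (G.far ((e i).1, !b)) = 5 := by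
      intro b hb
      have := far_not (G := G) ((e i).1, b)
      rw [this]
      exact (ℓs _).1 hb
    have h3 : ∀ b, ℓ (G.far ((e i).1, b)) = 5 := by
      intro b'
      by_cases hb : b' = b
      · rw [hb]; exact hs'
      · have : b' = !b := Bool.eq_not_of_ne hb
        rw [this]
        exact h2 b hs'
    have h4 := hpat i
    cases hf : pat e Y false i
    · rw [hf] at h4
      exact h1 true ((pat_eq_true e).1 h4) (h3 true)
    · exact h1 false ((pat_eq_true e).1 hf) (h3 false)
  -- `W` and `star W` have equal cuts, and their union consists of all lifts of a nonempty set of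
  -- vertices avoiding the root.
  have w4 : 4 ≤ G.d W := by
    have h1 := G.d_inter_add_d_union_le W (star W)
    rw [d_star] at h1
    have h2 : W ∪ star W = lifts {y | (y, false) ∈ W ∨ (y, true) ∈ W} := by
      ext ⟨y, b⟩
      cases b <;> simp [mem_star, mem_lifts, or_comm]
    have h3 := h.conn {y | (y, false) ∈ W ∨ (y, true) ∈ W} ?_ ?_
    · rw [← h2] at h3
      omega
    · have h4 : ∃ i, pat e W false i = true := by
        by_contra hcon
        push Not at hcon
        have h5 := nW false
        have h6 : pat e W false = fun _ => false := by
          ext i; simpa using hcon i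
        rw [h6] at h5
        exact absurd h5 (by decide)
      obtain ⟨i, hi⟩ := h4
      rw [pat_eq_true] at hi
      rcases hfar : G.far ((e i).1, false) with ⟨y, b⟩
      rw [hfar] at hi
      refine ⟨y, ?_⟩
      cases b
      · exact Or.inl hi
      · exact Or.inr hi
    · rintro (h1 | h1)
      · exact hTW _ h1 hvT
      · exact hTsW _ h1 hvT
  -- Cuts 6, 8, 8 of `T`, `Y`, `Z` give `e W (star W) = e W R = 0` and `e T W = e T (star W)`; the
  -- latter is at least 1 by `w4`, whence `d R = 2 * e T R ≤ 4`, less than the connectivity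
  -- condition allows for a nonempty `R`.
  have hR0 : R = ∅ := by
    by_contra hne
    have h2 : R = lifts {y | (y, false) ∈ R} := by
      ext ⟨y, b⟩
      cases b
      · simp [mem_lifts]
      · simpa [mem_lifts, hR] using ℓs (y, true)
    have h3 := h.conn {y | (y, false) ∈ R} ?_ ?_
    · rw [← h2] at h3
      omega
    · obtain ⟨⟨y, b⟩, hz⟩ := Set.nonempty_iff_ne_empty.2 hne
      rw [h2] at hz
      exact ⟨y, hz⟩
    · intro hv
      have hv : ℓ (v, false) = 5 := hv
      rw [(ℓT _).2 hvT] at hv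
      simp at hv
  -- hence `Y` together with a lift of `x` is a section of the double cover
  have full : adj x Y True False = {z | z.2 = decide ((z.1, true) ∈ adj x Y True False)} := by
    ext ⟨y, b⟩
    have hos : OneSided (adj x Y True False) := oneSided_adj hY1 (by simp)
    have hfull : (y, false) ∈ adj x Y True False ∨ (y, true) ∈ adj x Y True False := by
      by_cases hy : y = x
      · subst hy
        exact Or.inl ((adj_false_mem ..).2 trivial)
      · rw [mem_adj (by exact hy), mem_adj (by exact hy), hYW]
        have h5 : ℓ (y, false) ≠ 5 := fun h5 => by
          have : (y, false) ∈ R := h5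
          rw [hR0] at this
          exact this
        have aux : ∀ a : Fin 6, a ≠ 5 → a = 0 ∨ a = 1 ∨ a = 2 ∨ a = 3 ∨ a = 4 := by decide
        rcases aux _ h5 with h | h | h | h | h
        · exact Or.inl (Or.inl ((ℓT _).1 h))
        · exact Or.inr (Or.inl ((ℓT' _).1 h))
        · exact Or.inl (Or.inr ((ℓW _).1 h))
        · exact Or.inr (Or.inr ((ℓW' _).1 h))
        · exact absurd ((ℓx _).1 h) hy
    cases b
    · constructor
      · intro h1
        simpa using hos _ h1
      · intro h1
        have h1 : (y, true) ∉ adj x Y True False := by simpa using h1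
        exact hfull.resolve_right h1
    · simp
  -- This section has the cut 4 + (4 - 2) + 2 = 8, which is not 2 modulo 4.
  have hpar := h.par fun y => decide ((y, true) ∈ adj x Y True False)
  rw [← full, d_adj e hl, hYb, (hYn _).1, (hYn _).1] at hpar
  simp at hpar

end IsRooted

end StubGraph

theorem num_eq_four_sub : ∀ p q : Fin 4 → Bool, (∀ i, q i = !p i) → num q = 4 - num p := by
  decide

namespace StubGraph

variable {S V : Type*} {G : StubGraph S V} [Fintype S]

theorem dSplit_eq {x : V} (e : Fin 4 ≃ {s // G.vert s = x}) (j : Fin 3) (X : Set (V × Bool))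
    (b : Bool) :
    dSplit e j X = G.base x X + sepNum j (pat e X b) + sepNum j (pat e X !b) := by
  cases b
  · rfl
  · rw [dSplit, Bool.not_true]
    ring

namespace IsRooted

variable [Fintype V] {v x : V} (e : Fin 4 ≃ {s // G.vert s = x})

/-- The separation condition holds for all four placements of the lifts of `x`, hence for the
cheapest one. -/
theorem six_le_base_add (h : G.IsRooted v) (hx : x ≠ v) {X : Set (V × Bool)}
    (hX : (v, false) ∈ X) (hX' : (v, true) ∉ X) (b : Bool) :
    6 ≤ G.base x X + min (num (pat e X b)) (4 - num (pat e X b))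
      + min (num (pat e X !b)) (4 - num (pat e X !b)) := by
  have hl := h.noloop hx
  have h1 := h.six_le_d_adj hx hX hX' True True
  have h2 := h.six_le_d_adj hx hX hX' True False
  have h3 := h.six_le_d_adj hx hX hX' False True
  have h4 := h.six_le_d_adj hx hX hX' False False
  rw [d_adj e hl] at h1 h2 h3 h4
  simp only [if_true, if_false] at h1 h2 h3 h4
  cases b
  · simp only [Bool.not_false]
    omega
  · simp only [Bool.not_true]
    omega

/-- The case of `sep_unique` where a tight set is a section of the double cover. -/
theorem sep_unique_of_full (h : G.IsRooted v) (hx : x ≠ v) {T : Set (V × Bool)}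
    (hvT : (v, false) ∈ T) (hT1 : OneSided T) (hT6 : G.d T = 6)
    (hfull : ∀ z : V × Bool, z ∈ T ∨ (z.1, !z.2) ∈ T)
    {j k : Fin 3} (hjk : j ≠ k) {A B : Set (V × Bool)}
    (hA : (v, false) ∈ A) (hA' : (v, true) ∉ A) (hA6 : dSplit e j A < 6)
    (hB : (v, false) ∈ B) (hB' : (v, true) ∉ B) (hB6 : dSplit e k B < 6) : False := by
  classical
  have hl := h.noloop hx
  have hvT' : (v, true) ∉ T := hT1 _ hvT
  obtain ⟨b, hb⟩ : ∃ b, (x, b) ∈ T := by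
    rcases hfull (x, false) with h | h
    exacts [⟨_, h⟩, ⟨_, h⟩]
  have hb' : (x, !b) ∉ T := hT1 _ hb
  set t := pat e T b with ht
  have hnot : ∀ i, pat e T (!b) i = !t i := by
    intro i
    rw [ht, Bool.eq_iff_iff, Bool.not_eq_true', pat_eq_true, Bool.eq_false_iff, Ne, pat_eq_true]
    have h1 := far_not (G := G) ((e i).1, b)
    rw [h1]
    constructor
    · intro h2 h3
      exact hT1 _ h3 h2
    · exact (hfull _).resolve_left
  have hn := num_eq_four_sub _ _ hnot
  have hnot' : pat e T (!b) = fun i => !t i := funext hnot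
  have dT : G.base x T + 2 * (4 - num t) = 6 := by
    rw [d_eq_num e hl] at hT6
    cases b
    · simp only [Bool.not_false] at hb' hn
      simp only [hb, hb', if_true, if_false] at hT6
      rw [← ht] at hT6
      omega
    · simp only [Bool.not_true] at hb' hn
      simp only [hb, hb', if_true, if_false] at hT6
      rw [← ht] at hT6
      omega
  have h4 := num_le_four t
  -- With fewer than two entries, exchanging the lifts of `x` in `T` would reduce the cut of six.
  have hn2 : 2 ≤ num t := by
    have := h.six_le_base_add e hx hvT hvT' b
    rw [hn] at this
    omega
  have dsT : ∀ j, dSplit e j T ≤ 6 := by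
    intro j
    rw [dSplit_eq e j T b, ← ht, hnot', sepNum_not]
    have := sepNum_add_num_le j t
    omega
  -- The complement of the section `T` is `star T`, so of the two sets obtained by uncrossing with
  -- `T`, the union also yields a subset of `T`, namely `star` of its complement. Parity lowers
  -- "less than 6" to "at most 4".
  have shrink : ∀ (j : Fin 3) (X : Set (V × Bool)), (v, false) ∈ X → (v, true) ∉ X →
      dSplit e j X < 6 → ∃ Y ⊆ T, (v, false) ∈ Y ∧ dSplit e j Y ≤ 4 := by
    intro j X hX hX' hX6
    have h1 := dSplit_inter_add_union_le e hl j X T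
    have h2 := dsT j
    have even := h.even_dSplit e hx j
    by_cases h3 : dSplit e j (X ∩ T) < 6
    · refine ⟨X ∩ T, Set.inter_subset_right, ⟨hX, hvT⟩, ?_⟩
      obtain ⟨m, hm⟩ := even (X ∩ T)
      omega
    · refine ⟨star (X ∪ T)ᶜ, ?_, ?_, ?_⟩
      · intro z hz
        exact (hfull z).resolve_right fun h => hz (Or.inr h)
      · rintro (h | h)
        exacts [hX' h, hvT' h]
      · rw [dSplit_star e hl, dSplit_compl e hl]
        obtain ⟨m, hm⟩ := even (X ∪ T)
        omega
  obtain ⟨Y, hYT, hvY, hY⟩ := shrink j A hA hA' hA6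
  obtain ⟨Z, hZT, hvZ, hZ⟩ := shrink k B hB hB' hB6
  have hvY' : (v, true) ∉ Y := fun h => hvT' (hYT h)
  have hvZ' : (v, true) ∉ Z := fun h => hvT' (hZT h)
  have mono : ∀ X ⊆ T, ∀ c i, pat e X c i = true → pat e T c i = true := by
    intro X hX c i hi
    rw [pat_eq_true] at hi ⊢
    exact hX hi
  rw [dSplit_eq e j Y b] at hY
  rw [dSplit_eq e k Z b] at hZ
  by_cases h3 : num t = 2
  -- At one of the lifts the violating pattern is a pair of `j`; it is contained in the pattern of
  -- `T` there, which also has size two, so they agree. Since `t` and its complement are separated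
  -- alike, `t` splits into pairs of `j`.
  · have aligned : ∀ (j : Fin 3) (X : Set (V × Bool)), X ⊆ T → (v, false) ∈ X → (v, true) ∉ X →
        G.base x X + sepNum j (pat e X b) + sepNum j (pat e X !b) ≤ 4 → sepNum j t = 0 := by
      intro j X hXT hX hX' hX4
      have h6 := h.six_le_base_add e hx hX hX' b
      by_cases hlt : sepNum j (pat e X b) < num (pat e X b) ∧
          sepNum j (pat e X b) < 4 - num (pat e X b)
      · obtain ⟨h7, h8⟩ := num_eq_two_of_lt j _ hlt.1 hlt.2
        have := eq_of_num_eq _ _ (mono X hXT b) (h7.trans h3.symm)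
        rw [← ht] at this
        rw [← this, h8]
      · obtain ⟨h7, h8⟩ := num_eq_two_of_lt j (pat e X !b) (by omega) (by omega)
        have := eq_of_num_eq _ _ (mono X hXT (!b)) (by rw [h7, hn, h3])
        rw [← sepNum_not, ← hnot', ← this, h8]
    exact not_sepNum_eq_zero j k hjk t h3 (aligned j Y hYT hvY hvY' hY)
      (aligned k Z hZT hvZ hvZ' hZ)
  -- At the lift outside `T` all patterns have at most one entry, so ordinary submodularity holds
  -- there; at the other lift two is lost. Hence 6 + 6 ≤ 4 + 4 + 2, a contradiction.
  · have q1 := num_mono _ _ (mono Y hYT (!b))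
    have q2 := num_mono _ _ (mono Z hZT (!b))
    have r1 := sepNum_eq_num j (pat e Y !b) (by omega)
    have r2 := sepNum_eq_num k (pat e Z !b) (by omega)
    have sub := base_inter_add_base_union_le (G := G) (x := x) Y Z
    have i6 := h.six_le_base_add e hx (X := Y ∩ Z) ⟨hvY, hvZ⟩ (fun h => hvY' h.1) b
    have u6 := h.six_le_base_add e hx (X := Y ∪ Z) (Or.inl hvY)
      (by rintro (h | h); exacts [hvY' h, hvZ' h]) b
    have m1 := min_num_and_add_min_num_or_le j k hjk (pat e Y b) (pat e Z b)
    have m2 := num_and_add_num_or (pat e Y !b) (pat e Z !b)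
    rw [← pat_inter, ← pat_union] at m1 m2
    omega

/-- There is a tight set to start from: the single lift `(v, false)`, whose cut is at most the
valency 6 of the root. -/
theorem exists_maximal_tight (h : G.IsRooted v) : ∃ T : Set (V × Bool), (v, false) ∈ T ∧
    OneSided T ∧ G.d T = 6 ∧ ∀ Y, T ⊆ Y → OneSided Y → G.d Y = 6 → Y ⊆ T := by
  have hfin : {T : Set (V × Bool) | (v, false) ∈ T ∧ OneSided T ∧ G.d T = 6}.Finite :=
    Set.toFinite _
  have hmem : {(v, false)} ∈ {T : Set (V × Bool) | (v, false) ∈ T ∧ OneSided T ∧ G.d T = 6} := by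
    refine ⟨rfl, ?_, le_antisymm ?_ (h.sep _ rfl (by simp))⟩
    · rintro z rfl
      simp
    · rw [← h.deg_root, d, e, cnt_prod_bool]
      have h0 : (cnt fun s => G.near (s, true) ∈ ({(v, false)} : Set (V × Bool)) ∧
          G.far (s, true) ∈ ({(v, false)} : Set (V × Bool))ᶜ) = 0 := by
        refine cnt_eq_zero.2 ?_
        rintro s ⟨hs, -⟩
        simp [near] at hs
      rw [h0, add_zero]
      refine cnt_mono ?_
      rintro s ⟨hs, -⟩
      simpa [near] using hs
  obtain ⟨T, -, hT, hmax⟩ := hfin.exists_le_maximal hmem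
  exact ⟨T, hT.1, hT.2.1, hT.2.2, fun Y hTY hY1 hY6 => hmax ⟨hTY hT.1, hY1, hY6⟩ hTY⟩

/-- Only the conditions on cuts need hypotheses; parity is automatic. On a section the patterns at
the two lifts of `x` are complementary, so the cuts before and after are `base` plus twice `4 - num`
and twice `sepNum`, and `num` and `sepNum` have the same parity. -/
theorem elim (h : G.IsRooted v) (hx : x ≠ v) (j : Fin 3) [Fintype {s // G.vert s ≠ x}]
    [Fintype {y // y ≠ x}]
    (hsep : ∀ X : Set (V × Bool), (v, false) ∈ X → (v, true) ∉ X → 6 ≤ dSplit e j X)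
    (hconn : ∀ W : Set V, x ∉ W → W.Nonempty → v ∉ W → 8 ≤ dSplit e j (lifts W)) :
    (StubGraph.elim (isPairing_pairFun e (h.noloop hx) j)).IsRooted ⟨v, hx.symm⟩ := by
  classical
  have hl := h.noloop hx
  refine ⟨?_, ?_, ?_, ?_, ?_⟩
  · rw [deg_elim, h.deg_root]
  · intro y hy
    rw [deg_elim, h.deg_ne]
    exact fun h => hy (Subtype.ext h)
  · intro X hX hX'
    have h1 : X = restr x {z : V × Bool | ∃ hz : z.1 ≠ x, (⟨z.1, hz⟩, z.2) ∈ X} := by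
      ext ⟨y, b⟩
      simp [restr, y.2]
    rw [h1, d_elim_pairFun e hl]
    refine hsep _ ⟨hx.symm, hX⟩ ?_
    rintro ⟨_, hz⟩
    exact hX' hz
  · intro W hW hvW
    have h1 : lifts W = restr x (lifts {y | ∃ hy : y ≠ x, ⟨y, hy⟩ ∈ W}) := by
      ext ⟨y, b⟩
      simp [restr, lifts, y.2]
    rw [h1, d_elim_pairFun e hl]
    refine hconn _ ?_ ?_ ?_
    · rintro ⟨hy, -⟩
      exact hy rfl
    · obtain ⟨y, hy⟩ := hW
      exact ⟨y.1, y.2, hy⟩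
    · rintro ⟨_, hz⟩
      exact hvW hz
  · intro c
    let c' : V → Bool := fun y => if hy : y ≠ x then c ⟨y, hy⟩ else false
    have h1 : {z : {y // y ≠ x} × Bool | z.2 = c z.1} = restr x {z | z.2 = c' z.1} := by
      ext ⟨y, b⟩
      simp [restr, c', y.2]
    rw [h1, d_elim_pairFun e hl]
    have h2 := h.par c'
    have h3 : (x, false) ∈ {z : V × Bool | z.2 = c' z.1} := by simp [c']
    have h4 : (x, true) ∉ {z : V × Bool | z.2 = c' z.1} := by simp [c']
    rw [d_eq_num e hl, if_pos h3, if_neg h4] at h2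
    set X := {z : V × Bool | z.2 = c' z.1} with hX
    have h5 : ∀ i, pat e X true i = !pat e X false i := by
      intro i
      rw [Bool.eq_iff_iff, Bool.not_eq_true', pat_eq_true, Bool.eq_false_iff, Ne, pat_eq_true]
      have h1 := far_not (G := G) ((e i).1, false)
      rw [Bool.not_false] at h1
      rw [h1]
      simp only [hX, Set.mem_ofPred_eq]
      cases (G.far ((e i).1, false)).2 <;> cases c' (G.far ((e i).1, false)).1 <;> simp
    have h6 := num_eq_four_sub _ _ h5
    have h7 : pat e X true = fun i => !pat e X false i := funext h5
    have h8 := num_le_four (pat e X false)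
    have h9 := sepNum_mod_two j (pat e X false)
    have h10 := dSplit_eq e j X false
    rw [Bool.not_false, h7, sepNum_not] at h10
    omega

/-- One of the three ways of eliminating a vertex of valency four is admissible. -/
theorem exists_elim (h : G.IsRooted v) (hne : ∃ x, x ≠ v) :
    ∃ x, ∃ _ : x ≠ v, ∃ e : Fin 4 ≃ {s // G.vert s = x}, ∃ j : Fin 3,
      (∀ X : Set (V × Bool), (v, false) ∈ X → (v, true) ∉ X → 6 ≤ dSplit e j X) ∧
      (∀ W : Set V, x ∉ W → W.Nonempty → v ∉ W → 8 ≤ dSplit e j (lifts W)) := by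
  obtain ⟨T, hvT, hT1, hT6, hmax⟩ := h.exists_maximal_tight
  -- A vertex with both lifts outside `T` is taken if there is one; otherwise `T` is a section and
  -- any vertex other than the root serves.
  obtain ⟨x, hx, e, hsep⟩ : ∃ x, ∃ _ : x ≠ v, ∃ e : Fin 4 ≃ {s // G.vert s = x},
      ∀ j k : Fin 3, j ≠ k → ∀ A B : Set (V × Bool), (v, false) ∈ A → (v, true) ∉ A →
        dSplit e j A < 6 → (v, false) ∈ B → (v, true) ∉ B → dSplit e k B < 6 → False := by
    by_cases hx : ∃ x, (x, false) ∉ T ∧ (x, true) ∉ T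
    · obtain ⟨x, h1, h2⟩ := hx
      have hxv : x ≠ v := by
        rintro rfl
        exact h1 hvT
      have hxT : ∀ z ∈ T, z.1 ≠ x := by
        rintro ⟨y, b⟩ hz rfl
        cases b
        exacts [h1 hz, h2 hz]
      obtain ⟨e⟩ := h.exists_equiv hxv
      exact ⟨x, hxv, e, fun j k hjk A B hA hA' hA6 hB hB' hB6 =>
        h.sep_unique_of_notMem e hxv hvT hT1 hT6 hmax hxT hjk hA hA' hA6 hB hB' hB6⟩
    · have hfull : ∀ z : V × Bool, z ∈ T ∨ (z.1, !z.2) ∈ T := by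
        push Not at hx
        rintro ⟨y, b⟩
        have := hx y
        cases b <;> simp <;> tauto
      obtain ⟨x, hxv⟩ := hne
      obtain ⟨e⟩ := h.exists_equiv hxv
      exact ⟨x, hxv, e, fun j k hjk A B hA hA' hA6 hB hB' hB6 =>
        h.sep_unique_of_full e hxv hvT hT1 hT6 hfull hjk hA hA' hA6 hB hB' hB6⟩
  refine ⟨x, hx, e, ?_⟩
  by_contra hcon
  push Not at hcon
  have hc : ∀ j, (∃ X : Set (V × Bool), (v, false) ∈ X ∧ (v, true) ∉ X ∧ dSplit e j X < 6) ∨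
      ∃ W : Set V, x ∉ W ∧ W.Nonempty ∧ v ∉ W ∧ dSplit e j (lifts W) < 8 := by
    intro j
    by_cases hj : ∃ X : Set (V × Bool), (v, false) ∈ X ∧ (v, true) ∉ X ∧ dSplit e j X < 6
    · exact Or.inl hj
    · push Not at hj
      exact Or.inr (hcon j hj)
  have a : ∀ j k : Fin 3, j ≠ k →
      (∃ X : Set (V × Bool), (v, false) ∈ X ∧ (v, true) ∉ X ∧ dSplit e j X < 6) →
      (∃ X : Set (V × Bool), (v, false) ∈ X ∧ (v, true) ∉ X ∧ dSplit e k X < 6) → False := by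
    rintro j k hjk ⟨A, hA, hA', hA6⟩ ⟨B, hB, hB', hB6⟩
    exact hsep j k hjk A B hA hA' hA6 hB hB' hB6
  have b : ∀ j k : Fin 3, j ≠ k →
      (∃ W : Set V, x ∉ W ∧ W.Nonempty ∧ v ∉ W ∧ dSplit e j (lifts W) < 8) →
      (∃ W : Set V, x ∉ W ∧ W.Nonempty ∧ v ∉ W ∧ dSplit e k (lifts W) < 8) → False := by
    rintro j k hjk ⟨A, hA, hA0, hAv, hA8⟩ ⟨B, hB, hB0, hBv, hB8⟩
    exact h.conn_unique e hx hjk hA hA0 hAv hA8 hB hB0 hBv hB8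
  have h01 : (0 : Fin 3) ≠ 1 := by decide
  have h02 : (0 : Fin 3) ≠ 2 := by decide
  have h12 : (1 : Fin 3) ≠ 2 := by decide
  -- Three pairings and two kinds of obstruction: two of the pairings suffer from the same kind.
  rcases hc 0 with h0 | h0 <;> rcases hc 1 with h1 | h1 <;> rcases hc 2 with h2 | h2
  · exact a 0 1 h01 h0 h1
  · exact a 0 1 h01 h0 h1
  · exact a 0 2 h02 h0 h2
  · exact b 1 2 h12 h1 h2
  · exact a 1 2 h12 h1 h2
  · exact b 0 2 h02 h0 h2
  · exact b 0 1 h01 h0 h1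
  · exact b 0 1 h01 h0 h1

/-- The base case is three loops at the root. Only negative loops leave the single lift `(v,
false)`, and all six half-edges are needed for `sep`; so each loop is an odd eulerian graph by
itself. -/
theorem good_of_subsingleton (h : G.IsRooted v) (hv : ∀ x, x = v) : G.Good := by
  classical
  have hvert : ∀ s, G.vert s = v := fun s => hv _
  have h6 := h.deg_root
  rw [deg, cnt_congr (q := fun _ => True) (by simp [hvert])] at h6
  have hsgn : ∀ s, G.sgn s = true := by
    intro s
    by_contra hs
    have h1 := h.sep {(v, false)} rfl (by simp)
    have h2 : G.d {(v, false)} = cnt fun s => G.sgn s = true := by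
      rw [d, StubGraph.e, cnt_prod_bool]
      have h0 : (cnt fun s => G.near (s, true) ∈ ({(v, false)} : Set (V × Bool)) ∧
          G.far (s, true) ∈ ({(v, false)} : Set (V × Bool))ᶜ) = 0 := by
        refine cnt_eq_zero.2 ?_
        rintro s ⟨hs, -⟩
        simp [near] at hs
      rw [h0, add_zero]
      exact cnt_congr fun s => by simp [near, far, hvert]
    have h3 := cnt_add_cnt_not (fun _ : S => True) (fun s => G.sgn s = true)
    have h4 : 0 < cnt fun s => True ∧ ¬ G.sgn s = true := cnt_pos.2 ⟨s, trivial, hs⟩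
    simp only [true_and] at h3 h4
    omega
  have two : ∀ s, (cnt fun t => t = s ∨ t = G.mate s) = 2 := by
    intro s
    rw [cnt_eq_card]
    have : (Finset.univ.filter fun t => t = s ∨ t = G.mate s) = {s, G.mate s} := by
      ext t; simp
    rw [this, Finset.card_pair (G.mate_ne s).symm]
  have hs0 : ∃ s : S, True := by
    rw [← cnt_pos, h6]
    norm_num
  obtain ⟨s, -⟩ := hs0
  have hs1 : ∃ t, True ∧ ¬ (t = s ∨ t = G.mate s) := by
    have h1 := cnt_add_cnt_not (fun _ : S => True) (fun t => t = s ∨ t = G.mate s)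
    simp only [true_and] at h1 ⊢
    rw [← cnt_pos]
    have := two s
    omega
  obtain ⟨t, -, ht⟩ := hs1
  push Not at ht
  have ht' : G.mate t ≠ s := fun h => ht.2 (by rw [← h, G.mate_mate])
  have ht'' : G.mate t ≠ G.mate s := fun h => ht.1 (by rw [← G.mate_mate t, h, G.mate_mate])
  let τ : S → Fin 3 := fun u => if u = s ∨ u = G.mate s then 0 else
    if u = t ∨ u = G.mate t then 1 else 2
  have mate_iff : ∀ u w, G.mate u = w ∨ G.mate u = G.mate w ↔ u = w ∨ u = G.mate w := by
    intro u w
    constructor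
    · rintro (rfl | h)
      · right; rw [G.mate_mate]
      · left; rw [← G.mate_mate u, h, G.mate_mate]
    · rintro (rfl | rfl)
      · right; rfl
      · left; rw [G.mate_mate]
  have c0 : (cnt fun u => τ u = 0) = 2 := by
    refine (cnt_congr fun u => ?_).trans (two s)
    simp only [τ]
    split_ifs with h1 h2 <;> simp [h1]
  have c1 : (cnt fun u => τ u = 1) = 2 := by
    refine (cnt_congr fun u => ?_).trans (two t)
    simp only [τ]
    split_ifs with h1 h2
    · simp only [zero_ne_one, false_iff]
      rcases h1 with rfl | rfl
      · rintro (rfl | h)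
        · exact ht.1 rfl
        · exact ht' h.symm
      · rintro (h | h)
        · exact ht.2 h.symm
        · exact ht'' h.symm
    · simp [h2]
    · simp [h2]
  have c2 : (cnt fun u => τ u = 2) = 2 := by
    have h1 := cnt_add_cnt_not (fun _ : S => True) (fun u => τ u = 0)
    have h2 := cnt_add_cnt_not (fun u : S => ¬ τ u = 0) (fun u => τ u = 1)
    simp only [true_and] at h1
    have h3 : (cnt fun u => ¬ τ u = 0 ∧ τ u = 1) = cnt fun u => τ u = 1 :=
      cnt_congr fun u => ⟨fun h => h.2, fun h => ⟨by rw [h]; decide, h⟩⟩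
    have h4 : (cnt fun u => ¬ τ u = 0 ∧ ¬ τ u = 1) = cnt fun u => τ u = 2 := by
      refine cnt_congr fun u => ?_
      generalize τ u = a
      revert a
      decide
    omega
  have call : ∀ i, (cnt fun u => τ u = i) = 2 := by
    intro i
    fin_cases i
    exacts [c0, c1, c2]
  refine ⟨τ, v, ?_, ?_, ?_, ?_⟩
  · intro u
    simp only [τ, mate_iff]
  · intro x i
    rw [hv x, cnt_congr (q := fun u => τ u = i) (by simp [hvert]), call]
    decide
  · intro i
    rw [cnt_congr (q := fun u => τ u = i) (by simp [hsgn]), call]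
  · intro P hP _ _ u
    exact hP u (hvert u)

end IsRooted

/-- A rooted graph splits into three odd closed trails through its root. -/
theorem IsRooted.good (n : ℕ) : ∀ {S : Type*} {V : Type*} [Fintype S] [Fintype V]
    {G : StubGraph S V} {v : V}, G.IsRooted v → Fintype.card V = n → G.Good := by
  classical
  induction n with
  | zero =>
    intro S V _ _ G v _ hc
    exact ((Fintype.card_eq_zero_iff.1 hc).false v).elim
  | succ n ih =>
    intro S V _ _ G v h hc
    by_cases hne : ∃ x, x ≠ v
    · obtain ⟨x, hx, e, j, hsep, hconn⟩ := h.exists_elim hne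
      refine good_of_elim _ (ih (h.elim e hx j hsep hconn) ?_)
      rw [Fintype.card_subtype_compl]
      simp [hc]
    · push Not at hne
      exact h.good_of_subsingleton hne

end StubGraph

open Classical in
/-- The sum of `f` over the elements with a given property. -/
noncomputable def wsum {S : Type*} [Fintype S] (p : S → Prop) (f : S → ℤ) : ℤ :=
  ∑ s, if p s then f s else 0

/-! ### Sums of values over half-edges -/

section wsum

variable {S : Type*} [Fintype S]

theorem wsum_congr {p q : S → Prop} {f g : S → ℤ} (h : ∀ s, p s ↔ q s) (hf : ∀ s, q s → f s = g s) :
    wsum p f = wsum q g := by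
  classical
  refine Finset.sum_congr rfl fun s _ => ?_
  by_cases hq : q s
  · simp [h, hq, hf s hq]
  · simp [h, hq]

theorem wsum_eq_zero {p : S → Prop} {f : S → ℤ} (h : ∀ s, ¬ p s) : wsum p f = 0 := by
  classical
  exact Finset.sum_eq_zero fun s _ => by simp [h s]

theorem wsum_add_wsum_not (p q : S → Prop) (f : S → ℤ) :
    wsum (fun s => p s ∧ q s) f + wsum (fun s => p s ∧ ¬ q s) f = wsum p f := by
  classical
  simp only [wsum, ← Finset.sum_add_distrib]
  refine Finset.sum_congr rfl fun s _ => ?_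
  by_cases hp : p s <;> by_cases hq : q s <;> simp [hp, hq]

theorem wsum_eq_sum (p : S → Prop) [DecidablePred p] (f : S → ℤ) :
    wsum p f = ∑ s ∈ Finset.univ.filter p, f s := by
  classical
  rw [wsum, Finset.sum_filter]
  exact Finset.sum_congr rfl fun s _ => by split_ifs <;> rfl

theorem wsum_subtype (P : S → Prop) [Fintype {s // P s}] (p : S → Prop) (f : S → ℤ) :
    wsum (fun s : {s // P s} => p s.1) (fun s => f s.1) = wsum (fun s => P s ∧ p s) f := by
  classical
  rw [wsum_eq_sum, wsum_eq_sum]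
  have h : (Finset.univ.filter fun s => P s ∧ p s)
      = (Finset.univ.filter fun s : {s // P s} => p s.1).map (Function.Embedding.subtype P) := by
    ext s
    simp
    tauto
  rw [h, Finset.sum_map]
  rfl

theorem wsum_const (p : S → Prop) (c : ℤ) : wsum p (fun _ => c) = c * cnt p := by
  classical
  simp only [wsum, cnt]
  push_cast
  rw [Finset.mul_sum]
  refine Finset.sum_congr rfl fun s _ => ?_
  split_ifs <;> simp

theorem wsum_neg (p : S → Prop) (f : S → ℤ) : wsum p (fun s => - f s) = - wsum p f := by
  classical
  simp only [wsum, ← Finset.sum_neg_distrib]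
  exact Finset.sum_congr rfl fun s _ => by split_ifs <;> simp

theorem wsum_mul (p : S → Prop) (c : ℤ) (f : S → ℤ) :
    wsum p (fun s => c * f s) = c * wsum p f := by
  classical
  simp only [wsum, Finset.mul_sum]
  exact Finset.sum_congr rfl fun s _ => by split_ifs <;> simp

theorem wsum_add (p : S → Prop) (f g : S → ℤ) :
    wsum p (fun s => f s + g s) = wsum p f + wsum p g := by
  classical
  simp only [wsum, ← Finset.sum_add_distrib]
  exact Finset.sum_congr rfl fun s _ => by split_ifs <;> simp

theorem wsum_fiber {V : Type*} [Fintype V] (φ : S → V) (p : S → Prop) (f : S → ℤ) :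
    wsum p f = ∑ x, wsum (fun s => φ s = x ∧ p s) f := by
  classical
  simp only [wsum]
  rw [Finset.sum_comm]
  refine Finset.sum_congr rfl fun s _ => ?_
  by_cases hp : p s <;> simp [hp]

theorem wsum_comp_involutive {g : S → S} (hg : ∀ s, g (g s) = s) (p : S → Prop) (f : S → ℤ) :
    wsum (fun s => p (g s)) (fun s => f (g s)) = wsum p f := by
  classical
  exact Equiv.sum_comp (Function.Involutive.toPerm g hg) (fun s => if p s then f s else 0)

end wsum

/-! ### Connectivity, switching, contraction and attachment -/

namespace StubGraph

variable {S V S' V' : Type*} {G : StubGraph S V}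

/-- The part of the graph carried by the stubs with property `P` is connected. -/
def ConnOn (G : StubGraph S V) (P : S → Prop) : Prop :=
  ∀ Q : S → Prop, (∀ s t, P s → P t → G.vert s = G.vert t → Q s → Q t) →
    (∀ s, P s → P (G.mate s) → Q s → Q (G.mate s)) → ∀ s t, P s → P t → Q s → Q t

/-- The graph is connected, up to isolated vertices. -/
def Conn (G : StubGraph S V) : Prop :=
  ∀ Q : S → Prop, (∀ s t, G.vert s = G.vert t → Q s → Q t) →
    (∀ s, Q s → Q (G.mate s)) → ∀ s t, Q s → Q t

theorem ConnOn.conn {P : S → Prop} (h : G.ConnOn P) {H : StubGraph {s // P s} V}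
    (hvert : ∀ s, H.vert s = G.vert s.1)
    (hmate : ∀ s, P (G.mate s.1) → (H.mate s).1 = G.mate s.1) : H.Conn := by
  intro Q hv hm s t hs
  have := h (fun u => ∃ hu : P u, Q ⟨u, hu⟩) ?_ ?_ s.1 t.1 s.2 t.2 ⟨s.2, hs⟩
  · exact this.2
  · rintro a b - hb hab ⟨ha, h⟩
    exact ⟨hb, hv ⟨a, ha⟩ _ (by rw [hvert, hvert, hab]) h⟩
  · rintro a - hma ⟨ha, h⟩
    refine ⟨hma, ?_⟩
    have h1 := hm _ h
    have h2 : H.mate ⟨a, ha⟩ = ⟨G.mate a, hma⟩ := Subtype.ext (hmate ⟨a, ha⟩ hma)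
    rwa [h2] at h1

variable [Fintype S]

/-- In a class of edges with even valencies, the ends of an even number of edges get different
colours from a two-colouring of the vertices. -/
theorem cnt_ne_mod_four [Fintype V] {p : S → Prop} (hm : ∀ s, p s → p (G.mate s))
    (hev : ∀ x, Even (cnt fun s => G.vert s = x ∧ p s)) (c : V → Bool) :
    (cnt fun s => p s ∧ c (G.vert s) ≠ c (G.vert (G.mate s))) % 4 = 0 := by
  have h1 := two_mul_cnt_mod_four (a := fun s => c (G.vert s) = true) hm
    (fun s _ => G.mate_mate s) (fun s _ => G.mate_ne s)
  have h2 := cnt_add_cnt_not (fun s => p s ∧ c (G.vert s) ≠ c (G.vert (G.mate s)))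
    (fun s => c (G.vert s) = true)
  have hm' : ∀ s, p (G.mate s) ↔ p s :=
    fun s => ⟨fun hs => by simpa [G.mate_mate] using hm _ hs, hm s⟩
  have h3 : (cnt fun s => (p s ∧ c (G.vert s) ≠ c (G.vert (G.mate s))) ∧ c (G.vert s) = true)
      = cnt fun s => p s ∧ c (G.vert s) = true ∧ ¬ c (G.vert (G.mate s)) = true := by
    refine cnt_congr fun s => ?_
    cases c (G.vert s) <;> cases c (G.vert (G.mate s)) <;> simp
  have h4 : (cnt fun s => (p s ∧ c (G.vert s) ≠ c (G.vert (G.mate s))) ∧ ¬ c (G.vert s) = true)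
      = cnt fun s => p s ∧ c (G.vert s) = true ∧ ¬ c (G.vert (G.mate s)) = true := by
    rw [← cnt_comp_involutive G.mate_mate]
    refine cnt_congr fun s => ?_
    rw [G.mate_mate, hm']
    cases c (G.vert s) <;> cases c (G.vert (G.mate s)) <;> simp
  have h5 : Even (cnt fun s => p s ∧ c (G.vert s) = true) := by
    rw [cnt_fiber G.vert]
    refine Finset.even_sum _ fun x _ => ?_
    by_cases hx : c x = true
    · rw [cnt_congr (q := fun s => G.vert s = x ∧ p s)]
      · exact hev x
      · refine fun s => ⟨fun h => ⟨h.1, h.2.1⟩, ?_⟩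
        rintro ⟨rfl, h⟩
        exact ⟨rfl, h, hx⟩
    · rw [cnt_eq_zero.2]
      · exact Even.zero
      · rintro s ⟨rfl, -, h⟩
        exact hx h
  obtain ⟨k, hk⟩ := h5
  omega

/-- Switching does not change the parity of the number of negative edges. -/
theorem cnt_switch [Fintype V] {p : S → Prop} (hm : ∀ s, p s → p (G.mate s))
    (hev : ∀ x, Even (cnt fun s => G.vert s = x ∧ p s)) (c : V → Bool) :
    (cnt fun s => p s ∧ xor (G.sgn s) (xor (c (G.vert s)) (c (G.vert (G.mate s)))) = true) % 4
      = (cnt fun s => p s ∧ G.sgn s = true) % 4 := by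
  have h0 := cnt_ne_mod_four hm hev c
  have h1 := cnt_add_cnt_not (fun s => p s ∧ G.sgn s = true)
    (fun s => c (G.vert s) ≠ c (G.vert (G.mate s)))
  have h2 := cnt_add_cnt_not (fun s => p s ∧ c (G.vert s) ≠ c (G.vert (G.mate s)))
    (fun s => G.sgn s = true)
  have h3 := cnt_add_cnt_not
    (fun s => p s ∧ xor (G.sgn s) (xor (c (G.vert s)) (c (G.vert (G.mate s)))) = true)
    (fun s => G.sgn s = true)
  have e1 : (cnt fun s => (p s ∧ G.sgn s = true) ∧ c (G.vert s) ≠ c (G.vert (G.mate s)))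
      = cnt fun s => (p s ∧ c (G.vert s) ≠ c (G.vert (G.mate s))) ∧ G.sgn s = true :=
    cnt_congr fun s => by tauto
  have e2 : (cnt fun s => (p s ∧ xor (G.sgn s) (xor (c (G.vert s)) (c (G.vert (G.mate s)))) = true)
      ∧ G.sgn s = true)
      = cnt fun s => (p s ∧ G.sgn s = true) ∧ ¬ c (G.vert s) ≠ c (G.vert (G.mate s)) := by
    refine cnt_congr fun s => ?_
    cases c (G.vert s) <;> cases c (G.vert (G.mate s)) <;> cases G.sgn s <;> simp
  have e3 : (cnt fun s => (p s ∧ xor (G.sgn s) (xor (c (G.vert s)) (c (G.vert (G.mate s)))) = true)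
      ∧ ¬ G.sgn s = true)
      = cnt fun s => (p s ∧ c (G.vert s) ≠ c (G.vert (G.mate s))) ∧ ¬ G.sgn s = true := by
    refine cnt_congr fun s => ?_
    cases c (G.vert s) <;> cases c (G.vert (G.mate s)) <;> cases G.sgn s <;> simp
  have h4 : Even (cnt fun s => (p s ∧ c (G.vert s) ≠ c (G.vert (G.mate s))) ∧ G.sgn s = true) := by
    refine even_cnt_of_involution G.mate ?_ (fun s _ => G.mate_mate s) (fun s _ => G.mate_ne s)
    rintro s ⟨⟨h, h'⟩, h''⟩
    exact ⟨⟨hm s h, by rw [G.mate_mate]; exact h'.symm⟩, by rw [G.sgn_mate, h'']⟩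
  obtain ⟨k, hk⟩ := h4
  omega

/-- A colouring survives the contraction of positive edges and the identification of vertices. -/
theorem Good.contract [Fintype S'] [Fintype V'] {G' : StubGraph S' V'} (hG : G'.Good) (j : S → S')
    (φ : V' → V) (hj : Function.Injective j) (hmate : ∀ s, G'.mate (j s) = j (G.mate s))
    (hsgn : ∀ s, G'.sgn (j s) = G.sgn s) (hvert : ∀ s, φ (G'.vert (j s)) = G.vert s)
    (hrest : ∀ t, (∀ s, j s ≠ t) → G'.sgn t = false ∧ φ (G'.vert (G'.mate t)) = φ (G'.vert t)) :
    G.Good := by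
  classical
  obtain ⟨τ, v, hτ⟩ := hG
  have mem_mate : ∀ t, (∃ s, j s = G'.mate t) ↔ ∃ s, j s = t := by
    intro t
    constructor
    · rintro ⟨s, hs⟩
      exact ⟨G.mate s, by rw [← hmate, hs, G'.mate_mate]⟩
    · rintro ⟨s, rfl⟩
      exact ⟨G.mate s, by rw [hmate]⟩
  have image : ∀ p : S' → Prop, (cnt fun t => p t ∧ ∃ s, j s = t) = cnt fun s => p (j s) := by
    intro p
    let e : S ≃ {t // ∃ s, j s = t} := Equiv.ofInjective j hj
    rw [← cnt_congr (p := fun t => (∃ s, j s = t) ∧ p t) (fun t => and_comm), cnt_of_equiv e]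
    exact cnt_congr fun s => Iff.rfl
  refine ⟨fun s => τ (j s), φ v, ?_, ?_, ?_, ?_⟩
  · intro s
    rw [← hmate, hτ.mate]
  · intro y i
    have h1 := cnt_add_cnt_not (fun t => φ (G'.vert t) = y ∧ τ t = i) (fun t => ∃ s, j s = t)
    rw [image, cnt_congr (q := fun s => G.vert s = y ∧ τ (j s) = i)
      (fun s => by rw [hvert])] at h1
    have h2 : Even (cnt fun t => (φ (G'.vert t) = y ∧ τ t = i) ∧ ¬ ∃ s, j s = t) := by
      refine even_cnt_of_involution G'.mate ?_ (fun s _ => G'.mate_mate s)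
        (fun s _ => G'.mate_ne s)
      rintro t ⟨⟨h3, h4⟩, h5⟩
      refine ⟨⟨?_, by rw [hτ.mate, h4]⟩, by rwa [mem_mate]⟩
      rw [(hrest t (by push Not at h5; exact h5)).2, h3]
    have h3 : Even (cnt fun t => φ (G'.vert t) = y ∧ τ t = i) := by
      rw [cnt_fiber G'.vert]
      refine Finset.even_sum _ fun x _ => ?_
      by_cases hx : φ x = y
      · rw [cnt_congr (q := fun t => G'.vert t = x ∧ τ t = i)]
        · exact hτ.even x i
        · refine fun s => ⟨fun h => ⟨h.1, h.2.2⟩, ?_⟩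
          rintro ⟨rfl, h⟩
          exact ⟨rfl, hx, h⟩
      · rw [cnt_eq_zero.2]
        · exact Even.zero
        · rintro s ⟨rfl, h, -⟩
          exact hx h
    rw [← h1] at h3
    exact (Nat.even_add.1 h3).2 h2
  · intro i
    rw [← hτ.odd i, ← cnt_congr (p := fun s => G'.sgn (j s) = true ∧ τ (j s) = i)
      (fun s => by rw [hsgn]), ← image fun t => G'.sgn t = true ∧ τ t = i]
    refine congrArg (· % 4) (cnt_congr fun t => and_iff_left_of_imp ?_)
    rintro ⟨h1, -⟩
    by_contra h2
    push Not at h2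
    rw [(hrest t h2).1] at h1
    exact absurd h1 (by decide)
  · intro P hv hm hs s
    -- A contracted half-edge has no counterpart in `G`; the invariant attached to it therefore
    -- speaks of all half-edges of its colour at the image of its vertex.
    have key := hτ.reaches
      (fun t => ∀ s, (j s = t ∨ (∀ u, j u ≠ t) ∧ G.vert s = φ (G'.vert t) ∧ τ (j s) = τ t) → P s)
      ?_ ?_ ?_ (j s) s (Or.inl rfl)
    · exact key
    · rintro t ht u (rfl | ⟨-, h2, -⟩)
      · exact hv u (by rw [← hvert, ht])
      · exact hv u (by rw [h2, ht])
    · rintro t h u (h1 | ⟨h1, h2, h3⟩)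
      · rw [← G.mate_mate u]
        exact hm _ (h _ (Or.inl (by rw [← hmate, h1, G'.mate_mate])))
      · have h4 : ∀ u, j u ≠ t := by
          intro w hw
          obtain ⟨z, hz⟩ := (mem_mate t).2 ⟨w, hw⟩
          exact h1 z hz
        refine h u (Or.inr ⟨h4, ?_, ?_⟩)
        · rw [h2, (hrest t h4).2]
        · rw [h3, hτ.mate]
    · intro t t' htt hτt h u hu
      have h1 : G.vert u = φ (G'.vert t) ∧ τ (j u) = τ t := by
        rcases hu with rfl | ⟨-, h2, h3⟩
        · exact ⟨by rw [htt, hvert], hτt.symm⟩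
        · exact ⟨by rw [h2, htt], by rw [h3, hτt]⟩
      by_cases h2 : ∃ w, j w = t
      · obtain ⟨w, rfl⟩ := h2
        refine hs w u ?_ h1.2.symm (h w (Or.inl rfl))
        rw [h1.1, hvert]
      · push Not at h2
        exact h u (Or.inr ⟨h2, h1⟩)

/-- An odd part of a graph with a colouring absorbs an even connected part. -/
theorem Good.attach {P : S → Prop} [Fintype {s // P s}] {H : StubGraph {s // P s} V}
    (hvert : ∀ s, H.vert s = G.vert s.1) (hsgn : ∀ s, H.sgn s = G.sgn s.1)
    (hmate : ∀ s, P (G.mate s.1) → (H.mate s).1 = G.mate s.1) (hH : H.Good)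
    (hconn : G.ConnOn fun s => ¬ P s)
    (hev : ∀ x, Even (cnt fun s => G.vert s = x ∧ ¬ P s))
    (hodd : (cnt fun s => G.sgn s = true ∧ ¬ P s) % 4 = 0)
    (s₀ : {s // P s}) (hcross : ∀ s, ¬ P (G.mate s.1) → s = s₀ ∨ s = H.mate s₀)
    (t₀ : S) (ht₀ : ¬ P t₀) (hlink : G.vert t₀ = G.vert s₀.1 ∨ t₀ = G.mate s₀.1) : G.Good := by
  classical
  obtain ⟨τ, v, hτ⟩ := hH
  have hcr : ∀ s, ¬ P (G.mate s.1) → τ s = τ s₀ := by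
    intro s hs
    rcases hcross s hs with rfl | rfl
    · rfl
    · exact hτ.mate _
  -- The whole even part takes the colour of the edge at which it is attached, so the parities of
  -- the classes do not change.
  let ρ : S → Fin 3 := fun s => if hs : P s then τ ⟨s, hs⟩ else τ s₀
  have ρ_pos : ∀ s : {s // P s}, ρ s.1 = τ s := fun s => by simp [ρ, s.2]
  have ρ_neg : ∀ s, ¬ P s → ρ s = τ s₀ := fun s hs => by simp [ρ, hs]
  have ρ_mate : ∀ s, ρ (G.mate s) = ρ s := by
    intro s
    by_cases hs : P s <;> by_cases hm : P (G.mate s)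
    · rw [ρ_pos ⟨s, hs⟩, ← hτ.mate, ← ρ_pos, hmate _ hm]
    · rw [ρ_pos ⟨s, hs⟩, ρ_neg _ hm, hcr ⟨s, hs⟩ hm]
    · rw [ρ_pos ⟨_, hm⟩, ρ_neg _ hs, hcr ⟨_, hm⟩ (by rwa [G.mate_mate])]
    · rw [ρ_neg _ hs, ρ_neg _ hm]
  have split : ∀ (p : S → Prop) (q : {s // P s} → Prop) (i : Fin 3), (∀ s, q s ↔ p s.1) →
      (cnt fun s => p s ∧ ρ s = i) = (cnt fun s => q s ∧ τ s = i)
        + if i = τ s₀ then cnt fun s => p s ∧ ¬ P s else 0 := by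
    intro p q i hpq
    rw [← cnt_add_cnt_not _ P, cnt_congr (p := fun s => q s ∧ τ s = i)
      (q := fun s => p s.1 ∧ ρ s.1 = i) (fun s => by rw [hpq, ρ_pos]),
      cnt_subtype P fun s => p s ∧ ρ s = i]
    congr 1
    · exact cnt_congr fun s => and_comm
    · split_ifs with hi
      · refine cnt_congr fun s => ⟨fun h => ⟨h.1.1, h.2⟩, fun h => ⟨⟨h.1, ?_⟩, h.2⟩⟩
        rw [ρ_neg _ h.2, hi]
      · refine cnt_eq_zero.2 fun s h => hi ?_
        rw [← h.1.2, ρ_neg _ h.2]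
  refine ⟨ρ, v, ρ_mate, ?_, ?_, ?_⟩
  · intro x i
    rw [split (fun s => G.vert s = x) (fun s => H.vert s = x) i fun s => by rw [hvert]]
    refine (hτ.even x i).add ?_
    split_ifs
    exacts [hev x, Even.zero]
  · intro i
    rw [split (fun s => G.sgn s = true) (fun s => H.sgn s = true) i fun s => by rw [hsgn],
      Nat.add_mod, hτ.odd]
    split_ifs <;> simp [hodd]
  · intro Q hv hm hs
    have out : ∀ s t, ¬ P s → ¬ P t → Q s → Q t := by
      refine hconn Q ?_ fun s _ _ => hm s
      intro s t hPs hPt hst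
      exact hs s t hst (by rw [ρ_neg _ hPs, ρ_neg _ hPt])
    have inside : ∀ s : {s // P s}, Q s.1 := by
      refine hτ.reaches (fun s => Q s.1) ?_ ?_ ?_
      · intro s hsv
        exact hv _ (by rw [← hvert, hsv])
      · intro s hQ
        by_cases h1 : P (G.mate s.1)
        · rw [hmate _ h1]
          exact hm _ hQ
        -- Here the edge of `H` stands for a passage through the attached part, which is connected.
        · have h2 : ¬ P (G.mate (H.mate s).1) := by
            intro h2
            have h3 := hmate _ h2
            rw [H.mate_mate] at h3
            rw [h3, G.mate_mate] at h1
            exact h1 (H.mate s).2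
          rw [← G.mate_mate (H.mate s).1]
          exact hm _ (out _ _ h1 h2 (hm _ hQ))
      · intro s t hst hτst hQ
        rw [hvert, hvert] at hst
        exact hs _ _ hst (by rw [ρ_pos, ρ_pos, hτst]) hQ
    have ht₀Q : Q t₀ := by
      rcases hlink with h | h
      · exact hs s₀.1 t₀ h.symm (by rw [ρ_pos, ρ_neg _ ht₀]) (inside s₀)
      · rw [h]
        exact hm _ (inside s₀)
    intro s
    by_cases hsP : P s
    · exact inside ⟨s, hsP⟩
    · exact out t₀ s ht₀ hsP ht₀Q

/-! ### Splitting a vertex -/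

omit [Fintype S] in
-- The `P`-part meets the rest only at `x`. If a closed subset of it reaches `x`, then its
-- complement within `P` does not, and conversely; the one that avoids `x` is closed in all of `G`.
theorem Conn.connOn_of_cutVertex (hG : G.Conn) {P : S → Prop} {x : V}
    (hm : ∀ s, P s → P (G.mate s)) (hv : ∀ s t, G.vert s = G.vert t → G.vert s ≠ x → P s → P t) :
    G.ConnOn P := by
  intro Q hQv hQm s t hs ht hQs
  by_contra hQt
  by_cases hx : ∃ u, G.vert u = x ∧ P u ∧ Q u
  · obtain ⟨u, hux, hPu, hQu⟩ := hx
    have := hG (fun w => P w ∧ ¬ Q w) ?_ ?_ t s ⟨ht, hQt⟩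
    · exact this.2 hQs
    · rintro a b hab ⟨ha, hQa⟩
      by_cases hax : G.vert a = x
      · exact absurd (hQv u a hPu ha (by rw [hux, hax]) hQu) hQa
      · have hb := hv a b hab hax ha
        exact ⟨hb, fun h => hQa (hQv b a hb ha hab.symm h)⟩
    · rintro a ⟨ha, hQa⟩
      refine ⟨hm a ha, fun h => hQa ?_⟩
      have := hQm _ (hm a ha) (by rwa [G.mate_mate]) h
      rwa [G.mate_mate] at this
  · push Not at hx
    have := hG (fun w => P w ∧ Q w) ?_ ?_ s t ⟨hs, hQs⟩
    · exact hQt this.2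
    · rintro a b hab ⟨ha, hQa⟩
      have hax : G.vert a ≠ x := fun h => hx a h ha hQa
      have hb := hv a b hab hax ha
      exact ⟨hb, hQv a b ha hb hab hQa⟩
    · rintro a ⟨ha, hQa⟩
      exact ⟨hm a ha, hQm a ha (hm a ha) hQa⟩

open Classical in
/-- Split off the stubs with property `A` from their vertices. -/
noncomputable def split (G : StubGraph S V) (A : S → Prop) : StubGraph S (V × Bool) where
  vert s := (G.vert s, decide (A s))
  mate := G.mate
  sgn := G.sgn
  mate_mate := G.mate_mate
  mate_ne := G.mate_ne
  sgn_mate := G.sgn_mate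

omit [Fintype S] in
theorem split_vert_eq {A : S → Prop} {s t : S} :
    (G.split A).vert s = (G.split A).vert t ↔ G.vert s = G.vert t ∧ (A s ↔ A t) := by
  simp [split]

theorem good_of_split [Fintype V] {A : S → Prop} (h : (G.split A).Good) : G.Good :=
  h.contract id Prod.fst Function.injective_id (fun _ => rfl) (fun _ => rfl) (fun _ => rfl)
    fun t ht => (ht t rfl).elim

omit [Fintype S] in
-- A closed set of the split graph that is not closed in `G` must distinguish two half-edges at `x`.
-- Since it is constant on `A` and on the other half-edges at `x`, it or its complement cuts out
-- exactly `A` there.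
theorem Conn.exists_cut_of_not_conn_split (hG : G.Conn) {A : S → Prop} {x : V}
    (hA : ∀ s, A s → G.vert s = x) (h : ¬ (G.split A).Conn) :
    ∃ P : S → Prop, (∀ s, P (G.mate s) ↔ P s) ∧
      (∀ s t, G.vert s = G.vert t → G.vert s ≠ x → (P s ↔ P t)) ∧
      ∀ s, G.vert s = x → (P s ↔ A s) := by
  unfold Conn at h
  push Not at h
  obtain ⟨P, hv, hm, s, t, hs, ht⟩ := h
  have hm' : ∀ s, P (G.mate s) ↔ P s :=
    fun s => ⟨fun hs => by rw [← G.mate_mate s]; exact hm _ hs, hm s⟩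
  have hv' : ∀ s t, G.vert s = G.vert t → G.vert s ≠ x → (P s ↔ P t) := by
    intro s t hst hx
    have h1 : ¬ A s := fun h => hx (hA s h)
    have h2 : ¬ A t := fun h => hx (hst.trans (hA t h))
    exact ⟨hv s t (split_vert_eq.2 ⟨hst, by tauto⟩), hv t s (split_vert_eq.2 ⟨hst.symm, by tauto⟩)⟩
  have hx : ¬ ∀ s t, G.vert s = x → G.vert t = x → P s → P t := by
    intro hx
    refine ht (hG P ?_ hm s t hs)
    intro a b hab ha
    by_cases hax : G.vert a = x
    · exact hx a b hax (hab ▸ hax) ha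
    · exact (hv' a b hab hax).1 ha
  push Not at hx
  obtain ⟨a, b, ha, hb, hPa, hPb⟩ := hx
  have key : ∀ s t, G.vert s = x → G.vert t = x → (A s ↔ A t) → P s → P t :=
    fun s t hs ht hst => hv s t (split_vert_eq.2 ⟨hs.trans ht.symm, hst⟩)
  by_cases hAa : A a
  · refine ⟨P, hm', hv', fun u hu => ?_⟩
    have k1 := key a u ha hu
    have k2 := key u b hu hb
    have k3 := key a b ha hb
    tauto
  · refine ⟨fun s => ¬ P s, fun s => not_congr (hm' s), fun s t h h' => not_congr (hv' s t h h'),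
      fun u hu => ?_⟩
    have k1 := key a u ha hu
    have k2 := key u b hu hb
    have k3 := key a b ha hb
    tauto

/-- The part of a graph carried by a set of edges. -/
def sub (G : StubGraph S V) (P : S → Prop) (hP : ∀ s, P s → P (G.mate s)) :
    StubGraph {s // P s} V where
  vert s := G.vert s.1
  mate s := ⟨G.mate s.1, hP _ s.2⟩
  sgn s := G.sgn s.1
  mate_mate s := Subtype.ext (G.mate_mate s.1)
  mate_ne s h := G.mate_ne s.1 (congrArg Subtype.val h)
  sgn_mate s := G.sgn_mate s.1

omit [Fintype S] in
-- `h2` allows only one pair at `x`; with several pairs the elimination could disconnect the graph.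
theorem Conn.elim {x : V} {f : S → S} (hG : G.Conn) (h : G.IsPairing x f)
    (h2 : ∀ s t, G.vert s = x → G.vert t = x → t = s ∨ t = f s) : (StubGraph.elim h).Conn := by
  intro Q hv hm s t hs
  have key := hG (fun u => (∃ hu : G.vert u ≠ x, Q ⟨u, hu⟩) ∨
    ∃ hu : G.vert u = x, Q ⟨G.mate u, h.noloop u hu⟩) ?_ ?_ s.1 t.1 (Or.inl ⟨s.2, hs⟩)
  · rcases key with ⟨_, h⟩ | ⟨h, _⟩
    exacts [h, (t.2 h).elim]
  · rintro a b hab (⟨ha, hQ⟩ | ⟨ha, hQ⟩)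
    · exact Or.inl ⟨hab ▸ ha, hv ⟨a, ha⟩ ⟨b, hab ▸ ha⟩ (Subtype.ext hab) hQ⟩
    · have hb := hab ▸ ha
      refine Or.inr ⟨hb, ?_⟩
      rcases h2 a b ha hb with rfl | rfl
      · exact hQ
      · have h3 := hm _ hQ
        have h4 : (StubGraph.elim h).mate ⟨G.mate a, h.noloop a ha⟩
            = ⟨G.mate (f a), h.noloop _ (h.maps a ha)⟩ := by
          refine Subtype.ext ?_
          rw [elim_mate_of_eq h _ (by simpa [G.mate_mate] using ha), G.mate_mate]
        rwa [h4] at h3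
  · rintro a (⟨ha, hQ⟩ | ⟨ha, hQ⟩)
    · by_cases hma : G.vert (G.mate a) = x
      · refine Or.inr ⟨hma, ?_⟩
        have h4 : (⟨G.mate (G.mate a), h.noloop _ hma⟩ : {s // G.vert s ≠ x}) = ⟨a, ha⟩ :=
          Subtype.ext (G.mate_mate a)
        rwa [h4]
      · refine Or.inl ⟨hma, ?_⟩
        have h3 := hm _ hQ
        have h4 : (StubGraph.elim h).mate ⟨a, ha⟩ = ⟨G.mate a, hma⟩ :=
          Subtype.ext (elim_mate_of_ne h _ hma)
        rwa [h4] at h3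
    · exact Or.inl ⟨h.noloop a ha, hQ⟩

end StubGraph

section cnt

variable {S T : Type*} [Fintype S] [Fintype T]

theorem cnt_or_le (p q : S → Prop) : cnt (fun s => p s ∨ q s) ≤ cnt p + cnt q := by
  classical
  simp only [cnt, ← Finset.sum_add_distrib]
  refine Finset.sum_le_sum fun s _ => ?_
  by_cases hp : p s <;> by_cases hq : q s <;> simp [hp, hq]

theorem cnt_sum (p : S ⊕ T → Prop) :
    cnt p = cnt (fun s => p (Sum.inl s)) + cnt (fun t => p (Sum.inr t)) := by
  classical
  simp only [cnt, Fintype.sum_sum_type]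

theorem cnt_le_of_injective {j : S → T} (hj : Function.Injective j) (p : T → Prop) :
    cnt (fun s => p (j s)) ≤ cnt p := by
  classical
  rw [cnt_eq_card, cnt_eq_card, ← Finset.card_map ⟨j, hj⟩]
  refine Finset.card_le_card ?_
  intro t
  simp only [Finset.mem_map, Finset.mem_filter, Finset.mem_univ, true_and]
  rintro ⟨s, hs, rfl⟩
  exact hs

theorem cnt_prod_eq (a : S) (q : T → Prop) : cnt (fun t : S × T => t.1 = a ∧ q t.2) = cnt q := by
  let e : T ≃ {t : S × T // t.1 = a} :=
    { toFun := fun t => ⟨(a, t), rfl⟩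
      invFun := fun t => t.1.2
      left_inv := fun t => rfl
      right_inv := by
        rintro ⟨⟨b, t⟩, rfl⟩
        rfl }
  rw [cnt_of_equiv e fun t => q t.2]
  exact cnt_congr fun t => Iff.rfl

end cnt

/-- A family of sets of even size that is closed under the union of intersecting sets does not
cover a set of odd size. -/
theorem exists_notMem_of_even {V : Type*} [Fintype V] (hV : Odd (Fintype.card V))
    {F : Set (Set V)} (heven : ∀ W ∈ F, Even (cnt fun x => x ∈ W))
    (hunion : ∀ A ∈ F, ∀ B ∈ F, (A ∩ B).Nonempty → A ∪ B ∈ F) : ∃ x, ∀ W ∈ F, x ∉ W := by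
  classical
  by_contra hcon
  push Not at hcon
  -- If every vertex were covered, the maximal members of `F` would partition the vertices into sets
  -- of even size.
  have hmax : ∀ x, ∃ W ∈ F, x ∈ W ∧ ∀ B ∈ F, x ∈ B → W ⊆ B → B ⊆ W := by
    intro x
    obtain ⟨W, hW, hx⟩ := hcon x
    have hfin : {B : Set V | B ∈ F ∧ x ∈ B}.Finite := Set.toFinite _
    obtain ⟨M, -, hM, hmax⟩ := hfin.exists_le_maximal (a := W) ⟨hW, hx⟩
    exact ⟨M, hM.1, hM.2, fun B hB hxB hMB => hmax ⟨hB, hxB⟩ hMB⟩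
  choose M hMF hxM hM using hmax
  have hsub : ∀ x y, y ∈ M x → M x ⊆ M y := by
    intro x y hy
    have h1 := hunion _ (hMF x) _ (hMF y) ⟨y, hy, hxM y⟩
    exact Set.subset_union_left.trans (hM y _ h1 (Or.inl hy) Set.subset_union_right)
  have heq : ∀ x y, y ∈ M x → M y = M x := by
    intro x y hy
    have h1 := hsub x y hy
    exact Set.Subset.antisymm (hsub y x (h1 (hxM x))) h1
  rw [← Nat.not_even_iff_odd] at hV
  apply hV
  rw [← cnt_true, cnt_fiber M]
  refine Finset.even_sum _ fun W _ => ?_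
  by_cases hW : ∃ x, M x = W
  · obtain ⟨x, rfl⟩ := hW
    rw [cnt_congr (q := fun y => y ∈ M x)]
    · exact heven _ (hMF x)
    · exact fun y => ⟨fun h => h.1 ▸ hxM y, fun h => ⟨heq x y h, trivial⟩⟩
  · push Not at hW
    rw [cnt_eq_zero.2 fun x h => hW x h.1]
    exact Even.zero

/-! ### Cores and the choice of the root -/

namespace StubGraph

variable {S V : Type*} {G : StubGraph S V} [Fintype S] [Fintype V]

theorem cnt_vert {k : ℕ} (hdeg : ∀ x, G.deg x = k) (p : V → Prop) :
    (cnt fun s => p (G.vert s)) = k * cnt p := by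
  classical
  rw [cnt_fiber G.vert]
  simp only [cnt, Finset.mul_sum]
  refine Finset.sum_congr rfl fun x _ => ?_
  have := hdeg x
  by_cases hx : p x
  · rw [if_pos hx, mul_one, ← this, deg, cnt]
    refine Finset.sum_congr rfl fun s _ => ?_
    by_cases hs : G.vert s = x
    · subst hs
      simp [hx]
    · simp [hs]
  · rw [if_neg hx, mul_zero]
    refine Finset.sum_eq_zero fun s _ => ?_
    rw [if_neg]
    rintro ⟨rfl, h⟩
    exact hx h

omit [Fintype V] in
-- A section amounts to a switching: the edges leaving it are the lifts of the edges that are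
-- negative after switching by `c`.
theorem d_section (c : V → Bool) : G.d {z | z.2 = c z.1}
    = cnt fun s => xor (G.sgn s) (xor (c (G.vert s)) (c (G.vert (G.mate s)))) = true := by
  have h : G.d {z | z.2 = c z.1} = cnt fun p : S × Bool =>
      p.2 = c (G.vert p.1) ∧ ¬ xor p.2 (G.sgn p.1) = c (G.vert (G.mate p.1)) := rfl
  rw [h, cnt_prod_bool, ← cnt_add_cnt_not
    (fun s => xor (G.sgn s) (xor (c (G.vert s)) (c (G.vert (G.mate s)))) = true)
    (fun s => c (G.vert s) = false)]
  congr 1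
  · refine cnt_congr fun s => ?_
    cases c (G.vert s) <;> cases c (G.vert (G.mate s)) <;> cases G.sgn s <;> simp
  · refine cnt_congr fun s => ?_
    cases c (G.vert s) <;> cases c (G.vert (G.mate s)) <;> cases G.sgn s <;> simp

theorem d_section_mod_four (hdeg : ∀ x, Even (G.deg x)) (c : V → Bool) :
    G.d {z | z.2 = c z.1} % 4 = (cnt fun s => G.sgn s = true) % 4 := by
  have h := cnt_switch (G := G) (p := fun _ => True) (fun _ h => h)
    (fun x => by simpa [deg] using hdeg x) c
  simp only [true_and] at h
  rw [d_section, h]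

/-- The vertices of which at least one lift belongs to `X`. -/
def supp (X : Set (V × Bool)) : Set V := {x | (x, false) ∈ X ∨ (x, true) ∈ X}

omit [Fintype V] in
theorem lifts_supp (X : Set (V × Bool)) : lifts (supp X) = X ∪ star X := by
  ext ⟨x, b⟩
  cases b <;> simp [lifts, supp, mem_star, or_comm]

omit [Fintype V] in
theorem supp_star (X : Set (V × Bool)) : supp (star X) = supp X := by
  ext x
  simp [supp, mem_star, or_comm]

omit [Fintype V] in
theorem supp_union (X Y : Set (V × Bool)) : supp (X ∪ Y) = supp X ∪ supp Y := by
  ext x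
  simp [supp]
  tauto

omit [Fintype V] in
theorem OneSided.mono {X Y : Set (V × Bool)} (h : OneSided X) (hY : Y ⊆ X) : OneSided Y :=
  fun z hz hz' => h z (hY hz) (hY hz')

omit [Fintype V] in
theorem OneSided.star {X : Set (V × Bool)} (h : OneSided X) : OneSided (star X) := by
  intro z hz hz'
  exact h _ hz hz'

omit [Fintype V] in
theorem OneSided.disjoint {X : Set (V × Bool)} (h : OneSided X) {x : V} (hx : (x, false) ∈ X) :
    (x, true) ∉ X := h _ hx

/-- A six-regular odd graph, all of whose edges are negative, without small cuts. -/
structure IsCore (G : StubGraph S V) : Prop where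
  deg : ∀ x, G.deg x = 6
  sgn : ∀ s, G.sgn s = true
  odd : Fintype.card S % 4 = 2
  cut : ∀ W : Set V, W.Nonempty → W ≠ Set.univ → 8 ≤ G.d (lifts W)

/-- A one-sided set which separates the lifts of a part of the vertices by four edges. -/
structure IsBad (G : StubGraph S V) (U : Set (V × Bool)) : Prop where
  oneSided : OneSided U
  ne : supp U ≠ Set.univ
  d : G.d U = 4

namespace IsCore

omit [Fintype V] in
theorem even_deg (h : G.IsCore) (x : V) : Even (G.deg x) := by
  rw [h.deg]
  decide

/-- The half-edges number six times the vertices, and 2 modulo 4. -/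
theorem odd_card (h : G.IsCore) : Odd (Fintype.card V) := by
  have h1 := cnt_vert h.deg fun _ => True
  rw [cnt_true, cnt_true] at h1
  have := h.odd
  rw [Nat.odd_iff]
  omega

theorem cnt_mate (h : G.IsCore) (p q : V → Prop) :
    (cnt fun s => p (G.vert s) ∧ q (G.vert (G.mate s)))
      + (cnt fun s => p (G.vert s) ∧ ¬ q (G.vert (G.mate s))) = 6 * cnt p := by
  rw [← cnt_vert h.deg, cnt_add_cnt_not]

omit [Fintype V] in
theorem cnt_comm (p q : V → Prop) :
    (cnt fun s => p (G.vert s) ∧ q (G.vert (G.mate s)))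
      = cnt fun s => q (G.vert s) ∧ p (G.vert (G.mate s)) := by
  rw [← cnt_comp_involutive G.mate_mate]
  exact cnt_congr fun s => by rw [G.mate_mate, and_comm]

/-- The cut counts the half-edges of edges inside the two colour classes. It is 2 modulo 4, so it
remains to exclude 2. By six-regularity the two inner counts differ by a multiple of 6; both are
even, and with sum 2 they would differ by 2. -/
theorem six_le_d_section (h : G.IsCore) (c : V → Bool) : 6 ≤ G.d {z | z.2 = c z.1} := by
  have h1 := d_section_mod_four h.even_deg c
  rw [cnt_congr (q := fun _ => True) (fun s => by simp [h.sgn]), cnt_true, h.odd] at h1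
  have h2 := cnt_add_cnt_not (fun s => xor (G.sgn s) (xor (c (G.vert s)) (c (G.vert (G.mate s))))
    = true) (fun s => c (G.vert s) = true)
  rw [← d_section] at h2
  have e1 : (cnt fun s => xor (G.sgn s) (xor (c (G.vert s)) (c (G.vert (G.mate s)))) = true ∧
      c (G.vert s) = true) = cnt fun s => c (G.vert s) = true ∧ c (G.vert (G.mate s)) = true := by
    refine cnt_congr fun s => ?_
    rw [h.sgn]
    cases c (G.vert s) <;> cases c (G.vert (G.mate s)) <;> simp
  have e2 : (cnt fun s => xor (G.sgn s) (xor (c (G.vert s)) (c (G.vert (G.mate s)))) = true ∧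
      ¬ c (G.vert s) = true)
      = cnt fun s => ¬ c (G.vert s) = true ∧ ¬ c (G.vert (G.mate s)) = true := by
    refine cnt_congr fun s => ?_
    rw [h.sgn]
    cases c (G.vert s) <;> cases c (G.vert (G.mate s)) <;> simp
  have h3 := h.cnt_mate (fun x => c x = true) (fun x => c x = true)
  have h4 := h.cnt_mate (fun x => ¬ c x = true) (fun x => c x = true)
  have h5 := cnt_comm (G := G) (fun x => ¬ c x = true) (fun x => c x = true)
  have h6 : Even (cnt fun s => c (G.vert s) = true ∧ c (G.vert (G.mate s)) = true) := by
    refine even_cnt_of_involution G.mate ?_ (fun s _ => G.mate_mate s) (fun s _ => G.mate_ne s)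
    rintro s ⟨h, h'⟩
    exact ⟨h', by rwa [G.mate_mate]⟩
  obtain ⟨k, hk⟩ := h6
  omega

theorem six_le_d_of_supp_eq (h : G.IsCore) {U : Set (V × Bool)} (hU : OneSided U)
    (hsupp : supp U = Set.univ) : 6 ≤ G.d U := by
  classical
  have h1 : U = {z : V × Bool | z.2 = decide ((z.1, true) ∈ U)} := by
    ext ⟨x, b⟩
    have h2 : x ∈ supp U := hsupp ▸ Set.mem_univ x
    have h3 := hU (x, false)
    have h4 : (x, false) ∈ U ∨ (x, true) ∈ U := h2
    cases b
    · simp only [Bool.not_false] at h3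
      simp only [Set.mem_ofPred_eq]
      rw [eq_comm, decide_eq_false_iff_not]
      tauto
    · simp
  rw [h1]
  exact h.six_le_d_section fun x => decide ((x, true) ∈ U)

omit [Fintype V] in
-- `U` and `star U` have equal cuts, and their union is left by at least eight edges.
theorem four_le_d (h : G.IsCore) {U : Set (V × Bool)} (hne : U.Nonempty)
    (hsupp : supp U ≠ Set.univ) : 4 ≤ G.d U := by
  have h1 := G.d_inter_add_d_union_le U (star U)
  rw [← lifts_supp, d_star] at h1
  obtain ⟨⟨x, b⟩, hx⟩ := hne
  have h2 := h.cut (supp U) ⟨x, by cases b <;> simp [supp, hx]⟩ hsupp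
  omega

theorem isBad_or (h : G.IsCore) {U : Set (V × Bool)} (hU : OneSided U) (hne : U.Nonempty) :
    G.IsBad U ∨ 6 ≤ G.d U := by
  by_cases hsupp : supp U = Set.univ
  · exact Or.inr (h.six_le_d_of_supp_eq hU hsupp)
  · have h1 := h.four_le_d hne hsupp
    obtain ⟨k, hk⟩ := G.even_d h.even_deg U
    by_cases h4 : G.d U = 4
    · exact Or.inl ⟨hU, hsupp, h4⟩
    · right; omega

omit [Fintype V] in
theorem _root_.StubGraph.IsBad.nonempty {U : Set (V × Bool)} (hU : G.IsBad U) : U.Nonempty := by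
  rw [Set.nonempty_iff_ne_empty]
  rintro rfl
  have h1 := hU.d
  have h2 : G.d (∅ : Set (V × Bool)) = 0 := cnt_eq_zero.2 fun s h => h.1
  omega

omit [Fintype V] in
theorem _root_.StubGraph.IsBad.star {U : Set (V × Bool)} (hU : G.IsBad U) : G.IsBad (star U) :=
  ⟨hU.oneSided.star, by rw [supp_star]; exact hU.ne, by rw [d_star]; exact hU.d⟩

/-- Let `A` and `B` be the vertices represented in `U` by the one and the other lift. The support is
left by at least four edges and `U` by only four, so edges inside the support join `A` to `B`. By
six-regularity the numbers of edges leaving from `A` and from `B` differ by a multiple of 6; as they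
sum to 4, they are equal, and so are the sizes of `A` and `B`. -/
theorem even_supp (h : G.IsCore) {U : Set (V × Bool)} (hU : G.IsBad U) :
    Even (cnt fun x => x ∈ supp U) := by
  have h8 := h.four_le_d hU.nonempty hU.ne
  obtain ⟨⟨x, b⟩, hx⟩ := hU.nonempty
  have h1 := h.cut (supp U) ⟨x, by cases b <;> simp [supp, hx]⟩ hU.ne
  rw [d_lifts] at h1
  have h2 := hU.d
  have h3 : G.d U = cnt fun p : S × Bool => G.near p ∈ U ∧ ¬ G.far p ∈ U := rfl
  rw [h3, cnt_prod_bool] at h2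
  set A : V → Prop := fun x => (x, false) ∈ U with hA
  set B : V → Prop := fun x => (x, true) ∈ U with hB
  have hAB : ∀ x, A x → ¬ B x := fun x h => hU.oneSided.disjoint h
  have e1 : (cnt fun s => G.near (s, false) ∈ U ∧ ¬ G.far (s, false) ∈ U)
      = cnt fun s => A (G.vert s) ∧ ¬ B (G.vert (G.mate s)) :=
    cnt_congr fun s => by simp [near, far, h.sgn, hA, hB]
  have e2 : (cnt fun s => G.near (s, true) ∈ U ∧ ¬ G.far (s, true) ∈ U)
      = cnt fun s => B (G.vert s) ∧ ¬ A (G.vert (G.mate s)) :=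
    cnt_congr fun s => by simp [near, far, h.sgn, hA, hB]
  rw [e1, e2] at h2
  have a1 := cnt_add_cnt_not (fun s => A (G.vert s) ∧ ¬ B (G.vert (G.mate s)))
    (fun s => A (G.vert (G.mate s)))
  have b1 := cnt_add_cnt_not (fun s => B (G.vert s) ∧ ¬ A (G.vert (G.mate s)))
    (fun s => B (G.vert (G.mate s)))
  have c1 := cnt_add_cnt_not (fun s => G.vert s ∈ supp U ∧ G.vert (G.mate s) ∉ supp U)
    (fun s => A (G.vert s))
  have c2 : (cnt fun s => (G.vert s ∈ supp U ∧ G.vert (G.mate s) ∉ supp U) ∧ A (G.vert s))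
      = cnt fun s => (A (G.vert s) ∧ ¬ B (G.vert (G.mate s))) ∧ ¬ A (G.vert (G.mate s)) := by
    refine cnt_congr fun s => ?_
    have : ∀ x, x ∈ supp U ↔ A x ∨ B x := fun x => Iff.rfl
    rw [this, this]
    tauto
  have c3 : (cnt fun s => (G.vert s ∈ supp U ∧ G.vert (G.mate s) ∉ supp U) ∧ ¬ A (G.vert s))
      = cnt fun s => (B (G.vert s) ∧ ¬ A (G.vert (G.mate s))) ∧ ¬ B (G.vert (G.mate s)) := by
    refine cnt_congr fun s => ?_
    have : ∀ x, x ∈ supp U ↔ A x ∨ B x := fun x => Iff.rfl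
    have := hAB (G.vert s)
    rw [‹∀ x, x ∈ supp U ↔ A x ∨ B x›, ‹∀ x, x ∈ supp U ↔ A x ∨ B x›]
    tauto
  have m1 := h.cnt_mate A B
  have m2 := h.cnt_mate B A
  have m3 := cnt_comm (G := G) A B
  have n1 := cnt_add_cnt_not (fun x => x ∈ supp U) A
  have n2 : (cnt fun x => x ∈ supp U ∧ A x) = cnt A :=
    cnt_congr fun x => ⟨fun h => h.2, fun h => ⟨Or.inl h, h⟩⟩
  have n3 : (cnt fun x => x ∈ supp U ∧ ¬ A x) = cnt B :=
    cnt_congr fun x => ⟨fun h => h.1.resolve_left h.2, fun h => ⟨Or.inr h, fun h' => hAB x h' h⟩⟩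
  rw [Nat.even_iff]
  omega

/-- Two bad sets do not agree on one vertex and disagree on another one. -/
theorem not_conflict (h : G.IsCore) {U U' : Set (V × Bool)} (hU : G.IsBad U) (hU' : G.IsBad U')
    (h1 : (U ∩ U').Nonempty) (h2 : (U ∩ StubGraph.star U').Nonempty) : False := by
  have supp_ne : ∀ X ⊆ U, supp X ≠ Set.univ := by
    intro X hX hX'
    apply hU.ne
    rw [Set.eq_univ_iff_forall] at hX' ⊢
    intro x
    exact (hX' x).imp (fun h => hX h) (fun h => hX h)
  -- Uncrossing `U` with `U'` and with `star U'`, then the two unions, then the result with its own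
  -- `star`, leads to sets consisting of all lifts of their vertices, to which the cut condition
  -- applies.
  have a1 := G.d_inter_add_d_union_le U U'
  have a2 := G.d_inter_add_d_union_le U (StubGraph.star U')
  have a3 := G.d_inter_add_d_union_le (U ∪ U') (U ∪ StubGraph.star U')
  have a4 := G.d_inter_add_d_union_le (U ∪ (U' ∪ StubGraph.star U'))
    (StubGraph.star (U ∪ (U' ∪ StubGraph.star U')))
  have o1 : OneSided (U ∩ U') := hU.oneSided.mono Set.inter_subset_left
  have o2 : OneSided (U ∩ StubGraph.star U') := hU.oneSided.mono Set.inter_subset_left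
  have b1 := h.four_le_d h1 (supp_ne _ Set.inter_subset_left)
  have b2 := h.four_le_d h2 (supp_ne _ Set.inter_subset_left)
  rw [d_star, hU.d, hU'.d] at a2
  rw [hU.d, hU'.d] at a1
  have s1 : (U ∪ U') ∩ (U ∪ StubGraph.star U') = U := by
    ext z
    have := hU'.oneSided z
    simp only [Set.mem_inter_iff, Set.mem_union, mem_star]
    tauto
  have s2 : (U ∪ U') ∪ (U ∪ StubGraph.star U') = U ∪ (U' ∪ StubGraph.star U') := by
    ext z
    simp only [Set.mem_union]
    tauto
  rw [s1, s2, hU.d] at a3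
  have s3 : (U ∪ (U' ∪ StubGraph.star U')) ∩ StubGraph.star (U ∪ (U' ∪ StubGraph.star U'))
      = lifts (supp U') := by
    rw [lifts_supp]
    ext ⟨x, b⟩
    have := hU.oneSided (x, b)
    simp only [Set.mem_inter_iff, Set.mem_union, mem_star, Bool.not_not] at this ⊢
    tauto
  have s4 : (U ∪ (U' ∪ StubGraph.star U')) ∪ StubGraph.star (U ∪ (U' ∪ StubGraph.star U'))
      = lifts (supp (U ∪ U')) := by
    rw [lifts_supp]
    ext ⟨x, b⟩
    simp only [Set.mem_union, mem_star, Bool.not_not]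
    tauto
  rw [s3, s4, d_star] at a4
  obtain ⟨⟨x, b⟩, hx⟩ := hU'.nonempty
  have c1 := h.cut (supp U') ⟨x, by cases b <;> simp [supp, hx]⟩ hU'.ne
  -- The last uncrossing bounds the sum of the cuts over the two supports by 8. If the joint support
  -- were proper, both cuts would be at least 8.
  by_cases hfull : supp (U ∪ U') = Set.univ
  swap
  · have c2 := h.cut (supp (U ∪ U')) ⟨x, by cases b <;> simp [supp, hx]⟩ hfull
    omega
  -- All inequalities are now tight, so both intersections are bad and have even supports.
  -- Inclusion-exclusion expresses the number of vertices through four even numbers, but it is odd.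
  have e1 := h.even_supp ⟨o1, supp_ne _ Set.inter_subset_left, by omega⟩
  have e2 := h.even_supp ⟨o2, supp_ne _ Set.inter_subset_left, by omega⟩
  have e3 := h.even_supp hU
  have e4 := h.even_supp hU'
  have n0 := h.odd_card
  have n1 := cnt_add_cnt_not (fun _ : V => True) (fun x => x ∈ supp U)
  have n2 := cnt_add_cnt_not (fun x => x ∈ supp U') (fun x => x ∈ supp U)
  have n3 := cnt_add_cnt_not (fun x => x ∈ supp U' ∧ x ∈ supp U) (fun x => x ∈ supp (U ∩ U'))
  have m1 : (cnt fun x => True ∧ x ∈ supp U) = cnt fun x => x ∈ supp U :=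
    cnt_congr fun x => by simp
  have m2 : (cnt fun x => True ∧ ¬ x ∈ supp U) = cnt fun x => x ∈ supp U' ∧ ¬ x ∈ supp U := by
    refine cnt_congr fun x => ?_
    have : x ∈ supp (U ∪ U') := hfull ▸ Set.mem_univ x
    rw [supp_union] at this
    have : x ∈ supp U ∨ x ∈ supp U' := this
    tauto
  have m3 : (cnt fun x => (x ∈ supp U' ∧ x ∈ supp U) ∧ x ∈ supp (U ∩ U'))
      = cnt fun x => x ∈ supp (U ∩ U') := by
    refine cnt_congr fun x => ?_
    simp only [supp, Set.mem_ofPred_eq, Set.mem_inter_iff]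
    tauto
  have m4 : (cnt fun x => (x ∈ supp U' ∧ x ∈ supp U) ∧ ¬ x ∈ supp (U ∩ U'))
      = cnt fun x => x ∈ supp (U ∩ StubGraph.star U') := by
    refine cnt_congr fun x => ?_
    have t1 := hU.oneSided (x, false)
    have t2 := hU'.oneSided (x, false)
    simp only [supp, Set.mem_ofPred_eq, Set.mem_inter_iff, mem_star, Bool.not_false,
      Bool.not_true] at t1 t2 ⊢
    tauto
  rw [m1, m2, cnt_true] at n1
  rw [m3, m4] at n3
  rw [Nat.odd_iff] at n0
  rw [Nat.even_iff] at e1 e2 e3 e4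
  omega

theorem isBad_union (h : G.IsCore) {U U' : Set (V × Bool)} (hU : G.IsBad U) (hU' : G.IsBad U')
    (h1 : (U ∩ U').Nonempty) : G.IsBad (U ∪ U') := by
  have h2 : OneSided (U ∪ U') := by
    rintro ⟨x, b⟩ hz hz'
    refine h.not_conflict hU hU' h1 ?_
    rcases hz with hz | hz <;> rcases hz' with hz' | hz'
    · exact (hU.oneSided _ hz hz').elim
    · exact ⟨_, hz, hz'⟩
    · exact ⟨_, hz', by simpa [mem_star] using hz⟩
    · exact (hU'.oneSided _ hz hz').elim
  refine (h.isBad_or h2 hU.nonempty.inl).resolve_right ?_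
  have a1 := G.d_inter_add_d_union_le U U'
  have b1 := h.isBad_or (hU.oneSided.mono Set.inter_subset_left) h1
  have b2 : 4 ≤ G.d (U ∩ U') := by
    rcases b1 with b | b
    · exact b.d.ge
    · omega
  rw [hU.d, hU'.d] at a1
  omega

/-- Some vertex belongs to the support of no bad set. -/
theorem exists_root (h : G.IsCore) : ∃ v, ∀ X : Set (V × Bool), (v, false) ∈ X → (v, true) ∉ X →
    6 ≤ G.d X := by
  have heven : ∀ W ∈ {W | ∃ U, G.IsBad U ∧ supp U = W}, Even (cnt fun x => x ∈ W) := by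
    rintro _ ⟨U, hU, rfl⟩
    exact h.even_supp hU
  have hunion : ∀ A ∈ {W | ∃ U, G.IsBad U ∧ supp U = W}, ∀ B ∈ {W | ∃ U, G.IsBad U ∧ supp U = W},
      (A ∩ B).Nonempty → A ∪ B ∈ {W | ∃ U, G.IsBad U ∧ supp U = W} := by
    rintro _ ⟨U, hU, rfl⟩ _ ⟨U', hU', rfl⟩ ⟨x, hx, hx'⟩
    by_cases h1 : (U ∩ U').Nonempty
    · exact ⟨_, h.isBad_union hU hU' h1, supp_union _ _⟩
    -- A common vertex of the supports without a common lift becomes a common lift after replacing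
    -- `U'` by `star U'`, which has the same support.
    · refine ⟨_, h.isBad_union hU hU'.star ?_, by rw [supp_union, supp_star]⟩
      rw [Set.not_nonempty_iff_eq_empty, Set.eq_empty_iff_forall_notMem] at h1
      have h2 := h1 (x, false)
      have h3 := h1 (x, true)
      simp only [supp, Set.mem_ofPred_eq, Set.mem_inter_iff] at hx hx' h2 h3
      by_cases hf : (x, false) ∈ U
      · exact ⟨(x, false), hf, by simp only [mem_star, Bool.not_false]; tauto⟩
      · exact ⟨(x, true), by tauto, by simp only [mem_star, Bool.not_true]; tauto⟩
  obtain ⟨v, hv⟩ := exists_notMem_of_even h.odd_card heven hunion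
  refine ⟨v, fun X hX hX' => ?_⟩
  have h1 : (v, false) ∈ oneSidedPart X := ⟨hX, hX'⟩
  have h2 := G.d_oneSidedPart_le X
  rcases h.isBad_or (oneSided_oneSidedPart X) ⟨_, h1⟩ with hb | hb
  · exact (hv _ ⟨_, hb, rfl⟩ (Or.inl h1)).elim
  · omega

end IsCore

end StubGraph

/-! ### Triangles in place of vertices: from a core to a rooted graph -/

/-- The majority value of three. -/
def maj (m : Fin 3 → Bool) : Bool := (m 0 && m 1) || (m 0 && m 2) || (m 1 && m 2)

/-- The corner of a triangle at which a half-edge of the triangle is attached. -/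
def corner (k : Fin 3 × Bool) : Fin 3 := if k.2 then k.1 + 1 else k.1

/-- A corner in the minority costs two triangle edges in the cut, and carries two half-edges of the
original graph. This pays for moving it to the side of the majority. -/
theorem two_mul_minority_le : ∀ m : Fin 3 → Bool,
    (∑ i, if m i ≠ maj m then 2 else 0) ≤ (Finset.univ.filter fun k : Fin 3 × Bool =>
      m (corner k) = true ∧ ¬ m (corner (k.1, !k.2)) = true).card := by
  decide

theorem eq_false_of_maj : ∀ m : Fin 3 → Bool, maj m = false → ∀ i, m i = true →
    ∀ j, j ≠ i → m j = false := by
  decide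

theorem card_corner : ∀ i, (Finset.univ.filter fun k => corner k = i).card = 2 := by
  decide

/-- Two ways to divide six half-edges into three pairs: equal residues modulo 3 mean a difference of
3, equal quotients by 2 a difference of 1, so one of the two separates `a` and `b`. -/
theorem exists_labels : ∀ a b : Fin 6, a ≠ b → ∃ c : Bool,
    (if c then Fin.ofNat 3 (a : ℕ) else Fin.ofNat 3 ((a : ℕ) / 2))
      ≠ if c then Fin.ofNat 3 (b : ℕ) else Fin.ofNat 3 ((b : ℕ) / 2) := by
  decide

theorem card_label : ∀ (c : Bool) (i : Fin 3), (Finset.univ.filter fun a : Fin 6 =>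
    (if c then Fin.ofNat 3 (a : ℕ) else Fin.ofNat 3 ((a : ℕ) / 2)) = i).card = 2 := by
  decide

namespace StubGraph

variable {S V : Type*} {G : StubGraph S V} [Fintype S] {v : V} {l : S → Fin 3}

/-- A labelling of the stubs which distributes the six stubs at `x` to the three corners of a
triangle, the two stubs of a loop going to different corners. -/
structure IsLabelling (G : StubGraph S V) (l : S → Fin 3) (x : V) : Prop where
  two : ∀ i, (cnt fun s => G.vert s = x ∧ l s = i) = 2
  ne : ∀ s, G.vert s = x → G.vert (G.mate s) = x → l s ≠ l (G.mate s)

/-- At least four of the six half-edges lead away from `x`, so there is at most one loop, and only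
one pair of half-edges has to be kept apart. -/
theorem exists_isLabelling {x : V} (h6 : G.deg x = 6) (hcut : 8 ≤ G.d (lifts {x})) :
    ∃ l, G.IsLabelling l x := by
  classical
  obtain ⟨e⟩ : Nonempty ({s // G.vert s = x} ≃ Fin 6) := by
    have h := h6
    rw [deg, cnt_eq_card, ← Fintype.card_subtype] at h
    exact ⟨Fintype.equivFinOfCardEq h⟩
  have key : ∀ c : Bool, ∃ l : S → Fin 3, (∀ i, (cnt fun s => G.vert s = x ∧ l s = i) = 2) ∧
      ∀ s : {s // G.vert s = x}, l s.1 =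
        if c then Fin.ofNat 3 (e s : ℕ) else Fin.ofNat 3 ((e s : ℕ) / 2) := by
    intro c
    let l : S → Fin 3 := fun s => if hs : G.vert s = x then
      if c then Fin.ofNat 3 (e ⟨s, hs⟩ : ℕ) else Fin.ofNat 3 ((e ⟨s, hs⟩ : ℕ) / 2) else 0
    have hl : ∀ s : {s // G.vert s = x}, l s.1 =
        if c then Fin.ofNat 3 (e s : ℕ) else Fin.ofNat 3 ((e s : ℕ) / 2) := fun s => by
      simp [l, s.2]
    refine ⟨l, fun i => ?_, hl⟩
    rw [cnt_of_equiv e.symm fun s => l s = i, ← card_label c i, cnt_eq_card]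
    congr 1
    ext a
    rw [Finset.mem_filter, Finset.mem_filter, hl, e.apply_symm_apply]
  by_cases hloop : ∃ s, G.vert s = x ∧ G.vert (G.mate s) = x
  · obtain ⟨s, hs, hs'⟩ := hloop
    obtain ⟨c, hc⟩ := exists_labels (e ⟨s, hs⟩) (e ⟨G.mate s, hs'⟩) fun h =>
      G.mate_ne s (congrArg Subtype.val (e.injective h)).symm
    obtain ⟨l, hl, hle⟩ := key c
    have hne : l s ≠ l (G.mate s) := by
      rw [hle ⟨s, hs⟩, hle ⟨G.mate s, hs'⟩]
      exact hc
    refine ⟨l, hl, fun t ht ht' => ?_⟩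
    by_cases hts : t = s
    · rwa [hts]
    by_cases htm : t = G.mate s
    · rw [htm, G.mate_mate]
      exact hne.symm
    exfalso
    rw [d_lifts] at hcut
    have h1 := cnt_add_cnt_not (fun s => G.vert s = x) (fun s => G.vert (G.mate s) = x)
    have h2 : 3 ≤ cnt fun s => G.vert s = x ∧ G.vert (G.mate s) = x := by
      rw [cnt_eq_card]
      have h3 : ({t, s, G.mate s} : Finset S).card = 3 := by
        rw [Finset.card_insert_of_notMem (by simp [hts, htm]),
          Finset.card_pair (G.mate_ne s).symm]
      rw [← h3]
      refine Finset.card_le_card ?_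
      intro u hu
      simp only [Finset.mem_insert, Finset.mem_singleton] at hu
      rcases hu with rfl | rfl | rfl <;> simp [hs, hs', ht, ht', G.mate_mate]
    have h3 : (cnt fun s => G.vert s ∈ ({x} : Set V) ∧ G.vert (G.mate s) ∉ ({x} : Set V))
        = cnt fun s => G.vert s = x ∧ ¬ G.vert (G.mate s) = x := rfl
    have h4 : (cnt fun s => G.vert s = x) = 6 := h6
    omega
  · push Not at hloop
    obtain ⟨l, hl, -⟩ := key true
    exact ⟨l, hl, fun s hs hs' => (hloop s hs hs').elim⟩

open Classical in
/-- Replace every vertex other than `v` by a triangle with positive edges. -/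
noncomputable def gadget (G : StubGraph S V) (v : V) (l : S → Fin 3) :
    StubGraph (S ⊕ {x // x ≠ v} × Fin 3 × Bool) (Option ({x // x ≠ v} × Fin 3)) where
  vert := Sum.elim (fun s => if h : G.vert s = v then none else some (⟨G.vert s, h⟩, l s))
    fun t => some (t.1, corner t.2)
  mate := Sum.map G.mate fun t => (t.1, t.2.1, !t.2.2)
  sgn := Sum.elim G.sgn fun _ => false
  mate_mate := by
    rintro (s | ⟨x, i, b⟩)
    · simp [G.mate_mate]
    · simp
  mate_ne := by
    rintro (s | ⟨x, i, b⟩)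
    · simp [G.mate_ne]
    · simp
  sgn_mate := by
    rintro (s | ⟨x, i, b⟩)
    · simp [G.sgn_mate]
    · simp

omit [Fintype S] in
theorem gadget_vert_inl_of_ne {s : S} (h : G.vert s ≠ v) :
    (G.gadget v l).vert (Sum.inl s) = some (⟨G.vert s, h⟩, l s) := by
  simp [gadget, h]

omit [Fintype S] in
theorem gadget_vert_inl_of_eq {s : S} (h : G.vert s = v) :
    (G.gadget v l).vert (Sum.inl s) = none := by
  simp [gadget, h]

omit [Fintype S] in
theorem gadget_vert_inl_eq_some {s : S} {x : {x // x ≠ v}} {i : Fin 3} :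
    (G.gadget v l).vert (Sum.inl s) = some (x, i) ↔ G.vert s = x.1 ∧ l s = i := by
  by_cases h : G.vert s = v
  · rw [gadget_vert_inl_of_eq h]
    simp only [reduceCtorEq, false_iff]
    rintro ⟨h', -⟩
    exact x.2 (h'.symm.trans h)
  · rw [gadget_vert_inl_of_ne h]
    simp [Subtype.ext_iff]

open Classical in
/-- A triangle belongs to the rounding of `X` if at least two of its corners belong to `X`. -/
noncomputable def round (X : Set (Option ({x // x ≠ v} × Fin 3) × Bool)) : Set (V × Bool) :=
  {z | if h : z.1 = v then (none, z.2) ∈ X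
    else maj (fun i => decide ((some (⟨z.1, h⟩, i), z.2) ∈ X)) = true}

theorem mem_round_root {X : Set (Option ({x // x ≠ v} × Fin 3) × Bool)} {b : Bool} :
    (v, b) ∈ round X ↔ (none, b) ∈ X := by
  simp [round]

open Classical in
theorem mem_round {X : Set (Option ({x // x ≠ v} × Fin 3) × Bool)} {x : V} (hx : x ≠ v)
    {b : Bool} :
    (x, b) ∈ round X ↔ maj (fun i => decide ((some (⟨x, hx⟩, i), b) ∈ X)) = true := by
  simp [round, hx]

variable [Fintype V] [Fintype {x // x ≠ v}]

/-- Rounding does not increase the number of edges leaving a set. -/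
theorem d_round_le (hl : ∀ x, x ≠ v → G.IsLabelling l x)
    (X : Set (Option ({x // x ≠ v} × Fin 3) × Bool)) :
    G.d (round X) ≤ (G.gadget v l).d X := by
  classical
  set a : S × Bool → Prop := fun p => (G.gadget v l).near (Sum.inl p.1, p.2) ∈ X with ha
  set r : S × Bool → Prop := fun p => G.near p ∈ round X with hr
  let q : Bool → {x // x ≠ v} × Fin 3 × Bool → Prop := fun b t =>
    (some (t.1, corner t.2), b) ∈ X ∧ ¬ (some (t.1, corner (t.2.1, !t.2.2)), b) ∈ X
  have hd : (G.gadget v l).d X = (cnt fun p => a p ∧ ¬ a (G.coverMate p))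
      + (cnt (q false) + cnt (q true)) := by
    have h : (G.gadget v l).d X = cnt fun p => (G.gadget v l).near p ∈ X ∧
      ¬ (G.gadget v l).far p ∈ X := rfl
    have e1 : ∀ b, (cnt fun s => (G.gadget v l).near (s, b) ∈ X ∧ ¬ (G.gadget v l).far (s, b) ∈ X)
        = (cnt fun s : S => a (s, b) ∧ ¬ a (G.coverMate (s, b))) + cnt (q b) := by
      intro b
      rw [cnt_sum]
      congr 1
      refine cnt_congr fun t => ?_
      simp [near, far, gadget, q]
    rw [h, cnt_prod_bool, e1, e1, cnt_prod_bool fun p => a p ∧ ¬ a (G.coverMate p)]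
    ring
  have hround : G.d (round X) = cnt fun p => r p ∧ ¬ r (G.coverMate p) := rfl
  -- An edge cut by the rounded set is cut by `X` or has an end whose membership was changed by the
  -- rounding.
  have h1 : (cnt fun p => r p ∧ ¬ r (G.coverMate p)) ≤ (cnt fun p => a p ∧ ¬ a (G.coverMate p))
      + ((cnt fun p => r p ∧ ¬ a p) + cnt fun p => ¬ r (G.coverMate p) ∧ a (G.coverMate p)) :=
    (cnt_mono fun p hp => by tauto).trans
      ((cnt_or_le _ _).trans (Nat.add_le_add_left (cnt_or_le _ _) _))
  rw [cnt_comp_involutive G.coverMate_coverMate fun p => ¬ r p ∧ a p] at h1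
  have h2 : (cnt fun p => r p ∧ ¬ a p) + (cnt fun p => ¬ r p ∧ a p) = cnt fun p => ¬ (r p ↔ a p) := by
    rw [← cnt_add_cnt_not (fun p => ¬ (r p ↔ a p)) r]
    congr 1 <;> exact cnt_congr fun p => by tauto
  -- The changed half-edges are charged, triangle by triangle, to the triangle edges cut by `X`.
  have h3 : ∀ b, (cnt fun s => ¬ (r (s, b) ↔ a (s, b))) ≤ cnt (q b) := by
    intro b
    rw [cnt_fiber G.vert, cnt_fiber (fun t => t.1.1) (q b)]
    refine Finset.sum_le_sum fun x _ => ?_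
    by_cases hx : x = v
    · subst hx
      rw [cnt_eq_zero.2]
      · exact Nat.zero_le _
      · rintro s ⟨hs, h⟩
        apply h
        simp only [hr, ha, near]
        rw [gadget_vert_inl_of_eq hs, hs, mem_round_root]
    · set m : Fin 3 → Bool := fun i => decide ((some (⟨x, hx⟩, i), b) ∈ X) with hm
      have h4 := two_mul_minority_le m
      rw [← cnt_eq_card] at h4
      have h5 : (cnt fun s => G.vert s = x ∧ ¬ (r (s, b) ↔ a (s, b)))
          ≤ ∑ i, if m i ≠ maj m then 2 else 0 := by
        rw [cnt_fiber l]
        refine Finset.sum_le_sum fun i _ => ?_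
        have h6 : ∀ s, G.vert s = x → l s = i → (r (s, b) ↔ maj m = true) ∧
            (a (s, b) ↔ m i = true) := by
          rintro s rfl rfl
          simp only [hr, ha, near]
          rw [gadget_vert_inl_of_ne hx, mem_round hx]
          exact ⟨Iff.rfl, by simp [hm]⟩
        by_cases hi : m i = maj m
        · rw [cnt_eq_zero.2]
          · exact Nat.zero_le _
          · rintro s ⟨hs, hs', h⟩
            obtain ⟨h7, h8⟩ := h6 s hs' hs
            rw [h7, h8, hi] at h
            exact h Iff.rfl
        · rw [if_pos hi, ← (hl x hx).two i]
          exact cnt_mono fun s hs => ⟨hs.2.1, hs.1⟩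
      refine h5.trans (h4.trans ?_)
      refine le_trans ?_ (cnt_le_of_injective (j := fun k : Fin 3 × Bool =>
        ((⟨x, hx⟩, k) : {x // x ≠ v} × Fin 3 × Bool)) (fun k k' h => (Prod.ext_iff.1 h).2) _)
      refine cnt_mono fun k hk => ⟨rfl, ?_⟩
      simpa [hm, q] using hk
  have h4 := h3 false
  have h5 := h3 true
  rw [cnt_prod_bool fun p => ¬ (r p ↔ a p)] at h2
  omega

omit [Fintype V] in
theorem gadget_deg_root : (G.gadget v l).deg none = G.deg v := by
  have h0 : (cnt fun t => (G.gadget v l).vert (Sum.inr t) = none) = 0 :=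
    cnt_eq_zero.2 fun t h => by simp [gadget] at h
  rw [deg, cnt_sum, h0, add_zero]
  refine cnt_congr fun s => ?_
  by_cases h : G.vert s = v
  · simp [gadget_vert_inl_of_eq h, h]
  · simp [gadget_vert_inl_of_ne h, h]

omit [Fintype V] in
theorem gadget_deg_ne {x : {x // x ≠ v}} (hl : G.IsLabelling l x.1) (i : Fin 3) :
    (G.gadget v l).deg (some (x, i)) = 4 := by
  classical
  rw [deg, cnt_sum, cnt_congr fun s => gadget_vert_inl_eq_some, hl.two]
  have h : (cnt fun t : {x // x ≠ v} × Fin 3 × Bool => (G.gadget v l).vert (Sum.inr t)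
      = some (x, i)) = cnt fun t : {x // x ≠ v} × Fin 3 × Bool => t.1 = x ∧ corner t.2 = i :=
    cnt_congr fun t => by simp [gadget]
  rw [h, cnt_prod_eq x fun k => corner k = i, cnt_eq_card, card_corner]

omit [Fintype V] in
/-- A set of corners, at most one in each triangle, is left by at least four edges. -/
theorem four_le_cut_gadget (hl : ∀ x, x ≠ v → G.IsLabelling l x)
    {W : Set (Option ({x // x ≠ v} × Fin 3))} (hv : none ∉ W) (hW : W.Nonempty)
    (hone : ∀ x i j, some (x, i) ∈ W → j ≠ i → some (x, j) ∉ W) :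
    4 ≤ cnt fun s => (G.gadget v l).vert s ∈ W ∧ (G.gadget v l).vert ((G.gadget v l).mate s) ∉ W := by
  classical
  have two : ∀ x i, some (x, i) ∈ W → 2 ≤ cnt fun s => ((G.gadget v l).vert s ∈ W ∧
      (G.gadget v l).vert ((G.gadget v l).mate s) ∉ W) ∧ (G.gadget v l).vert s = some (x, i) := by
    intro x i hi
    have h1 : (cnt fun _ : Bool => True) = 2 := by rw [cnt_true]; rfl
    have hj : Function.Injective fun b : Bool =>
        (Sum.inr (x, if b then i + 2 else i, b) : S ⊕ {x // x ≠ v} × Fin 3 × Bool) := by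
      intro b b' h
      simp only [Sum.inr.injEq, Prod.mk.injEq] at h
      exact h.2.2
    rw [← h1]
    refine le_trans (cnt_mono ?_) (cnt_le_of_injective hj _)
    have c1 : ∀ i : Fin 3, corner (i, false) = i ∧ corner (i + 2, true) = i ∧
        corner (i, true) ≠ i ∧ corner (i + 2, false) ≠ i := by decide
    obtain ⟨c1, c2, c3, c4⟩ := c1 i
    rintro (_ | _) -
    · have h2 : (G.gadget v l).vert (Sum.inr (x, i, false)) = some (x, i) := by
        simp [gadget, c1]
      refine ⟨⟨?_, ?_⟩, h2⟩
      · exact h2 ▸ hi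
      · have := hone x i _ hi c3
        simpa [gadget] using this
    · have h2 : (G.gadget v l).vert (Sum.inr (x, i + 2, true)) = some (x, i) := by
        simp [gadget, c2]
      refine ⟨⟨?_, ?_⟩, h2⟩
      · exact h2 ▸ hi
      · have := hone x i _ hi c4
        simpa [gadget] using this
  obtain ⟨w, hw⟩ := hW
  obtain _ | ⟨x, i⟩ := w
  · exact absurd hw hv
  by_cases hw' : ∃ w ∈ W, w ≠ some (x, i)
  · obtain ⟨_ | ⟨y, k⟩, hy, hne⟩ := hw'
    · exact absurd hy hv
    have t1 := two x i hw
    have t2 := two y k hy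
    rw [← cnt_add_cnt_not _ fun s => (G.gadget v l).vert s = some (x, i)]
    have t3 : (cnt fun s => ((G.gadget v l).vert s ∈ W ∧
        (G.gadget v l).vert ((G.gadget v l).mate s) ∉ W) ∧ (G.gadget v l).vert s = some (y, k))
        ≤ cnt fun s => ((G.gadget v l).vert s ∈ W ∧
        (G.gadget v l).vert ((G.gadget v l).mate s) ∉ W) ∧ ¬ (G.gadget v l).vert s = some (x, i) :=
      cnt_mono fun s hs => ⟨hs.1, by rw [hs.2]; exact hne⟩
    omega
  · push Not at hw'
    have hWx : ∀ w, w ∈ W ↔ w = some (x, i) := fun w => ⟨hw' w, fun h => h ▸ hw⟩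
    rw [← gadget_deg_ne (hl x.1 x.2) i, deg]
    refine cnt_mono fun s hs => ?_
    rw [hWx, hWx]
    refine ⟨hs, fun hs' => ?_⟩
    rcases s with s | ⟨y, k, b⟩
    · have h1 := gadget_vert_inl_eq_some.1 hs
      have h2 := gadget_vert_inl_eq_some.1 hs'
      exact (hl x.1 x.2).ne s h1.1 h2.1 (h1.2.trans h2.2.symm)
    · have c1 : ∀ k b, corner (k, b) ≠ corner (k, !b) := by decide
      simp only [gadget, Sum.map_inr, Sum.elim_inr, Option.some.injEq, Prod.mk.injEq] at hs hs'
      exact c1 k b (hs.2.trans hs'.2.symm)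

/-- Rounding carries the cut conditions over from the core. A set of corners that rounds to the
empty set has at most one corner in each triangle, and its cut is bounded directly. Triangle edges
are positive and do not affect the parity. -/
theorem IsCore.isRooted_gadget (h : G.IsCore)
    (hv : ∀ X : Set (V × Bool), (v, false) ∈ X → (v, true) ∉ X → 6 ≤ G.d X)
    (hl : ∀ x, x ≠ v → G.IsLabelling l x) : (G.gadget v l).IsRooted none := by
  classical
  have hroot : (G.gadget v l).deg none = 6 := by rw [gadget_deg_root, h.deg]
  have hne : ∀ w, w ≠ none → (G.gadget v l).deg w = 4 := by
    rintro (_ | ⟨x, i⟩) hw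
    · exact absurd rfl hw
    · exact gadget_deg_ne (hl x.1 x.2) i
  refine ⟨hroot, hne, ?_, ?_, ?_⟩
  · intro X hX hX'
    refine (hv (round X) (mem_round_root.2 hX) fun h => hX' (mem_round_root.1 h)).trans
      (d_round_le hl X)
  · intro W hW hvW
    by_cases hW' : ∃ x, (x, false) ∈ round (lifts W)
    · refine le_trans ?_ (d_round_le hl (lifts W))
      have h1 : round (lifts W) = lifts {x | (x, false) ∈ round (lifts W)} := by
        ext ⟨x, b⟩
        by_cases hx : x = v
        · subst hx
          simp [lifts, mem_round_root]
        · simp only [lifts, Set.mem_ofPred_eq, mem_round hx]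
      rw [h1]
      refine h.cut _ hW' fun h2 => ?_
      have h3 : v ∈ {x | (x, false) ∈ round (lifts W)} := h2 ▸ Set.mem_univ v
      exact hvW (mem_round_root.1 h3)
    · push Not at hW'
      rw [d_lifts]
      have := four_le_cut_gadget hl hvW hW ?_
      · omega
      · intro x i j hi hj hWj
        have h1 := hW' x.1
        rw [mem_round x.2, Bool.not_eq_true] at h1
        have h2 := eq_false_of_maj _ h1 i (by simpa [lifts] using hi) j hj
        rw [decide_eq_false_iff_not] at h2
        exact h2 hWj
  · intro c
    rw [d_section_mod_four]
    · have h0 : (cnt fun t => (G.gadget v l).sgn (Sum.inr t) = true) = 0 :=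
        cnt_eq_zero.2 fun t h => by simp [gadget] at h
      rw [cnt_sum, h0, add_zero,
        cnt_congr (q := fun _ => True) (fun s => by simp [gadget, h.sgn]), cnt_true, h.odd]
    · intro w
      by_cases hw : w = none
      · rw [hw, hroot]; decide
      · rw [hne w hw]; decide

omit [Fintype {x // x ≠ v}] in
/-- A six-regular odd graph with all edges negative and without small cuts splits into three odd
eulerian subgraphs with a common vertex. -/
theorem IsCore.good (h : G.IsCore) : G.Good := by
  classical
  obtain ⟨v, hv⟩ := h.exists_root
  have hlx : ∀ x, x ≠ v → ∃ l, G.IsLabelling l x := fun x hx =>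
    exists_isLabelling (h.deg x) (h.cut _ ⟨x, rfl⟩ fun h1 => hx
      (Set.mem_singleton_iff.1 (h1 ▸ Set.mem_univ v)).symm)
  choose! L hL using hlx
  have hl : ∀ x, x ≠ v → G.IsLabelling (fun s => L (G.vert s) s) x := by
    intro x hx
    refine ⟨fun i => ?_, fun s hs hs' => ?_⟩
    · rw [← (hL x hx).two i]
      refine cnt_congr fun s => ?_
      constructor <;> rintro ⟨rfl, h⟩ <;> exact ⟨rfl, h⟩
    · rw [hs, hs']
      exact (hL x hx).ne s hs hs'
  -- Contracting the positive triangles restores the core.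
  refine ((h.isRooted_gadget hv hl).good _ rfl).contract Sum.inl
    (fun w => w.elim v fun t => t.1.1) Sum.inl_injective (fun s => rfl) (fun s => rfl) ?_ ?_
  · intro s
    by_cases hs : G.vert s = v
    · rw [gadget_vert_inl_of_eq hs, hs]
      rfl
    · rw [gadget_vert_inl_of_ne hs]
      rfl
  · rintro (s | t) ht
    · exact (ht s rfl).elim
    · exact ⟨rfl, rfl⟩

end StubGraph

theorem cnt_lt_of_injective {S T : Type*} [Fintype S] [Fintype T] {j : S → T}
    (hj : Function.Injective j) {p : S → Prop} {q : T → Prop} (hpq : ∀ s, p s → q (j s)) {t : T}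
    (ht : q t) (hpt : ∀ s, p s → j s ≠ t) : cnt p < cnt q := by
  classical
  rw [cnt_eq_card, cnt_eq_card, ← Finset.card_map ⟨j, hj⟩]
  refine Finset.card_lt_card (Finset.ssubset_iff_of_subset ?_ |>.2 ⟨t, by simpa using ht, ?_⟩)
  · intro u
    simp only [Finset.mem_map, Finset.mem_filter, Finset.mem_univ, true_and]
    rintro ⟨s, hs, rfl⟩
    exact hpq s hs
  · simp only [Finset.mem_map, Finset.mem_filter, Finset.mem_univ, true_and]
    rintro ⟨s, hs, h⟩
    exact hpt s hs h

theorem cnt_eq_one {S : Type*} [Fintype S] (a : S) : (cnt fun s => s = a) = 1 := by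
  classical
  rw [cnt_eq_card, ← Finset.card_singleton a]
  congr 1
  ext s
  simp

theorem cnt_eq_or_eq {S : Type*} [Fintype S] {a b : S} (h : a ≠ b) :
    (cnt fun s => s = a ∨ s = b) = 2 := by
  classical
  rw [cnt_eq_card, ← Finset.card_pair h]
  congr 1
  ext s
  simp

theorem cnt_two_elems {S : Type*} [Fintype S] {p : S → Prop} (h : cnt p = 2) :
    ∃ a b, a ≠ b ∧ ∀ s, p s ↔ s = a ∨ s = b := by
  classical
  rw [cnt_eq_card, Finset.card_eq_two] at h
  obtain ⟨a, b, hab, h⟩ := h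
  refine ⟨a, b, hab, fun s => ?_⟩
  have h1 := Finset.ext_iff.1 h s
  simpa using h1

theorem exists_cnt_eq {S : Type*} [Fintype S] {p : S → Prop} {k : ℕ} (h : k ≤ cnt p) :
    ∃ A : S → Prop, (∀ s, A s → p s) ∧ cnt A = k := by
  classical
  rw [cnt_eq_card] at h
  obtain ⟨A, hA, hk⟩ := Finset.exists_subset_card_eq h
  refine ⟨fun s => s ∈ A, fun s hs => by simpa using hA hs, ?_⟩
  rw [cnt_eq_card, ← hk]
  congr 1
  ext s
  simp

/-- The sum of values in `{±1, ±2}`. -/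
theorem wsum_eq_cnt {S : Type*} [Fintype S] {p : S → Prop} {f : S → ℤ}
    (hf : ∀ s, p s → f s = 1 ∨ f s = -1 ∨ f s = 2 ∨ f s = -2) :
    wsum p f = (cnt fun s => p s ∧ f s = 1) - (cnt fun s => p s ∧ f s = -1)
      + 2 * (cnt fun s => p s ∧ f s = 2) - 2 * (cnt fun s => p s ∧ f s = -2) := by
  classical
  simp only [wsum, cnt]
  push_cast
  rw [Finset.mul_sum, Finset.mul_sum, ← Finset.sum_sub_distrib, ← Finset.sum_add_distrib,
    ← Finset.sum_sub_distrib]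
  refine Finset.sum_congr rfl fun s _ => ?_
  by_cases hp : p s
  · rcases hf s hp with h | h | h | h <;> simp [hp, h]
  · simp [hp]

theorem cnt_eq_cnt_add {S : Type*} [Fintype S] {p : S → Prop} {f : S → ℤ}
    (hf : ∀ s, p s → f s = 1 ∨ f s = -1 ∨ f s = 2 ∨ f s = -2) :
    cnt p = (cnt fun s => p s ∧ f s = 1) + (cnt fun s => p s ∧ f s = -1)
      + (cnt fun s => p s ∧ f s = 2) + (cnt fun s => p s ∧ f s = -2) := by
  classical
  simp only [cnt, ← Finset.sum_add_distrib]
  refine Finset.sum_congr rfl fun s _ => ?_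
  by_cases hp : p s
  · rcases hf s hp with h | h | h | h <;> simp [hp, h]
  · simp [hp]

theorem cnt_abs_two {S : Type*} [Fintype S] (p : S → Prop) (f : S → ℤ) :
    (cnt fun s => p s ∧ |f s| = 2) = (cnt fun s => p s ∧ f s = 2) + cnt fun s => p s ∧ f s = -2 := by
  classical
  simp only [cnt, ← Finset.sum_add_distrib]
  refine Finset.sum_congr rfl fun s _ => ?_
  by_cases hp : p s
  · by_cases h : f s = 2
    · simp [hp, h]
    · by_cases h' : f s = -2
      · simp [hp, h']
      · have : |f s| ≠ 2 := by
          intro h2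
          rcases abs_eq (by norm_num : (0 : ℤ) ≤ 2) |>.1 h2 with h3 | h3
          exacts [h h3, h' h3]
        simp [hp, h, h', this]
  · simp [hp]

/-! ### Three-flows: reduction to a core -/

namespace StubGraph

universe u v

variable {S : Type u} {V : Type v} {V' : Type*} {G : StubGraph S V} [Fintype S] {f : S → ℤ}

/-- A balanced assignment of values `±1`, `±2` to the stubs, compatible with the signature, with
an even number of values `±2` at each vertex. -/
structure IsThreeFlow (G : StubGraph S V) (f : S → ℤ) : Prop where
  mate : ∀ s, f (G.mate s) = if G.sgn s then f s else - f s
  bal : ∀ x, wsum (fun s => G.vert s = x) f = 0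
  val : ∀ s, f s = 1 ∨ f s = -1 ∨ f s = 2 ∨ f s = -2
  two : ∀ x, Even (cnt fun s => G.vert s = x ∧ |f s| = 2)

/-- The number of pairs of stubs with a common vertex. -/
noncomputable def pairs (G : StubGraph S V) : ℕ := cnt fun t : S × S => G.vert t.1 = G.vert t.2

/-- Modulo 2 the sum counts the values ±1, so their number is even, and the number of values ±2 is
even by hypothesis. -/
theorem even_cnt_of_bal {p : S → Prop} (hf : ∀ s, p s → f s = 1 ∨ f s = -1 ∨ f s = 2 ∨ f s = -2)
    (hbal : wsum p f = 0) (htwo : Even (cnt fun s => p s ∧ |f s| = 2)) : Even (cnt p) := by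
  rw [wsum_eq_cnt hf] at hbal
  rw [cnt_abs_two] at htwo
  rw [cnt_eq_cnt_add hf]
  rw [Nat.even_iff] at htwo ⊢
  omega

theorem IsThreeFlow.even_deg (hf : G.IsThreeFlow f) (x : V) : Even (G.deg x) :=
  even_cnt_of_bal (fun s _ => hf.val s) (hf.bal x) (hf.two x)

theorem IsThreeFlow.restrict (hf : G.IsThreeFlow f) {P : S → Prop} [Fintype {s // P s}]
    {H : StubGraph {s // P s} V'} {φ : V' → V} (hvert : ∀ s y, H.vert s = y ↔ G.vert s.1 = φ y)
    (hmate : ∀ s, f (H.mate s).1 = if H.sgn s then f s.1 else - f s.1)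
    (hbal : ∀ y, wsum (fun s => G.vert s = φ y ∧ P s) f = 0)
    (htwo : ∀ y, Even (cnt fun s => (G.vert s = φ y ∧ P s) ∧ |f s| = 2)) :
    H.IsThreeFlow fun s => f s.1 := by
  refine ⟨hmate, fun y => ?_, fun s => hf.val s.1, fun y => ?_⟩
  · rw [← hbal y, ← wsum_congr (p := fun s => P s ∧ G.vert s = φ y) (fun s => and_comm)
      (fun s _ => rfl), ← wsum_subtype]
    exact wsum_congr (fun s => hvert s y) fun s _ => rfl
  · rw [cnt_congr (q := fun s : {s // P s} => G.vert s.1 = φ y ∧ |f s.1| = 2)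
      (fun s => by rw [hvert]), cnt_subtype P fun s => G.vert s = φ y ∧ |f s| = 2]
    have := htwo y
    rwa [cnt_congr (q := fun s => P s ∧ G.vert s = φ y ∧ |f s| = 2) fun s => by tauto] at this

theorem pairs_lt {P : S → Prop} [Fintype {s // P s}] {H : StubGraph {s // P s} V'}
    (hvert : ∀ s t, H.vert s = H.vert t → G.vert s.1 = G.vert t.1) {u : S} (hu : ¬ P u) :
    H.pairs < G.pairs :=
  cnt_lt_of_injective (j := Prod.map Subtype.val Subtype.val)
    (Subtype.val_injective.prodMap Subtype.val_injective) (t := (u, u)) (fun s hs => hvert _ _ hs)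
    rfl fun s _ hs => hu (by
      have h : s.1.1 = u := congrArg Prod.fst hs
      rw [← h]
      exact s.1.2)

theorem pairs_split_lt {A : S → Prop} {s t : S} (hst : G.vert s = G.vert t) (hs : A s)
    (ht : ¬ A t) : (G.split A).pairs < G.pairs := by
  refine cnt_lt_of_injective (j := id) Function.injective_id (t := (s, t)) (fun u hu => ?_) hst ?_
  · exact (split_vert_eq.1 hu).1
  · rintro _ hu rfl
    exact ht ((split_vert_eq.1 hu).2.1 hs)

theorem even_cnt_sgn {P : S → Prop} (hm : ∀ s, P s → P (G.mate s)) :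
    Even (cnt fun s => G.sgn s = true ∧ P s) :=
  even_cnt_of_involution G.mate (fun s hs => ⟨by rw [G.sgn_mate, hs.1], hm s hs.2⟩)
    (fun s _ => G.mate_mate s) (fun s _ => G.mate_ne s)

/-- The induction hypothesis: odd connected graphs with few pairs of stubs at a common vertex and
with a suitable flow are good. -/
def GoodBelow (n : ℕ) : Prop :=
  ∀ (S : Type u) (V : Type v) [Fintype S] [Fintype V] (G : StubGraph S V) (f : S → ℤ),
    G.pairs < n → G.IsThreeFlow f → G.Conn → (cnt fun s => G.sgn s = true) % 4 = 2 → G.Good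

/-- A cut vertex whose sides carry flows. -/
theorem good_of_cutVertex [Fintype V] (ih : GoodBelow.{u, v} G.pairs) (hf : G.IsThreeFlow f)
    (hG : G.Conn) (hodd : (cnt fun s => G.sgn s = true) % 4 = 2) {P : S → Prop} {x : V}
    (hm : ∀ s, P (G.mate s) ↔ P s)
    (hv : ∀ s t, G.vert s = G.vert t → G.vert s ≠ x → (P s ↔ P t))
    (hbal : ∀ y, wsum (fun s => G.vert s = y ∧ P s) f = 0)
    (htwo : ∀ y, Even (cnt fun s => (G.vert s = y ∧ P s) ∧ |f s| = 2))
    {s t : S} (hs : G.vert s = x) (hPs : P s) (ht : G.vert t = x) (hPt : ¬ P t)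
    (hP : (cnt fun s => G.sgn s = true ∧ P s) % 4 = 2) : G.Good := by
  classical
  have hm1 : ∀ s, P s → P (G.mate s) := fun s hs => (hm s).2 hs
  have hm2 : ∀ s, ¬ P s → ¬ P (G.mate s) := fun s hs h => hs ((hm s).1 h)
  have h1 := cnt_add_cnt_not (fun s => G.sgn s = true) P
  have flow := hf.restrict (H := G.sub P hm1) (φ := id) (fun s y => Iff.rfl)
    (fun s => hf.mate s.1) hbal htwo
  have conn : (G.sub P hm1).Conn := (hG.connOn_of_cutVertex hm1
    fun s t hst hsx hPs => (hv s t hst hsx).1 hPs).conn (fun s => rfl) (fun s _ => rfl)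
  have good : (G.sub P hm1).Good := by
    refine ih _ _ _ _ (pairs_lt (fun s t h => h) hPt) flow conn ?_
    rw [← hP, ← cnt_congr (p := fun s => P s ∧ G.sgn s = true) (fun s => and_comm), ← cnt_subtype]
    rfl
  refine good.attach (fun s => rfl) (fun s => rfl) (fun s _ => rfl) ?_ ?_ (by omega) ⟨s, hPs⟩
    (fun s h => (hm2 _ h (by rw [G.mate_mate]; exact s.2)).elim) t hPt (Or.inl (ht.trans hs.symm))
  · exact hG.connOn_of_cutVertex hm2 fun s t hst hsx hPs h => hPs ((hv s t hst hsx).2 h)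
  · intro y
    have h2 := even_cnt_of_bal (fun s _ => hf.val s) (hbal y) (htwo y)
    have h3 := cnt_add_cnt_not (fun s => G.vert s = y) P
    have h4 : Even (cnt fun s => G.vert s = y) := hf.even_deg y
    rw [← h3] at h4
    exact (Nat.even_add.1 h4).1 h2

/-- The flow survives splitting off the balanced set `A`. If the split graph is connected, induction
applies to it. Otherwise `x` is a cut vertex whose sides both carry flows, and exactly one side has
an odd number of negative edges; that side is treated by induction and absorbs the other. -/
theorem good_of_zeroSum [Fintype V] (ih : GoodBelow.{u, v} G.pairs) (hf : G.IsThreeFlow f) (hG : G.Conn)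
    (hodd : (cnt fun s => G.sgn s = true) % 4 = 2) {x : V} {A : S → Prop}
    (hA : ∀ s, A s → G.vert s = x) {s t : S} (hs : A s) (ht : G.vert t = x) (htA : ¬ A t)
    (hbal : wsum A f = 0) (htwo : Even (cnt fun s => A s ∧ |f s| = 2)) : G.Good := by
  classical
  have bal : ∀ y, wsum (fun s => G.vert s = y ∧ A s) f = 0 := by
    intro y
    by_cases hy : y = x
    · rw [← hbal]
      exact wsum_congr (fun s => ⟨fun h => h.2, fun h => ⟨hy ▸ hA s h, h⟩⟩) fun s _ => rfl
    · exact wsum_eq_zero fun s h => hy (h.1.symm.trans (hA s h.2))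
  have two : ∀ y, Even (cnt fun s => (G.vert s = y ∧ A s) ∧ |f s| = 2) := by
    intro y
    by_cases hy : y = x
    · rw [cnt_congr (q := fun s => A s ∧ |f s| = 2)]
      · exact htwo
      · exact fun s => ⟨fun h => ⟨h.1.2, h.2⟩, fun h => ⟨⟨hy ▸ hA s h.1, h.1⟩, h.2⟩⟩
    · rw [cnt_eq_zero.2 fun s h => hy (h.1.1.symm.trans (hA s h.1.2))]
      exact Even.zero
  have co_bal : ∀ (P : S → Prop), (∀ y, wsum (fun s => G.vert s = y ∧ P s) f = 0) →
      ∀ y, wsum (fun s => G.vert s = y ∧ ¬ P s) f = 0 := by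
    intro P hP y
    have h1 := wsum_add_wsum_not (fun s => G.vert s = y) P f
    rw [hP, hf.bal, zero_add] at h1
    exact h1
  have co_two : ∀ (P : S → Prop), (∀ y, Even (cnt fun s => (G.vert s = y ∧ P s) ∧ |f s| = 2)) →
      ∀ y, Even (cnt fun s => (G.vert s = y ∧ ¬ P s) ∧ |f s| = 2) := by
    intro P hP y
    have h1 := cnt_add_cnt_not (fun s => G.vert s = y ∧ |f s| = 2) P
    rw [cnt_congr (p := fun s => (G.vert s = y ∧ |f s| = 2) ∧ P s)
      (q := fun s => (G.vert s = y ∧ P s) ∧ |f s| = 2) (fun s => by tauto),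
      cnt_congr (p := fun s => (G.vert s = y ∧ |f s| = 2) ∧ ¬ P s)
      (q := fun s => (G.vert s = y ∧ ¬ P s) ∧ |f s| = 2) (fun s => by tauto)] at h1
    have h2 := hf.two y
    rw [← h1] at h2
    exact (Nat.even_add.1 h2).1 (hP y)
  by_cases hconn : (G.split A).Conn
  · refine good_of_split (A := A) (ih _ _ _ f (pairs_split_lt ((hA s hs).trans ht.symm) hs htA)
      ⟨hf.mate, ?_, hf.val, ?_⟩ hconn hodd)
    · rintro ⟨y, b⟩
      cases b
      · rw [← co_bal A bal y]
        exact wsum_congr (fun s => by simp [split]) fun s _ => rfl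
      · rw [← bal y]
        exact wsum_congr (fun s => by simp [split]) fun s _ => rfl
    · rintro ⟨y, b⟩
      cases b
      · convert co_two A two y using 3 with s
        simp [split]
      · convert two y using 3 with s
        simp [split]
  · obtain ⟨P, hm, hv, hx⟩ := hG.exists_cut_of_not_conn_split hA hconn
    have hPs : P s := (hx s (hA s hs)).2 hs
    have hPt : ¬ P t := fun h => htA ((hx t ht).1 h)
    have off : ∀ y, y ≠ x → (∀ s, G.vert s = y → P s) ∨ ∀ s, G.vert s = y → ¬ P s := by
      intro y hy
      by_cases h : ∃ s, G.vert s = y ∧ P s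
      · obtain ⟨u, hu, hPu⟩ := h
        exact Or.inl fun w hw => (hv u w (hu.trans hw.symm) (hu ▸ hy)).1 hPu
      · push Not at h
        exact Or.inr h
    have balP : ∀ y, wsum (fun s => G.vert s = y ∧ P s) f = 0 := by
      intro y
      by_cases hy : y = x
      · rw [← bal y]
        exact wsum_congr (fun s => and_congr_right fun h => hx s (h.trans hy)) fun s _ => rfl
      · rcases off y hy with h | h
        · rw [← hf.bal y]
          exact wsum_congr (fun s => and_iff_left_of_imp (h s)) fun s _ => rfl
        · exact wsum_eq_zero fun s hs => h s hs.1 hs.2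
    have twoP : ∀ y, Even (cnt fun s => (G.vert s = y ∧ P s) ∧ |f s| = 2) := by
      intro y
      by_cases hy : y = x
      · rw [cnt_congr (q := fun s => (G.vert s = y ∧ A s) ∧ |f s| = 2) (fun s =>
          and_congr_left fun _ => and_congr_right fun h => hx s (h.trans hy))]
        exact two y
      · rcases off y hy with h | h
        · rw [cnt_congr (q := fun s => G.vert s = y ∧ |f s| = 2) (fun s =>
            and_congr_left fun _ => and_iff_left_of_imp (h s))]
          exact hf.two y
        · rw [cnt_eq_zero.2 fun s hs => h s hs.1.1 hs.1.2]
          exact Even.zero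
    have h1 := cnt_add_cnt_not (fun s => G.sgn s = true) P
    have h2 := G.even_cnt_sgn (P := P) fun s hs => (hm s).2 hs
    obtain ⟨k, hk⟩ := h2
    by_cases hodd' : (cnt fun s => G.sgn s = true ∧ P s) % 4 = 2
    · exact good_of_cutVertex ih hf hG hodd hm hv balP twoP (hA s hs) hPs ht hPt hodd'
    · exact good_of_cutVertex ih hf hG hodd (P := fun s => ¬ P s) (fun s => not_congr (hm s))
        (fun s t h h' => not_congr (hv s t h h')) (co_bal P balP) (co_two P twoP) ht hPt (hA s hs)
        (not_not.2 hPs) (by omega)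

/-- A vertex without a proper balanced part has valency two, or carries two stubs of value `2c` and
four stubs of value `-c`, for some sign `c`. -/
theorem IsThreeFlow.vertex_cases (hf : G.IsThreeFlow f) {x : V}
    (hirr : ∀ A : S → Prop, (∀ s, A s → G.vert s = x) → (∃ s, A s) → wsum A f = 0 →
      Even (cnt fun s => A s ∧ |f s| = 2) → ∀ s, G.vert s = x → A s)
    (hx : ∃ s, G.vert s = x) :
    (∃ s t, G.vert s = x ∧ G.vert t = x ∧ f t = - f s ∧ ∀ u, G.vert u = x → u = s ∨ u = t) ∨
      ((cnt fun s => G.vert s = x ∧ |f s| = 2) = 2 ∧ G.deg x = 6 ∧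
        ∃ c : Bool, ∀ s, G.vert s = x → (decide (f s = 1 ∨ f s = -2)) = c) := by
  classical
  -- Two opposite values form a balanced set, which must then be everything at `x`. Without opposite
  -- values each absolute value occurs with one sign only.
  by_cases hopp : ∃ s t, G.vert s = x ∧ G.vert t = x ∧ f t = - f s
  · left
    obtain ⟨s, t, hs, ht, hst⟩ := hopp
    have hne : s ≠ t := by
      rintro rfl
      have := hf.val s
      omega
    refine ⟨s, t, hs, ht, hst, hirr _ ?_ ⟨s, Or.inl rfl⟩ ?_ ?_⟩
    · rintro u (rfl | rfl)
      exacts [hs, ht]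
    · have h1 : wsum (fun u => u = s ∨ u = t) f = f s + f t := by
        rw [wsum_eq_sum, ← Finset.sum_pair hne]
        congr 1
        ext u
        simp
      rw [h1, hst]
      ring
    · by_cases h2 : |f s| = 2
      · rw [cnt_congr (q := fun u => u = s ∨ u = t), cnt_eq_or_eq hne]
        · exact even_two
        · refine fun u => and_iff_left_of_imp ?_
          rintro (rfl | rfl)
          · exact h2
          · rw [hst, abs_neg, h2]
      · rw [cnt_eq_zero.2]
        · exact Even.zero
        · rintro u ⟨rfl | rfl, h⟩
          · exact h2 h
          · rw [hst, abs_neg] at h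
            exact h2 h
  · right
    push Not at hopp
    have hbal := hf.bal x
    have htwo := hf.two x
    have hdeg : G.deg x = _ := cnt_eq_cnt_add (fun s _ => hf.val s)
    have hpos : 0 < G.deg x := cnt_pos.2 hx
    rw [wsum_eq_cnt fun s _ => hf.val s] at hbal
    rw [cnt_abs_two] at htwo ⊢
    have hzero : ∀ a : ℤ, 0 < (cnt fun s => G.vert s = x ∧ f s = a) →
        (cnt fun s => G.vert s = x ∧ f s = -a) = 0 := by
      intro a ha
      obtain ⟨s, hs, rfl⟩ := cnt_pos.1 ha
      exact cnt_eq_zero.2 fun t ht => hopp s t hs ht.1 ht.2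
    have z1 := hzero 1
    have z2 := hzero 2
    rw [Nat.even_iff] at htwo
    -- Two values `2a` and four values `-a` form a balanced set, which again must be everything.
    -- Balance and the even number of values ±2 guarantee that so many are present.
    have key : ∀ a : ℤ, (a = 1 ∨ a = -1) → 2 ≤ (cnt fun s => G.vert s = x ∧ f s = 2 * a) →
        4 ≤ (cnt fun s => G.vert s = x ∧ f s = -a) →
        (cnt fun s => G.vert s = x ∧ f s = 2 * a) = 2 ∧
          (cnt fun s => G.vert s = x ∧ f s = -a) = 4 ∧
          ∀ s, G.vert s = x → f s = 2 * a ∨ f s = -a := by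
      intro a ha h2 h4
      obtain ⟨A, hA, hA2⟩ := exists_cnt_eq h2
      obtain ⟨B, hB, hB4⟩ := exists_cnt_eq h4
      have hAB : ∀ s, A s → ¬ B s := by
        intro s hs hs'
        have h1 := (hA s hs).2
        have h2 := (hB s hs').2
        omega
      have e1 : wsum (fun s => A s ∨ B s) f = 0 := by
        rw [← wsum_add_wsum_not _ A, wsum_congr (q := A) (g := fun _ => 2 * a) (fun s => by tauto)
          (fun s hs => (hA s hs).2), wsum_congr (q := B) (g := fun _ => -a)
          (fun s => by have := hAB s; tauto) (fun s hs => (hB s hs).2), wsum_const, wsum_const, hA2,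
          hB4]
        push_cast
        ring
      have e2 : (cnt fun s => (A s ∨ B s) ∧ |f s| = 2) = 2 := by
        rw [← hA2]
        refine cnt_congr fun s => ⟨fun h => h.1.resolve_right fun hs => ?_,
          fun h => ⟨Or.inl h, ?_⟩⟩
        · have h1 := (hB s hs).2
          rw [h1] at h
          rcases ha with rfl | rfl <;> simp at h
        · rw [(hA s h).2]
          rcases ha with rfl | rfl <;> rfl
      have hall := hirr (fun s => A s ∨ B s)
        (fun s hs => hs.elim (fun h => (hA s h).1) fun h => (hB s h).1)
        (by
          obtain ⟨s, hs⟩ := cnt_pos.1 (by omega : 0 < cnt A)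
          exact ⟨s, Or.inl hs⟩) e1 (by rw [e2]; exact even_two)
      refine ⟨?_, ?_, fun s hs => (hall s hs).imp (fun h => (hA s h).2) fun h => (hB s h).2⟩
      · rw [← hA2]
        refine cnt_congr fun s => ⟨fun h => (hall s h.1).resolve_right fun h' => ?_, hA s⟩
        have := (hB s h').2
        omega
      · rw [← hB4]
        refine cnt_congr fun s => ⟨fun h => (hall s h.1).resolve_left fun h' => ?_, hB s⟩
        have := (hA s h').2
        omega
    have k1 := key 1 (Or.inl rfl)
    have k2 := key (-1) (Or.inr rfl)
    norm_num at k1 k2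
    by_cases hone : 0 < cnt fun s => G.vert s = x ∧ f s = 1
    · obtain ⟨h1, h2, h3⟩ := k2 (by omega) (by omega)
      refine ⟨by omega, by omega, true, fun s hs => ?_⟩
      rw [decide_eq_true_eq]
      have := h3 s hs
      tauto
    · obtain ⟨h1, h2, h3⟩ := k1 (by omega) (by omega)
      refine ⟨by omega, by omega, false, fun s hs => ?_⟩
      rw [decide_eq_false_iff_not]
      have := h3 s hs
      omega

end StubGraph

namespace StubGraph

universe u v

variable {S : Type u} {V : Type v} {G : StubGraph S V} [Fintype S] [Fintype V] {f : S → ℤ}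

open Classical in
omit [Fintype S] [Fintype V] in
theorem isPairing_of_twoValent {x : V} {s t : S} (hs : G.vert s = x) (ht : G.vert t = x)
    (hne : s ≠ t) (hmst : G.mate s ≠ t) (hall : ∀ u, G.vert u = x → u = s ∨ u = t) :
    G.IsPairing x fun u => if u = s then t else s := by
  have hmts : G.mate t ≠ s := fun h => hmst (by rw [← h, G.mate_mate])
  refine ⟨?_, ?_, ?_, ?_⟩
  · intro u hu hu'
    rcases hall u hu with rfl | rfl <;> rcases hall _ hu' with h | h
    exacts [G.mate_ne _ h, hmst h, hmts h, G.mate_ne _ h]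
  · intro u hu
    split_ifs
    exacts [ht, hs]
  · intro u hu
    rcases hall u hu with rfl | rfl
    · simp [hne.symm]
    · simp [hne.symm]
  · intro u hu
    rcases hall u hu with rfl | rfl
    · simp [hne.symm]
    · simp [hne.symm, hne]

open Classical in
omit [Fintype S] [Fintype V] in
theorem eq_or_eq_of_twoValent {x : V} {s t : S} (hne : s ≠ t)
    (hall : ∀ u, G.vert u = x → u = s ∨ u = t) (a b : S) (ha : G.vert a = x) (hb : G.vert b = x) :
    b = a ∨ b = if a = s then t else s := by
  rcases hall a ha with rfl | rfl <;> rcases hall b hb with rfl | rfl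
  · exact Or.inl rfl
  · right; simp
  · right; simp [hne.symm]
  · exact Or.inl rfl

omit [Fintype S] [Fintype V] in
theorem Conn.eq_or_eq_of_loop (hG : G.Conn) {x : V} {s t : S} (hs : G.vert s = x)
    (ht : G.vert t = x) (hmst : G.mate s = t) (hall : ∀ u, G.vert u = x → u = s ∨ u = t) (u : S) :
    u = s ∨ u = t := by
  have hmts : G.mate t = s := by rw [← hmst, G.mate_mate]
  refine hG (fun u => u = s ∨ u = t) ?_ ?_ s u (Or.inl rfl)
  · rintro a b hab (rfl | rfl)
    exacts [hall b (hab ▸ hs), hall b (hab ▸ ht)]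
  · rintro a (rfl | rfl)
    exacts [Or.inr hmst, Or.inl hmts]

/-- If the two half-edges form a loop, their opposite values make it positive and connectivity makes
it the whole graph, which is then not odd. Otherwise `x` is suppressed, and opposite values at `x`
are just what makes the flow pass to the merged edge. -/
theorem good_of_twoValent (ih : GoodBelow.{u, v} G.pairs) (hf : G.IsThreeFlow f) (hG : G.Conn)
    (hodd : (cnt fun s => G.sgn s = true) % 4 = 2) {x : V} {s t : S} (hs : G.vert s = x)
    (ht : G.vert t = x) (hst : f t = - f s) (hall : ∀ u, G.vert u = x → u = s ∨ u = t) :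
    G.Good := by
  classical
  have hne : s ≠ t := by
    rintro rfl
    have := hf.val s
    omega
  by_cases hmst : G.mate s = t
  · exfalso
    have h1 := hf.mate s
    rw [hmst, hst] at h1
    have h2 : G.sgn s = false := by
      by_contra h2
      rw [Bool.not_eq_false] at h2
      rw [if_pos h2] at h1
      have := hf.val s
      omega
    have h3 := hG.eq_or_eq_of_loop hs ht hmst hall
    rw [cnt_eq_zero.2] at hodd
    · omega
    · intro u hu
      rcases h3 u with rfl | rfl
      · rw [h2] at hu
        exact absurd hu (by decide)
      · rw [← hmst, G.sgn_mate, h2] at hu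
        exact absurd hu (by decide)
  · have hp := isPairing_of_twoValent hs ht hne hmst hall
    have hfp : ∀ u, G.vert u = x → f (if u = s then t else s) = - f u := by
      intro u hu
      rcases hall u hu with rfl | rfl
      · simp [hst]
      · simp [hne.symm, hst]
    have hsgn := cnt_sgn_elim hp (p := fun _ => True) (fun _ _ => trivial) fun _ _ _ => trivial
    simp only [and_true] at hsgn
    refine good_of_elim hp (ih _ _ _ (fun u => f u.1) (pairs_lt ?_ (not_not.2 hs)) ?_ ?_ ?_)
    · intro a b hab
      exact congrArg Subtype.val hab
    · refine hf.restrict (φ := Subtype.val) (fun u y => Subtype.ext_iff) ?_ ?_ ?_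
      · intro u
        by_cases hu : G.vert (G.mate u.1) = x
        · rw [elim_mate_of_eq hp u hu, hf.mate, hfp _ hu, hf.mate]
          have h1 : (elim hp).sgn u = xor (G.sgn u.1)
              (G.sgn (if G.mate u.1 = s then t else s)) := by
            simp [elim, hu]
          rw [h1]
          cases G.sgn u.1 <;> cases G.sgn (if G.mate u.1 = s then t else s) <;> simp
        · rw [elim_mate_of_ne hp u hu, hf.mate]
          have h1 : (elim hp).sgn u = G.sgn u.1 := by simp [elim, hu]
          rw [h1]
      · intro y
        rw [← hf.bal y.1]
        exact wsum_congr (fun u => and_iff_left_of_imp fun h => h ▸ y.2) fun u _ => rfl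
      · intro y
        rw [cnt_congr (q := fun u => G.vert u = y.1 ∧ |f u| = 2) fun u =>
          and_congr_left fun _ => and_iff_left_of_imp fun h => h ▸ y.2]
        exact hf.two y.1
    · exact hG.elim hp (eq_or_eq_of_twoValent hne hall)
    · rw [hsgn, hodd]

/-- A side of a cut with two edges is connected. -/
theorem Conn.connOn_of_twoCut (hG : G.Conn) (hdeg : ∀ x, Even (G.deg x)) {W : Set V} {a b : S}
    (hW : ∀ s, G.vert s ∈ W → G.vert (G.mate s) ∉ W → s = a ∨ s = b) :
    G.ConnOn fun s => G.vert s ∈ W := by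
  -- A nonempty proper part closed within the side is left only through `a` or `b`, by an even
  -- number of edges, and not by none; so both belong to it. Applied to a part and to its complement
  -- this is contradictory.
  have key : ∀ Q : S → Prop, (∀ s t, G.vert s ∈ W → G.vert t ∈ W → G.vert s = G.vert t → Q s → Q t) →
      (∀ s, G.vert s ∈ W → G.vert (G.mate s) ∈ W → Q s → Q (G.mate s)) →
      (∃ s, G.vert s ∈ W ∧ Q s) → (∃ s, ¬ (G.vert s ∈ W ∧ Q s)) →
      (G.vert a ∈ W ∧ Q a) ∧ G.vert b ∈ W ∧ Q b := by
    rintro Q hv hm ⟨s, hs⟩ ⟨t, ht⟩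
    have h1 := even_cnt_cut hdeg {y | ∃ u, G.vert u = y ∧ G.vert u ∈ W ∧ Q u}
    have mem : ∀ s, G.vert s ∈ {y | ∃ u, G.vert u = y ∧ G.vert u ∈ W ∧ Q u}
        ↔ G.vert s ∈ W ∧ Q s := by
      intro s
      constructor
      · rintro ⟨u, hu, huW, hQ⟩
        have hs : G.vert s ∈ W := hu ▸ huW
        exact ⟨hs, hv u s huW hs hu hQ⟩
      · exact fun h => ⟨s, rfl, h⟩
    rw [cnt_congr fun s => by rw [mem, mem]] at h1
    have h2 : ∀ s, (G.vert s ∈ W ∧ Q s) ∧ ¬ (G.vert (G.mate s) ∈ W ∧ Q (G.mate s)) →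
        s = a ∨ s = b := by
      rintro s ⟨⟨hs, hQ⟩, h⟩
      exact hW s hs fun h' => h ⟨h', hm s hs h' hQ⟩
    by_contra hcon
    have h3 : ∃ c, ∀ s, (G.vert s ∈ W ∧ Q s) ∧ ¬ (G.vert (G.mate s) ∈ W ∧ Q (G.mate s)) →
        s = c := by
      by_cases ha : G.vert a ∈ W ∧ Q a
      · refine ⟨a, fun s hs => (h2 s hs).resolve_right ?_⟩
        rintro rfl
        exact hcon ⟨ha, hs.1⟩
      · refine ⟨b, fun s hs => (h2 s hs).resolve_left ?_⟩
        rintro rfl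
        exact ha hs.1
    obtain ⟨c, hc⟩ := h3
    have h4 : ∀ s, ¬ ((G.vert s ∈ W ∧ Q s) ∧ ¬ (G.vert (G.mate s) ∈ W ∧ Q (G.mate s))) := by
      intro s hs
      have h5 := (cnt_mono hc).trans_eq (cnt_eq_one c)
      have h6 : 0 < cnt fun s => (G.vert s ∈ W ∧ Q s) ∧ ¬ (G.vert (G.mate s) ∈ W ∧ Q (G.mate s)) :=
        cnt_pos.2 ⟨s, hs⟩
      rw [Nat.even_iff] at h1
      omega
    refine ht (hG (fun s => G.vert s ∈ W ∧ Q s) ?_ ?_ s t hs)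
    · rintro s t hst ⟨hs, hQ⟩
      have ht : G.vert t ∈ W := hst ▸ hs
      exact ⟨ht, hv s t hs ht hst hQ⟩
    · intro s hs
      by_contra h
      exact h4 s ⟨hs, h⟩
  intro Q hv hm s t hs ht hQs
  by_contra hQt
  have h1 := key Q hv hm ⟨s, hs, hQs⟩ ⟨t, fun h => hQt h.2⟩
  have h2 := key (fun s => ¬ Q s) (fun s t hs ht hst hQ h => hQ (hv t s ht hs hst.symm h))
    (fun s hs hs' hQ h => hQ (by
      have := hm _ hs' (by rwa [G.mate_mate]) h
      rwa [G.mate_mate] at this)) ⟨t, ht, hQt⟩ ⟨s, fun h => h.2 hQs⟩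
  exact h2.1.2 h1.1.2

open Classical in
/-- The side `W` of a cut whose edges leave `W` at the stubs `a` and `b`; these are joined. -/
noncomputable def side (G : StubGraph S V) {W : Set V} {a b : S}
    (ha : G.vert a ∈ W ∧ G.vert (G.mate a) ∉ W) (hb : G.vert b ∈ W ∧ G.vert (G.mate b) ∉ W)
    (hab : a ≠ b) (hW : ∀ s, G.vert s ∈ W → G.vert (G.mate s) ∉ W → s = a ∨ s = b)
    (hsgn : G.sgn a = G.sgn b) : StubGraph {s // G.vert s ∈ W} V where
  vert s := G.vert s.1
  mate s := if hs : G.vert (G.mate s.1) ∈ W then ⟨G.mate s.1, hs⟩ else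
    if s.1 = a then ⟨b, hb.1⟩ else ⟨a, ha.1⟩
  sgn s := G.sgn s.1
  mate_mate := by
    rintro ⟨s, hs⟩
    by_cases hs' : G.vert (G.mate s) ∈ W
    · simp [hs', G.mate_mate, hs]
    · rcases hW s hs hs' with rfl | rfl
      · simp [hs', hb.2, hab.symm]
      · simp [hs', ha.2, hab.symm]
  mate_ne := by
    rintro ⟨s, hs⟩
    by_cases hs' : G.vert (G.mate s) ∈ W
    · simp [hs', G.mate_ne]
    · rcases hW s hs hs' with rfl | rfl
      · simp [hs', hab.symm]
      · simp [hs', hab.symm, hab]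
  sgn_mate := by
    rintro ⟨s, hs⟩
    by_cases hs' : G.vert (G.mate s) ∈ W
    · simp [hs', G.sgn_mate]
    · rcases hW s hs hs' with rfl | rfl
      · simp [hs', hsgn]
      · simp [hs', hab.symm, hsgn]

/-- A connected odd graph with negative edges, each vertex carrying two stubs of value `2` and four
stubs of value `-1`. -/
structure IsNegative (G : StubGraph S V) (f : S → ℤ) : Prop where
  flow : G.IsThreeFlow f
  conn : G.Conn
  odd : Fintype.card S % 4 = 2
  sgn : ∀ s, G.sgn s = true
  val : ∀ s, f s = 2 ∨ f s = -1
  deg : ∀ s, G.deg (G.vert s) = 6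
  two : ∀ s, (cnt fun t => G.vert t = G.vert s ∧ f t = 2) = 2

/-- Joining the two cut half-edges turns the side `W` into a graph with an odd number of edges,
which is what `hW` expresses. The flow passes to it since the two values agree: each vertex has two
half-edges of value 2 and each inner edge uses none or two of them, so an even number of cut
half-edges has value 2. -/
theorem IsNegative.good_of_twoCut (ih : GoodBelow.{u, v} G.pairs) (h : G.IsNegative f) {W : Set V}
    (hcut : (cnt fun s => G.vert s ∈ W ∧ G.vert (G.mate s) ∉ W) = 2)
    (hW : (cnt fun s => G.vert s ∈ W) % 4 = 2) : G.Good := by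
  classical
  obtain ⟨a, b, hab, hW2⟩ := cnt_two_elems hcut
  have ha := (hW2 a).2 (Or.inl rfl)
  have hb := (hW2 b).2 (Or.inr rfl)
  have hWab : ∀ s, G.vert s ∈ W → G.vert (G.mate s) ∉ W → s = a ∨ s = b :=
    fun s hs hs' => (hW2 s).1 ⟨hs, hs'⟩
  have hmate : ∀ s, f (G.mate s) = f s := fun s => by rw [h.flow.mate, if_pos (h.sgn s)]
  have hdeg := h.flow.even_deg
  have fiber : ∀ p : S → Prop, (∀ x, Even (cnt fun s => G.vert s = x ∧ p s)) →
      Even (cnt fun s => G.vert s ∈ W ∧ p s) := by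
    intro p hp
    rw [cnt_fiber G.vert]
    refine Finset.even_sum _ fun x _ => ?_
    by_cases hx : x ∈ W
    · rw [cnt_congr (q := fun s => G.vert s = x ∧ p s)]
      · exact hp x
      · exact fun s => ⟨fun h => ⟨h.1, h.2.2⟩, fun h => ⟨h.1, h.1 ▸ hx, h.2⟩⟩
    · rw [cnt_eq_zero.2]
      · exact Even.zero
      · rintro s ⟨rfl, h, -⟩
        exact hx h
  have hfab : f a = f b := by
    have h1 : Even (cnt fun s => G.vert s ∈ W ∧ f s = 2) := by
      refine fiber _ fun x => ?_
      by_cases hx : ∃ s, G.vert s = x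
      · obtain ⟨s, rfl⟩ := hx
        rw [h.two s]
        exact even_two
      · push Not at hx
        rw [cnt_eq_zero.2 fun s h => hx s h.1]
        exact Even.zero
    have h2 := cnt_add_cnt_not (fun s => G.vert s ∈ W ∧ f s = 2) (fun s => G.vert (G.mate s) ∈ W)
    have h3 : Even (cnt fun s => (G.vert s ∈ W ∧ f s = 2) ∧ G.vert (G.mate s) ∈ W) := by
      refine even_cnt_of_involution G.mate ?_ (fun s _ => G.mate_mate s) (fun s _ => G.mate_ne s)
      rintro s ⟨⟨h1, h2⟩, h3⟩
      exact ⟨⟨h3, by rw [hmate, h2]⟩, by rwa [G.mate_mate]⟩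
    rw [← h2] at h1
    have h4 := (Nat.even_add.1 h1).1 h3
    have h5 : ∀ c d, c ≠ d → (∀ s, s = c ∨ s = d ↔ s = a ∨ s = b) → f c = 2 → f d = -1 → False := by
      intro c d hcd hcd' hc hd
      rw [cnt_congr (q := fun s => s = c), cnt_eq_one] at h4
      · exact absurd h4 (by decide)
      · intro s
        have h6 := (hW2 s).trans (hcd' s).symm
        constructor
        · rintro ⟨⟨hs, hs2⟩, hs'⟩
          rcases h6.1 ⟨hs, hs'⟩ with rfl | rfl
          · rfl
          · omega
        · rintro rfl
          have := h6.2 (Or.inl rfl)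
          exact ⟨⟨this.1, hc⟩, this.2⟩
    rcases h.val a with ha2 | ha2 <;> rcases h.val b with hb2 | hb2
    · rw [ha2, hb2]
    · exact (h5 a b hab (fun s => Iff.rfl) ha2 hb2).elim
    · exact (h5 b a hab.symm (fun s => or_comm) hb2 ha2).elim
    · rw [ha2, hb2]
  have hsgn : G.sgn a = G.sgn b := by rw [h.sgn, h.sgn]
  set H := G.side ha hb hab hWab hsgn with hH
  have hHmate : ∀ s : {s // G.vert s ∈ W}, G.vert (G.mate s.1) ∈ W → (H.mate s).1 = G.mate s.1 := by
    intro s hs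
    simp [hH, side, hs]
  have hHa : (H.mate ⟨a, ha.1⟩).1 = b := by simp [hH, side, ha.2]
  have hHb : (H.mate ⟨b, hb.1⟩).1 = a := by simp [hH, side, hb.2, hab.symm]
  have hfib : ∀ y, y ∈ W ∨ y ∉ W := fun y => Classical.em _
  have flow : H.IsThreeFlow fun s => f s.1 := by
    refine h.flow.restrict (φ := id) (fun s y => Iff.rfl) ?_ ?_ ?_
    · intro s
      have h1 : H.sgn s = true := h.sgn s.1
      rw [if_pos h1]
      by_cases hs : G.vert (G.mate s.1) ∈ W
      · rw [hHmate s hs, hmate]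
      · rcases hWab s.1 s.2 hs with h2 | h2
        · have h3 : s = ⟨a, ha.1⟩ := Subtype.ext h2
          rw [h3, hHa, hfab]
        · have h3 : s = ⟨b, hb.1⟩ := Subtype.ext h2
          rw [h3, hHb, hfab]
    · intro y
      change wsum (fun s => G.vert s = y ∧ G.vert s ∈ W) f = 0
      rcases hfib y with hy | hy
      · rw [← h.flow.bal y]
        exact wsum_congr (fun s => and_iff_left_of_imp fun h => h ▸ hy) fun s _ => rfl
      · exact wsum_eq_zero fun s h => hy (h.1 ▸ h.2)
    · intro y
      change Even (cnt fun s => (G.vert s = y ∧ G.vert s ∈ W) ∧ |f s| = 2)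
      rcases hfib y with hy | hy
      · rw [cnt_congr (q := fun s => G.vert s = y ∧ |f s| = 2) fun s =>
          and_congr_left fun _ => and_iff_left_of_imp fun h => h ▸ hy]
        exact h.flow.two y
      · rw [cnt_eq_zero.2]
        · exact Even.zero
        · rintro s ⟨⟨rfl, h⟩, -⟩
          exact hy h
  have conn : H.Conn := (h.conn.connOn_of_twoCut hdeg hWab).conn (fun s => rfl) hHmate
  have hcard := cnt_add_cnt_not (fun s => G.sgn s = true) (fun s => G.vert s ∈ W)
  have e1 : (cnt fun s => G.sgn s = true ∧ G.vert s ∈ W) = cnt fun s => G.vert s ∈ W :=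
    cnt_congr fun s => by simp [h.sgn]
  have e2 : (cnt fun s => G.sgn s = true) = Fintype.card S := by
    rw [← cnt_true]
    exact cnt_congr fun s => by simp [h.sgn]
  have hodd := h.odd
  have good : H.Good := by
    refine ih _ _ _ _ (pairs_lt (fun s t h => h) ha.2) flow conn ?_
    rw [← hW, ← e1, cnt_congr (q := fun s => G.vert s ∈ W ∧ G.sgn s = true) (fun s => and_comm),
      ← cnt_subtype]
    rfl
  refine good.attach (fun s => rfl) (fun s => rfl) hHmate ?_ ?_ (by omega) ⟨a, ha.1⟩ ?_
    (G.mate a) ha.2 (Or.inr rfl)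
  · refine h.conn.connOn_of_twoCut hdeg (W := Wᶜ) (a := G.mate a) (b := G.mate b) ?_
    intro s hs hs'
    have := hWab (G.mate s) (not_not.1 hs') (by rwa [G.mate_mate])
    exact this.imp (fun h => by rw [← h, G.mate_mate]) fun h => by rw [← h, G.mate_mate]
  · intro x
    rcases hfib x with hx | hx
    · rw [cnt_eq_zero.2]
      · exact Even.zero
      · rintro s ⟨rfl, h⟩
        exact h hx
    · rw [cnt_congr (q := fun s => G.vert s = x) fun s => and_iff_left_of_imp fun h => h ▸ hx]
      exact hdeg x
  · intro s hs
    rcases hWab s.1 s.2 hs with h2 | h2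
    · exact Or.inl (Subtype.ext h2)
    · exact Or.inr (Subtype.ext (h2.trans hHa.symm))

/-- A cut of fewer than four edges has exactly two, being even and, by connectivity, nonempty. The
half-edges number 2 modulo 4 in all and an even number on each side, so one side has 2 modulo 4. If
there is no such cut, the graph is a core. -/
theorem IsNegative.good (ih : GoodBelow.{u, v} G.pairs) (h : G.IsNegative f) : G.Good := by
  classical
  have hdeg := h.flow.even_deg
  by_cases hcut : ∃ W : Set V, (∃ s, G.vert s ∈ W) ∧ (∃ s, G.vert s ∉ W) ∧
      (cnt fun s => G.vert s ∈ W ∧ G.vert (G.mate s) ∉ W) < 4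
  · obtain ⟨W, ⟨s, hs⟩, ⟨t, ht⟩, hW⟩ := hcut
    have h1 := even_cnt_cut hdeg W
    have h2 : 0 < cnt fun s => G.vert s ∈ W ∧ G.vert (G.mate s) ∉ W := by
      by_contra h2
      have h3 := cnt_eq_zero.1 (by omega : (cnt fun s => G.vert s ∈ W ∧ G.vert (G.mate s) ∉ W) = 0)
      refine ht (h.conn (fun u => G.vert u ∈ W) ?_ ?_ s t hs)
      · exact fun a b hab ha => hab ▸ ha
      · intro a ha
        by_contra h4
        exact h3 a ⟨ha, h4⟩
    rw [Nat.even_iff] at h1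
    have h3 : (cnt fun s => G.vert s ∈ W ∧ G.vert (G.mate s) ∉ W) = 2 := by omega
    by_cases h4 : (cnt fun s => G.vert s ∈ W) % 4 = 2
    · exact h.good_of_twoCut ih h3 h4
    · refine h.good_of_twoCut ih (W := Wᶜ) ?_ ?_
      · rw [← h3, ← cnt_comp_involutive G.mate_mate fun s => G.vert s ∈ W ∧ G.vert (G.mate s) ∉ W]
        refine cnt_congr fun s => ?_
        rw [G.mate_mate]
        simp only [Set.mem_compl_iff, not_not]
        exact and_comm
      · have h5 := cnt_add_cnt_not (fun _ : S => True) fun s => G.vert s ∈ W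
        rw [cnt_true] at h5
        have h6 : (cnt fun s => True ∧ G.vert s ∈ W) = cnt fun s => G.vert s ∈ W :=
          cnt_congr fun s => by simp
        have h7 : (cnt fun s => True ∧ ¬ G.vert s ∈ W) = cnt fun s => G.vert s ∈ Wᶜ :=
          cnt_congr fun s => by simp
        have h8 := even_cnt_vert hdeg fun x => x ∈ W
        have h9 := h.odd
        rw [Nat.even_iff] at h8
        omega
  · push Not at hcut
    -- Isolated vertices are dropped, since a core has valency six at every vertex.
    let G' : StubGraph S {x // ∃ s, G.vert s = x} :=
      { vert := fun s => ⟨G.vert s, s, rfl⟩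
        mate := G.mate
        sgn := G.sgn
        mate_mate := G.mate_mate
        mate_ne := G.mate_ne
        sgn_mate := G.sgn_mate }
    have core : G'.IsCore := by
      refine ⟨?_, h.sgn, h.odd, ?_⟩
      · rintro ⟨_, s, rfl⟩
        rw [← h.deg s]
        exact cnt_congr fun t => Subtype.ext_iff
      · intro W hW hW'
        have h1 := hcut (Subtype.val '' W) ?_ ?_
        · rw [d_lifts]
          have h2 : (cnt fun s => G.vert s ∈ Subtype.val '' W ∧ G.vert (G.mate s) ∉ Subtype.val '' W)
              = cnt fun s => G'.vert s ∈ W ∧ G'.vert (G'.mate s) ∉ W := by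
            refine cnt_congr fun s => ?_
            have : ∀ s, G.vert s ∈ Subtype.val '' W ↔ G'.vert s ∈ W := fun s =>
              Function.Injective.mem_set_image Subtype.val_injective (a := G'.vert s)
            rw [this, this]
          omega
        · obtain ⟨⟨_, s, rfl⟩, hs⟩ := hW
          exact ⟨s, _, hs, rfl⟩
        · rw [Set.ne_univ_iff_exists_notMem] at hW'
          obtain ⟨⟨_, s, rfl⟩, hs⟩ := hW'
          refine ⟨s, ?_⟩
          rintro ⟨y, hy, hys⟩
          apply hs
          have : y = ⟨G.vert s, s, rfl⟩ := Subtype.ext hys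
          rwa [← this]
    exact core.good.contract id Subtype.val Function.injective_id (fun _ => rfl) (fun _ => rfl)
      (fun _ => rfl) fun t ht => (ht t rfl).elim

/-- Switching does not affect the existence of a colouring. -/
theorem Good.of_switch {H : StubGraph S V} (hvert : H.vert = G.vert) (hmate : H.mate = G.mate)
    {c : V → Bool} (hsgn : ∀ s, H.sgn s = xor (G.sgn s) (xor (c (G.vert s)) (c (G.vert (G.mate s)))))
    (hH : H.Good) : G.Good := by
  obtain ⟨τ, v, hτ⟩ := hH
  have hm := hτ.mate
  have he := hτ.even
  have ho := hτ.odd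
  rw [hmate] at hm
  simp only [hvert] at he
  refine ⟨τ, v, hm, he, fun i => ?_, ?_⟩
  · have h1 := cnt_switch (G := G) (p := fun s => τ s = i) (fun s hs => by rw [hm, hs])
      (fun x => he x i) c
    rw [cnt_congr (q := fun s => τ s = i ∧ G.sgn s = true) (fun s => and_comm), ← h1, ← ho i]
    exact congrArg (· % 4) (cnt_congr fun s => by rw [hsgn, and_comm])
  · have h1 := hτ.reaches
    unfold Reaches at h1 ⊢
    rwa [hvert, hmate] at h1

/-- Once no reduction applies, all vertices with half-edges carry 2c, 2c and four times -c. Negation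
exchanges the types c = 1 and c = -1, so positive edges join different types and negative edges
equal ones; switching at one type makes every edge negative. -/
theorem good_of_isThreeFlow_aux (ih : GoodBelow.{u, v} G.pairs) (hf : G.IsThreeFlow f)
    (hG : G.Conn) (hodd : (cnt fun s => G.sgn s = true) % 4 = 2) : G.Good := by
  classical
  by_cases hirr : ∀ x, ∀ A : S → Prop, (∀ s, A s → G.vert s = x) → (∃ s, A s) → wsum A f = 0 →
      Even (cnt fun s => A s ∧ |f s| = 2) → ∀ s, G.vert s = x → A s
  swap
  · push Not at hirr
    obtain ⟨x, A, hA, ⟨s, hs⟩, hbal, htwo, t, ht, hAt⟩ := hirr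
    exact good_of_zeroSum ih hf hG hodd hA hs ht hAt hbal htwo
  by_cases h2 : ∃ s t, G.vert t = G.vert s ∧ f t = - f s ∧
      ∀ u, G.vert u = G.vert s → u = s ∨ u = t
  · obtain ⟨s, t, ht, hst, hall⟩ := h2
    exact good_of_twoValent ih hf hG hodd rfl ht hst hall
  have h6 : ∀ s, (cnt fun t => G.vert t = G.vert s ∧ |f t| = 2) = 2 ∧ G.deg (G.vert s) = 6 ∧
      ∃ c : Bool, ∀ t, G.vert t = G.vert s → (decide (f t = 1 ∨ f t = -2)) = c := by
    intro s
    refine (hf.vertex_cases (hirr _) ⟨s, rfl⟩).resolve_left ?_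
    rintro ⟨a, b, ha, hb, hab, hall⟩
    refine h2 ⟨a, b, hb.trans ha.symm, hab, ?_⟩
    rwa [ha]
  let c : V → Bool := fun x => decide (∃ s, G.vert s = x ∧ (f s = 1 ∨ f s = -2))
  have hc : ∀ s, c (G.vert s) = true ↔ f s = 1 ∨ f s = -2 := by
    intro s
    obtain ⟨-, -, b, hb⟩ := h6 s
    simp only [c, decide_eq_true_eq]
    constructor
    · rintro ⟨t, ht, h⟩
      have h1 := hb t ht
      rw [← hb s rfl, decide_eq_decide] at h1
      exact h1.1 h
    · exact fun h => ⟨s, rfl, h⟩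
  have hsw : ∀ s, xor (G.sgn s) (xor (c (G.vert s)) (c (G.vert (G.mate s)))) = true := by
    intro s
    have h1 := hf.mate s
    have h3 := hc s
    have h4 := hc (G.mate s)
    have h5 := hf.val s
    revert h1 h3 h4
    cases G.sgn s <;> cases c (G.vert s) <;> cases c (G.vert (G.mate s)) <;> simp <;> omega
  let H : StubGraph S V :=
    { vert := G.vert
      mate := G.mate
      sgn := fun _ => true
      mate_mate := G.mate_mate
      mate_ne := G.mate_ne
      sgn_mate := fun _ => rfl }
  -- The values of the flow after the switching.
  let g : S → ℤ := fun s => if |f s| = 2 then 2 else -1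
  have hg2 : ∀ s, g s = 2 ↔ |f s| = 2 := by
    intro s
    simp only [g]
    split_ifs with h <;> simp [h]
  have hg : ∀ s, g s = 2 ∨ g s = -1 := by
    intro s
    simp only [g]
    split_ifs
    exacts [Or.inl rfl, Or.inr rfl]
  have hgabs : ∀ s, |g s| = 2 ↔ |f s| = 2 := by
    intro s
    rw [← hg2]
    rcases hg s with h | h <;> simp [h]
  have hgmate : ∀ s, g (G.mate s) = g s := by
    intro s
    have : |f (G.mate s)| = |f s| := by
      rw [hf.mate]
      split_ifs
      exacts [rfl, abs_neg _]
    simp only [g, this]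
  have htwo : ∀ s, (cnt fun t => G.vert t = G.vert s ∧ g t = 2) = 2 := by
    intro s
    rw [← (h6 s).1]
    exact cnt_congr fun t => by rw [hg2]
  have flow : H.IsThreeFlow g := by
    refine ⟨hgmate, ?_, ?_, ?_⟩
    · intro x
      by_cases hx : ∃ s, G.vert s = x
      · obtain ⟨s, rfl⟩ := hx
        have v4 : ∀ s, g s = 1 ∨ g s = -1 ∨ g s = 2 ∨ g s = -2 := fun s => by
          have := hg s
          tauto
        have h1 := htwo s
        have h3 : G.deg (G.vert s) = _ := cnt_eq_cnt_add (fun t _ => v4 t)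
        have h4 := (h6 s).2.1
        have h7 : (cnt fun t => G.vert t = G.vert s ∧ g t = 1) = 0 :=
          cnt_eq_zero.2 fun t ht => by have := hg t; omega
        have h8 : (cnt fun t => G.vert t = G.vert s ∧ g t = -2) = 0 :=
          cnt_eq_zero.2 fun t ht => by have := hg t; omega
        change wsum (fun t => G.vert t = G.vert s) g = 0
        rw [wsum_eq_cnt fun t _ => v4 t]
        omega
      · push Not at hx
        exact wsum_eq_zero hx
    · intro s
      have := hg s
      tauto
    · intro x
      rw [cnt_congr (q := fun s => G.vert s = x ∧ |f s| = 2) fun s => by rw [hgabs]]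
      exact hf.two x
  have hcard : Fintype.card S % 4 = 2 := by
    have h1 := cnt_switch (G := G) (p := fun _ => True) (fun _ h => h)
      (fun x => by simpa [deg] using hf.even_deg x) c
    simp only [true_and, hsw] at h1
    rw [← cnt_true, h1, hodd]
  have hH : H.IsNegative g := ⟨flow, hG, hcard, fun _ => rfl, hg, fun s => (h6 s).2.1, htwo⟩
  exact Good.of_switch (G := G) (H := H) rfl rfl (c := c) (fun s => (hsw s).symm)
    (IsNegative.good (G := H) ih hH)

/-- An odd connected graph with a nowhere-zero flow with values `±1`, `±2` splits into three odd
eulerian subgraphs with a common vertex. -/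
theorem good_of_isThreeFlow (hf : G.IsThreeFlow f) (hG : G.Conn)
    (hodd : (cnt fun s => G.sgn s = true) % 4 = 2) : G.Good := by
  have key : ∀ n, GoodBelow.{u, v} n := by
    intro n
    induction n with
    | zero => exact fun S V _ _ G f h => absurd h (Nat.not_lt_zero _)
    | succ n ih =>
      intro S V _ _ G f h hf hG hodd
      refine good_of_isThreeFlow_aux (fun S' V' _ _ G' f' h' => ?_) hf hG hodd
      exact ih S' V' G' f' (by omega)
  exact good_of_isThreeFlow_aux (key _) hf hG hodd

end StubGraph

theorem wsum_single {S : Type*} [Fintype S] [DecidableEq S] (p : S → Prop) [DecidablePred p] (a : S)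
    (c : ℤ) : wsum p (fun s => if s = a then c else 0) = if p a then c else 0 := by
  classical
  rw [wsum_eq_sum, Finset.sum_ite_eq']
  simp

/-! ### Two-flows and assignments with excess two -/

namespace StubGraph

universe u v

variable {S : Type u} {V : Type v} {G : StubGraph S V} [Fintype S] {f : S → ℤ}

/-- A balanced assignment of values `±1` to the stubs, compatible with the signature. -/
structure IsTwoFlow (G : StubGraph S V) (f : S → ℤ) : Prop where
  mate : ∀ s, f (G.mate s) = if G.sgn s then f s else - f s
  bal : ∀ x, wsum (fun s => G.vert s = x) f = 0
  val : ∀ s, f s = 1 ∨ f s = -1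

/-- Splitting off two stubs, either `a` and `b` or `a` and `c`, preserves connectivity. -/
theorem Conn.conn_split_pair [Fintype V] (hG : G.Conn) (hdeg : ∀ x, Even (G.deg x)) {x : V}
    {a b c : S} (ha : G.vert a = x) (hb : G.vert b = x) (hc : G.vert c = x) (hab : a ≠ b)
    (hbc : b ≠ c) (hac : a ≠ c) : (G.split fun s => s = a ∨ s = b).Conn ∨
      (G.split fun s => s = a ∨ s = c).Conn := by
  by_contra h
  push Not at h
  have h1 : ∀ s, s = a ∨ s = b → G.vert s = x := by rintro s (rfl | rfl) <;> assumption
  have h2 : ∀ s, s = a ∨ s = c → G.vert s = x := by rintro s (rfl | rfl) <;> assumption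
  obtain ⟨P, hPm, hPv, hPx⟩ := hG.exists_cut_of_not_conn_split h1 h.1
  obtain ⟨Q, hQm, hQv, hQx⟩ := hG.exists_cut_of_not_conn_split h2 h.2
  -- If both splits disconnect, the half-edges in both cuts `P` and `Q` form whole edges, so their
  -- number is even. But at every vertex other than `x` they are all or none of an even number, and
  -- at `x` only `a` is among them.
  have h3 : Even (cnt fun s => P s ∧ Q s) :=
    even_cnt_of_involution G.mate (fun s hs => ⟨(hPm s).2 hs.1, (hQm s).2 hs.2⟩)
      (fun s _ => G.mate_mate s) (fun s _ => G.mate_ne s)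
  rw [← cnt_add_cnt_not (fun s => P s ∧ Q s) fun s => s = a] at h3
  have h4 : (cnt fun s => (P s ∧ Q s) ∧ s = a) = 1 := by
    rw [← cnt_eq_one a]
    refine cnt_congr fun s => and_iff_right_of_imp ?_
    rintro rfl
    exact ⟨(hPx s ha).2 (Or.inl rfl), (hQx s ha).2 (Or.inl rfl)⟩
  have h5 : Even (cnt fun s => (P s ∧ Q s) ∧ ¬ s = a) := by
    rw [cnt_fiber G.vert]
    refine Finset.even_sum _ fun y _ => ?_
    by_cases hy : y = x
    · rw [cnt_eq_zero.2]
      · exact Even.zero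
      · rintro s ⟨hs, ⟨hP, hQ⟩, hsa⟩
        have e1 := (hPx s (hs.trans hy)).1 hP
        have e2 := (hQx s (hs.trans hy)).1 hQ
        rcases e1 with e1 | e1
        · exact hsa e1
        · rcases e2 with e2 | e2
          exacts [hsa e2, hbc (e1.symm.trans e2)]
    · by_cases hex : ∃ s, G.vert s = y ∧ P s ∧ Q s
      · obtain ⟨s, hs, hP, hQ⟩ := hex
        rw [cnt_congr (q := fun s => G.vert s = y)]
        · exact hdeg y
        · refine fun t => and_iff_left_of_imp fun ht => ⟨⟨?_, ?_⟩, ?_⟩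
          · exact (hPv s t (hs.trans ht.symm) (hs ▸ hy)).1 hP
          · exact (hQv s t (hs.trans ht.symm) (hs ▸ hy)).1 hQ
          · rintro rfl
            exact hy (ht.symm.trans ha)
      · push Not at hex
        rw [cnt_eq_zero.2]
        · exact Even.zero
        · rintro s ⟨hs, ⟨hP, hQ⟩, -⟩
          exact hex s hs hP hQ
  rw [h4] at h3
  rw [Nat.even_iff] at h3 h5
  omega

theorem even_deg_split (hdeg : ∀ x, Even (G.deg x)) {x : V} {a b : S} (ha : G.vert a = x)
    (hb : G.vert b = x) (hab : a ≠ b) (z : V × Bool) :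
    Even ((G.split fun s => s = a ∨ s = b).deg z) := by
  have h1 : ∀ y, Even (cnt fun s => G.vert s = y ∧ (s = a ∨ s = b)) := by
    intro y
    by_cases hy : x = y
    · rw [cnt_congr (q := fun s => s = a ∨ s = b), cnt_eq_or_eq hab]
      · exact even_two
      · refine fun s => and_iff_right_of_imp ?_
        rintro (rfl | rfl)
        exacts [ha.trans hy, hb.trans hy]
    · rw [cnt_eq_zero.2]
      · exact Even.zero
      · rintro s ⟨rfl, rfl | rfl⟩
        exacts [hy ha.symm, hy hb.symm]
  obtain ⟨y, c⟩ := z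
  cases c
  · have h2 := cnt_add_cnt_not (fun s => G.vert s = y) (fun s => s = a ∨ s = b)
    have h3 : Even (cnt fun s => G.vert s = y) := hdeg y
    rw [← h2] at h3
    have h4 : (G.split fun s => s = a ∨ s = b).deg (y, false)
        = cnt fun s => G.vert s = y ∧ ¬ (s = a ∨ s = b) := cnt_congr fun s => by simp [split]
    rw [h4]
    exact (Nat.even_add.1 h3).1 (h1 y)
  · have h4 : (G.split fun s => s = a ∨ s = b).deg (y, true)
        = cnt fun s => G.vert s = y ∧ (s = a ∨ s = b) := cnt_congr fun s => by simp [split]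
    rw [h4]
    exact h1 y

theorem IsTwoFlow.of_split {A : S → Prop} (hf : (G.split A).IsTwoFlow f) : G.IsTwoFlow f := by
  refine ⟨hf.mate, fun x => ?_, hf.val⟩
  have h1 := wsum_add_wsum_not (fun s => G.vert s = x) A f
  have h2 := hf.bal (x, true)
  have h3 := hf.bal (x, false)
  rw [wsum_congr (q := fun s => G.vert s = x ∧ A s) (g := f) (fun s => by simp [split])
    fun _ _ => rfl] at h2
  rw [wsum_congr (q := fun s => G.vert s = x ∧ ¬ A s) (g := f) (fun s => by simp [split])
    fun _ _ => rfl] at h3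
  rw [← h1, h2, h3, add_zero]

theorem wsum_of_twoValent {x : V} {s t : S} (hs : G.vert s = x) (ht : G.vert t = x) (hne : s ≠ t)
    (hall : ∀ u, G.vert u = x → u = s ∨ u = t) (f : S → ℤ) :
    wsum (fun u => G.vert u = x) f = f s + f t := by
  classical
  rw [wsum_eq_sum, ← Finset.sum_pair hne]
  congr 1
  ext u
  simp only [Finset.mem_filter, Finset.mem_univ, true_and, Finset.mem_insert, Finset.mem_singleton]
  refine ⟨hall u, ?_⟩
  rintro (rfl | rfl)
  exacts [hs, ht]

open Classical in
-- A loop here is the whole graph and is positive by evenness, so 1 and -1 serve. Otherwise the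
-- values at `x` are dictated by the mates, and they cancel because the merged edge has the product
-- sign.
theorem exists_isTwoFlow_of_twoValent [Fintype V] (hG : G.Conn)
    (heven : (cnt fun s => G.sgn s = true) % 4 = 0) {x : V} {s t : S} (hs : G.vert s = x)
    (ht : G.vert t = x) (hne : s ≠ t) (hall : ∀ u, G.vert u = x → u = s ∨ u = t)
    (ih : ∀ (h : G.IsPairing x fun u => if u = s then t else s),
      (cnt fun u => (elim h).sgn u = true) % 4 = 0 → (elim h).Conn → ∃ g, (elim h).IsTwoFlow g) :
    ∃ f, G.IsTwoFlow f := by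
  classical
  by_cases hmst : G.mate s = t
  · have hmts : G.mate t = s := by rw [← hmst, G.mate_mate]
    have h3 := hG.eq_or_eq_of_loop hs ht hmst hall
    have hsgn : G.sgn s = false := by
      by_contra h
      rw [Bool.not_eq_false] at h
      rw [cnt_congr (q := fun u => u = s ∨ u = t), cnt_eq_or_eq hne] at heven
      · omega
      · refine fun u => ⟨fun _ => h3 u, ?_⟩
        rintro (rfl | rfl)
        · exact h
        · rw [← hmst, G.sgn_mate, h]
    have hsgn' : G.sgn t = false := by rw [← hmst, G.sgn_mate, hsgn]
    refine ⟨fun u => if u = s then 1 else -1, ?_, ?_, ?_⟩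
    · intro u
      rcases h3 u with rfl | rfl
      · simp [hmst, hne.symm, hsgn]
      · simp [hmts, hne.symm, hsgn']
    · intro y
      by_cases hy : y = x
      · rw [hy, wsum_of_twoValent hs ht hne hall]
        simp [hne.symm]
      · refine wsum_eq_zero fun u hu => hy ?_
        rcases h3 u with rfl | rfl
        exacts [hu.symm.trans hs, hu.symm.trans ht]
    · intro u
      split_ifs
      exacts [Or.inl rfl, Or.inr rfl]
  · have hp := isPairing_of_twoValent hs ht hne hmst hall
    have hsgn := cnt_sgn_elim hp (p := fun _ => True) (fun _ _ => trivial) fun _ _ _ => trivial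
    simp only [and_true] at hsgn
    obtain ⟨g, hg⟩ := ih hp (hsgn.trans heven) (hG.elim hp (eq_or_eq_of_twoValent hne hall))
    let f : S → ℤ := fun u => if hu : G.vert u = x then
      (if G.sgn u then g ⟨G.mate u, hp.noloop u hu⟩ else - g ⟨G.mate u, hp.noloop u hu⟩)
      else g ⟨u, hu⟩
    have hfx : ∀ u (hu : G.vert u = x), f u =
        if G.sgn u then g ⟨G.mate u, hp.noloop u hu⟩ else - g ⟨G.mate u, hp.noloop u hu⟩ :=
      fun u hu => by simp [f, hu]
    have hfn : ∀ u : {u // G.vert u ≠ x}, f u.1 = g u := fun u => by simp [f, u.2]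
    refine ⟨f, ?_, ?_, ?_⟩
    · intro u
      by_cases hu : G.vert u = x
      · rw [hfx u hu, hfn ⟨_, hp.noloop u hu⟩]
        split_ifs <;> simp
      · by_cases hu' : G.vert (G.mate u) = x
        · rw [hfx _ hu', hfn ⟨u, hu⟩, G.sgn_mate]
          simp only [G.mate_mate]
        · rw [hfn ⟨u, hu⟩, hfn ⟨_, hu'⟩]
          have h1 := hg.mate ⟨u, hu⟩
          have h2 : (elim hp).mate ⟨u, hu⟩ = ⟨G.mate u, hu'⟩ :=
            Subtype.ext (elim_mate_of_ne hp ⟨u, hu⟩ hu')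
          have h3 : (elim hp).sgn ⟨u, hu⟩ = G.sgn u := by simp [elim, hu']
          rwa [h2, h3] at h1
    · intro y
      by_cases hy : y = x
      · rw [hy, wsum_of_twoValent hs ht hne hall, hfx s hs, hfx t ht]
        have h1 := hg.mate ⟨G.mate s, hp.noloop s hs⟩
        have h2 : (elim hp).mate ⟨G.mate s, hp.noloop s hs⟩ = ⟨G.mate t, hp.noloop t ht⟩ := by
          refine Subtype.ext ?_
          rw [elim_mate_of_eq hp _ (by simpa [G.mate_mate] using hs)]
          simp [G.mate_mate]
        have h3 : (elim hp).sgn ⟨G.mate s, hp.noloop s hs⟩ = xor (G.sgn s) (G.sgn t) := by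
          simp [elim, G.mate_mate, hs, G.sgn_mate]
        rw [h2, h3] at h1
        rw [h1]
        cases G.sgn s <;> cases G.sgn t <;> simp
      · rw [← hg.bal ⟨y, hy⟩, ← wsum_congr (p := fun u => G.vert u ≠ x ∧ G.vert u = y) (f := f)
          (fun u => and_iff_right_of_imp fun h => h ▸ hy) (fun _ _ => rfl), ← wsum_subtype]
        exact wsum_congr (fun u => by simp [elim, Subtype.ext_iff]) fun u _ => hfn u
    · intro u
      by_cases hu : G.vert u = x
      · rw [hfx u hu]
        have := hg.val ⟨G.mate u, hp.noloop u hu⟩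
        split_ifs
        · exact this
        · omega
      · rw [hfn ⟨u, hu⟩]
        exact hg.val _

/-- A connected even graph with even valencies has a nowhere-zero flow with values `±1`. -/
theorem exists_isTwoFlow (n : ℕ) : ∀ {S : Type u} {V : Type v} [Fintype S] [Fintype V]
    (G : StubGraph S V), G.pairs < n → G.Conn → (∀ x, Even (G.deg x)) →
      (cnt fun s => G.sgn s = true) % 4 = 0 → ∃ f, G.IsTwoFlow f := by
  classical
  induction n with
  | zero => exact fun G h => absurd h (Nat.not_lt_zero _)
  | succ n ih =>
    intro S V _ _ G hn hG hdeg heven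
    have split_case : ∀ {x : V} {a b c : S}, G.vert a = x → G.vert b = x → G.vert c = x → a ≠ b →
        b ≠ c → a ≠ c → (G.split fun s => s = a ∨ s = b).Conn → ∃ f, G.IsTwoFlow f := by
      intro x a b c ha hb hc hab hbc hac hconn
      have h1 : (G.split fun s => s = a ∨ s = b).pairs < G.pairs :=
        pairs_split_lt (ha.trans hc.symm) (Or.inl rfl) (by
          rintro (h | h)
          exacts [hac h.symm, hbc h.symm])
      obtain ⟨f, hf⟩ := ih _ (by omega) hconn (even_deg_split hdeg ha hb hab) heven
      exact ⟨f, hf.of_split⟩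
    -- Three half-edges at a vertex allow a connected split; otherwise every vertex with half-edges
    -- has valency two and can be suppressed.
    by_cases h3 : ∃ a b c, G.vert b = G.vert a ∧ G.vert c = G.vert a ∧ a ≠ b ∧ b ≠ c ∧ a ≠ c
    · obtain ⟨a, b, c, hb, hc, hab, hbc, hac⟩ := h3
      rcases hG.conn_split_pair hdeg rfl hb hc hab hbc hac with h | h
      · exact split_case rfl hb hc hab hbc hac h
      · exact split_case rfl hc hb hac hbc.symm hab h
    · by_cases hS : ∃ s : S, True
      · obtain ⟨s, -⟩ := hS
        obtain ⟨t, ht, hts⟩ : ∃ t, G.vert t = G.vert s ∧ ¬ t = s := by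
          rw [← cnt_pos]
          have h1 := cnt_add_cnt_not (fun u => G.vert u = G.vert s) (fun u => u = s)
          have h2 : (cnt fun u => G.vert u = G.vert s ∧ u = s) = 1 := by
            rw [← cnt_eq_one s]
            exact cnt_congr fun u => and_iff_right_of_imp fun h => h ▸ rfl
          have h4 : Even (cnt fun u => G.vert u = G.vert s) := hdeg _
          rw [Nat.even_iff] at h4
          omega
        have hall : ∀ u, G.vert u = G.vert s → u = s ∨ u = t := by
          intro u hu
          by_contra hcon
          push Not at hcon
          exact h3 ⟨s, t, u, ht, hu, Ne.symm hts, hcon.2.symm, hcon.1.symm⟩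
        refine exists_isTwoFlow_of_twoValent hG heven rfl ht (Ne.symm hts) hall ?_
        intro hp h1 h2
        have h4 : (elim hp).pairs < G.pairs :=
          pairs_lt (fun a b hab => congrArg Subtype.val hab) (u := s) (fun h => h rfl)
        refine ih _ (by omega) h2 (fun y => ?_) h1
        rw [deg_elim]
        exact hdeg _
      · push Not at hS
        exact ⟨fun _ => 1, fun s => (hS s).elim, fun x => wsum_eq_zero fun s => (hS s).elim,
          fun s => (hS s).elim⟩

/-- A connected odd graph with even valencies has an assignment of values `±1` which is balanced
except at a given vertex, where the excess is `2` or `-2`, as prescribed. -/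
theorem exists_excess_two [Fintype V] (hG : G.Conn) (hdeg : ∀ x, Even (G.deg x))
    (hodd : (cnt fun s => G.sgn s = true) % 4 = 2) (s₀ : S) {c : ℤ} (hc : c = 1 ∨ c = -1) :
    ∃ f : S → ℤ, (∀ s, f (G.mate s) = if G.sgn s then f s else - f s) ∧
      (∀ s, f s = 1 ∨ f s = -1) ∧ (∀ x, x ≠ G.vert s₀ → wsum (fun s => G.vert s = x) f = 0) ∧
      wsum (fun s => G.vert s = G.vert s₀) f = 2 * c := by
  classical
  -- Reversing the sign of the edge of `s₀` makes the graph even, so that it has a 2-flow.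
  let H : StubGraph S V :=
    { vert := G.vert
      mate := G.mate
      sgn := fun s => if s = s₀ ∨ s = G.mate s₀ then !G.sgn s else G.sgn s
      mate_mate := G.mate_mate
      mate_ne := G.mate_ne
      sgn_mate := fun s => by
        have h : (G.mate s = s₀ ∨ G.mate s = G.mate s₀) ↔ (s = s₀ ∨ s = G.mate s₀) := by
          constructor
          · rintro (rfl | h)
            · right; rw [G.mate_mate]
            · left; rw [← G.mate_mate s, h, G.mate_mate]
          · rintro (rfl | rfl)
            · right; rfl
            · left; rw [G.mate_mate]
        simp only [h, G.sgn_mate] }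
  have hH : (cnt fun s => H.sgn s = true) % 4 = 0 := by
    have h1 := cnt_add_cnt_not (fun s => H.sgn s = true) (fun s => s = s₀ ∨ s = G.mate s₀)
    have h2 := cnt_add_cnt_not (fun s => G.sgn s = true) (fun s => s = s₀ ∨ s = G.mate s₀)
    have h3 : (cnt fun s => H.sgn s = true ∧ ¬ (s = s₀ ∨ s = G.mate s₀))
        = cnt fun s => G.sgn s = true ∧ ¬ (s = s₀ ∨ s = G.mate s₀) :=
      cnt_congr fun s => and_congr_left fun h => by simp only [H, if_neg h]
    have h4 := cnt_eq_or_eq (G.mate_ne s₀).symm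
    have e1 : ∀ s, s = s₀ ∨ s = G.mate s₀ → G.sgn s = G.sgn s₀ := by
      rintro s (rfl | rfl)
      exacts [rfl, G.sgn_mate _]
    have e2 : ∀ s, s = s₀ ∨ s = G.mate s₀ → H.sgn s = !G.sgn s₀ := by
      intro s hs
      rw [← e1 s hs]
      simp only [H, if_pos hs]
    by_cases h5 : G.sgn s₀ = true
    · rw [cnt_eq_zero.2 (fun s hs => by rw [e2 s hs.2, h5] at hs; exact absurd hs.1 (by decide))]
        at h1
      rw [cnt_congr (q := fun s => s = s₀ ∨ s = G.mate s₀)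
        (fun s => and_iff_right_of_imp fun h => by rw [e1 s h, h5])] at h2
      omega
    · rw [Bool.not_eq_true] at h5
      have h6 : (cnt fun s => G.sgn s = true ∧ (s = s₀ ∨ s = G.mate s₀)) = 0 :=
        cnt_eq_zero.2 fun s hs => by rw [e1 s hs.2, h5] at hs; exact absurd hs.1 (by decide)
      have h7 : (cnt fun s => H.sgn s = true ∧ (s = s₀ ∨ s = G.mate s₀)) = 2 := by
        rw [← h4]
        exact cnt_congr fun s => and_iff_right_of_imp fun h => by rw [e2 s h, h5]; rfl
      omega
  obtain ⟨f, hf⟩ := exists_isTwoFlow _ H (Nat.lt_succ_self _) hG hdeg hH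
  -- Negating the value on the single half-edge `s₀` restores compatibility with the original
  -- signature and shifts the sum at its vertex by `-2 * f s₀`.
  let g : S → ℤ := fun s => f s + if s = s₀ then - 2 * f s₀ else 0
  have hg0 : g s₀ = - f s₀ := by
    simp only [g, if_true]
    ring
  have hg : ∀ s, s ≠ s₀ → g s = f s := fun s hs => by simp [g, hs]
  have hgmate : ∀ s, g (G.mate s) = if G.sgn s then g s else - g s := by
    intro s
    have h1 : f (G.mate s) = if H.sgn s then f s else - f s := hf.mate s
    by_cases h2 : s = s₀
    · subst h2
      rw [hg _ (G.mate_ne s), hg0, h1]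
      simp only [H, true_or, if_true]
      cases G.sgn s <;> simp
    · by_cases h3 : s = G.mate s₀
      · subst h3
        rw [G.mate_mate] at h1 ⊢
        rw [hg0, hg _ h2, h1]
        simp only [H, or_true, if_true]
        cases G.sgn (G.mate s₀) <;> simp
      · have h4 : G.mate s ≠ s₀ := by
          rintro rfl
          exact h3 (G.mate_mate s).symm
        rw [hg _ h2, hg _ h4, h1]
        simp only [H, h2, h3, or_false, if_false]
  have hgsum : ∀ x, wsum (fun s => G.vert s = x) g = if G.vert s₀ = x then -2 * f s₀ else 0 := by
    intro x
    have h1 : wsum (fun s => G.vert s = x) f = 0 := hf.bal x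
    rw [← wsum_single (fun s => G.vert s = x), wsum_add, h1, zero_add]
  have hgval : ∀ s, g s = 1 ∨ g s = -1 := by
    intro s
    have h1 := hf.val s
    by_cases h2 : s = s₀
    · subst h2
      rw [hg0]
      omega
    · rwa [hg s h2]
  -- The factor is ±1 and turns the excess `-2 * f s₀` into `2 * c`.
  refine ⟨fun s => (- c * f s₀) * g s, ?_, ?_, ?_, ?_⟩
  · intro s
    dsimp only
    rw [hgmate]
    split_ifs <;> ring
  · intro s
    rcases hc with rfl | rfl <;> rcases hf.val s₀ with h | h <;> rcases hgval s with h' | h' <;>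
      simp [h, h']
  · intro x hx
    rw [wsum_mul, hgsum, if_neg (Ne.symm hx), mul_zero]
  · rw [wsum_mul, hgsum, if_pos rfl]
    rcases hf.val s₀ with h | h <;> rw [h] <;> ring

/-- In a graph with a nowhere-zero flow with values `±1` the number of negative edges is even. -/
theorem IsTwoFlow.cnt_sgn [Fintype V] (hf : G.IsTwoFlow f) :
    (cnt fun s => G.sgn s = true) % 4 = 0 := by
  have h1 : wsum (fun _ => True) f = 0 := by
    rw [wsum_fiber G.vert]
    refine Finset.sum_eq_zero fun x _ => ?_
    rw [← hf.bal x]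
    exact wsum_congr (fun s => by simp) fun _ _ => rfl
  -- The sum of all values is zero. Positive edges contribute nothing, as their sum is its own
  -- negative, so the values 2 and -2 contributed by the negative edges cancel.
  have h2 := wsum_add_wsum_not (fun _ => True) (fun s => G.sgn s = true) f
  rw [h1] at h2
  have h3 := wsum_comp_involutive G.mate_mate (fun s => True ∧ ¬ G.sgn s = true) f
  rw [wsum_congr (q := fun s => True ∧ ¬ G.sgn s = true) (g := fun s => - f s)
    (fun s => by rw [G.sgn_mate]) (fun s hs => by rw [hf.mate, if_neg hs.2]), wsum_neg] at h3
  have v4 : ∀ s, f s = 1 ∨ f s = -1 ∨ f s = 2 ∨ f s = -2 := fun s => by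
    have := hf.val s
    tauto
  rw [wsum_eq_cnt (p := fun s => True ∧ G.sgn s = true) fun s _ => v4 s] at h2
  have h4 := cnt_eq_cnt_add (p := fun s => True ∧ G.sgn s = true) (fun s _ => v4 s)
  have h5 : (cnt fun s => (True ∧ G.sgn s = true) ∧ f s = 2) = 0 :=
    cnt_eq_zero.2 fun s hs => by have := hf.val s; omega
  have h6 : (cnt fun s => (True ∧ G.sgn s = true) ∧ f s = -2) = 0 :=
    cnt_eq_zero.2 fun s hs => by have := hf.val s; omega
  have h7 : Even (cnt fun s => (True ∧ G.sgn s = true) ∧ f s = 1) := by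
    refine even_cnt_of_involution G.mate ?_ (fun s _ => G.mate_mate s) (fun s _ => G.mate_ne s)
    rintro s ⟨⟨-, h⟩, h'⟩
    exact ⟨⟨trivial, by rw [G.sgn_mate, h]⟩, by rw [hf.mate, if_pos h, h']⟩
  rw [Nat.even_iff] at h7
  simp only [true_and] at h2 h3 h4 h5 h6 h7
  omega

end StubGraph

/-! ### Passage between `Graph` and half-edge graphs -/

namespace Graph

variable {α β : Type*} {G H : Graph α β} {σ : β → ℤˣ} {ends : β → Bool → α}

/-- `ends e false` and `ends e true` are the ends of the edge `e`. -/
def IsEnds (G : Graph α β) (ends : β → Bool → α) : Prop :=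
  ∀ e ∈ G.edgeSet, G.IsLink e (ends e false) (ends e true)

theorem exists_isEnds (h : G.vertexSet.Nonempty) : ∃ ends, G.IsEnds ends := by
  classical
  obtain ⟨x₀, -⟩ := h
  have key : ∀ e, ∃ p : α × α, e ∈ G.edgeSet → G.IsLink e p.1 p.2 := by
    intro e
    by_cases he : e ∈ G.edgeSet
    · obtain ⟨x, y, hxy⟩ := G.exists_isLink_of_mem_edgeSet he
      exact ⟨(x, y), fun _ => hxy⟩
    · exact ⟨(x₀, x₀), fun h => (he h).elim⟩
  choose p hp using key
  exact ⟨fun e b => if b then (p e).2 else (p e).1, fun e he => by simpa using hp e he⟩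

namespace IsEnds

theorem mono (h : G.IsEnds ends) (hH : H ≤ G) : H.IsEnds ends := fun e he =>
  (hH.isLink_iff he).2 (h e (hH.edgeSet_mono he))

theorem isLink (h : G.IsEnds ends) {e : β} (he : e ∈ G.edgeSet) (b : Bool) :
    G.IsLink e (ends e b) (ends e !b) := by
  cases b
  exacts [h e he, (h e he).symm]

theorem mem (h : G.IsEnds ends) {e : β} (he : e ∈ G.edgeSet) (b : Bool) :
    ends e b ∈ G.vertexSet := (h.isLink he b).left_mem

theorem eq_of_isLink (h : G.IsEnds ends) {e : β} {x y : α} (hxy : G.IsLink e x y) :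
    ∃ b, ends e b = x ∧ ends e (!b) = y := by
  rcases (h e hxy.edge_mem).eq_and_eq_or_eq_and_eq hxy with h | h
  · exact ⟨false, h⟩
  · exact ⟨true, h.2, h.1⟩

end IsEnds

/-- The half-edges of a graph with a signature. -/
def stubs (h : G.IsEnds ends) (σ : β → ℤˣ) :
    StubGraph {s : β × Bool // s.1 ∈ G.edgeSet} {x // x ∈ G.vertexSet} where
  vert s := ⟨ends s.1.1 s.1.2, h.mem s.2 _⟩
  mate s := ⟨(s.1.1, !s.1.2), s.2⟩
  sgn s := decide (σ s.1.1 = -1)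
  mate_mate s := Subtype.ext (by simp)
  mate_ne s h := by simpa using congrArg (fun t => t.1.2) h
  sgn_mate s := rfl

theorem stubs_vert_eq (h : G.IsEnds ends) {s : {s : β × Bool // s.1 ∈ G.edgeSet}}
    {x : {x // x ∈ G.vertexSet}} : (stubs h σ).vert s = x ↔ ends s.1.1 s.1.2 = x.1 :=
  Subtype.ext_iff

theorem finite_stubs (h : G.edgeSet.Finite) : Finite {s : β × Bool // s.1 ∈ G.edgeSet} := by
  have h1 : {s : β × Bool | s.1 ∈ G.edgeSet}.Finite :=
    (h.prod (Set.finite_univ (α := Bool))).subset fun s hs => ⟨hs, trivial⟩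
  exact h1.to_subtype

/-- Inclusion-exclusion: the incident edges are the union, and the loops the intersection, of the
edges with first end and those with second end at `x`. -/
theorem valency_eq (h : G.IsEnds ends) (hfin : G.edgeSet.Finite) (x : α) :
    G.valency x = {s : β × Bool | s.1 ∈ G.edgeSet ∧ ends s.1 s.2 = x}.ncard := by
  set A : Bool → Set β := fun b => {e | e ∈ G.edgeSet ∧ ends e b = x} with hA
  have hAfin : ∀ b, (A b).Finite := fun b => hfin.subset fun e he => he.1
  have h1 : G.incidenceSet x = A false ∪ A true := by
    ext e
    simp only [mem_incidenceSet, hA, Set.mem_union, Set.mem_ofPred_eq]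
    constructor
    · rintro ⟨y, hy⟩
      obtain ⟨b, hb, -⟩ := h.eq_of_isLink hy
      cases b
      exacts [Or.inl ⟨hy.edge_mem, hb⟩, Or.inr ⟨hy.edge_mem, hb⟩]
    · rintro (⟨he, rfl⟩ | ⟨he, rfl⟩)
      exacts [⟨_, h.isLink he false⟩, ⟨_, h.isLink he true⟩]
  have h2 : G.loopSet x = A false ∩ A true := by
    ext e
    simp only [mem_loopSet, hA, Set.mem_inter_iff, Set.mem_ofPred_eq]
    constructor
    · intro hx
      obtain ⟨b, hb, hb'⟩ := h.eq_of_isLink hx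
      cases b
      exacts [⟨⟨hx.edge_mem, hb⟩, hx.edge_mem, hb'⟩, ⟨⟨hx.edge_mem, hb'⟩, hx.edge_mem, hb⟩]
    · rintro ⟨⟨he, h1⟩, -, h2⟩
      have := h e he
      rwa [h1, h2] at this
  have h3 : {s : β × Bool | s.1 ∈ G.edgeSet ∧ ends s.1 s.2 = x}
      = (fun e => (e, false)) '' A false ∪ (fun e => (e, true)) '' A true := by
    ext ⟨e, b⟩
    cases b <;> simp [hA]
  have inj : ∀ b : Bool, Function.Injective fun e : β => (e, b) := fun b e e' h =>
    (Prod.ext_iff.1 h).1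
  rw [valency, h1, h2, Set.ncard_union_add_ncard_inter _ _ (hAfin _) (hAfin _), h3,
    Set.ncard_union_eq _ ((hAfin _).image _) ((hAfin _).image _),
    Set.ncard_image_of_injective _ (inj _), Set.ncard_image_of_injective _ (inj _)]
  rw [Set.disjoint_left]
  rintro _ ⟨e, -, rfl⟩ ⟨e', -, h⟩
  exact absurd (Prod.ext_iff.1 h).2 (by simp)

theorem ncard_negStubs (G : Graph α β) (σ : β → ℤˣ) :
    {s : β × Bool | s.1 ∈ G.edgeSet ∧ σ s.1 = -1}.ncard = 2 * (G.negEdges σ).ncard := by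
  have h : {s : β × Bool | s.1 ∈ G.edgeSet ∧ σ s.1 = -1} = G.negEdges σ ×ˢ Set.univ := by
    ext s
    simp [negEdges]
  rw [h, Set.ncard_prod, Set.ncard_univ, Nat.card_eq_fintype_card, Fintype.card_bool, mul_comm]

section

variable [Fintype {s : β × Bool // s.1 ∈ G.edgeSet}]

theorem cnt_stubs (p : β × Bool → Prop) :
    (cnt fun s : {s : β × Bool // s.1 ∈ G.edgeSet} => p s.1)
      = {s : β × Bool | s.1 ∈ G.edgeSet ∧ p s}.ncard := by
  classical
  rw [cnt_eq_card, ← Finset.card_map (Function.Embedding.subtype _), ← Set.ncard_coe_finset]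
  congr 1
  ext s
  simp only [Set.mem_ofPred_eq, Finset.coe_map, Set.mem_image, Finset.mem_coe, Finset.mem_filter,
    Finset.mem_univ, true_and, Function.Embedding.subtype_apply]
  constructor
  · rintro ⟨t, ht, rfl⟩
    exact ⟨t.2, ht⟩
  · exact fun ⟨hs, hp⟩ => ⟨⟨s, hs⟩, hp, rfl⟩

theorem wsum_stubs (p : β × Bool → Prop) (g : β × Bool → ℤ) :
    wsum (fun s : {s : β × Bool // s.1 ∈ G.edgeSet} => p s.1) (fun s => g s.1)
      = ∑ᶠ s ∈ {s : β × Bool | s.1 ∈ G.edgeSet ∧ p s}, g s := by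
  classical
  have h : {s : β × Bool | s.1 ∈ G.edgeSet ∧ p s}
      = ↑((Finset.univ.filter fun s : {s : β × Bool // s.1 ∈ G.edgeSet} => p s.1).map
        (Function.Embedding.subtype _)) := by
    ext s
    simp only [Set.mem_ofPred_eq, Finset.coe_map, Set.mem_image, Finset.mem_coe, Finset.mem_filter,
      Finset.mem_univ, true_and, Function.Embedding.subtype_apply]
    constructor
    · exact fun ⟨hs, hp⟩ => ⟨⟨s, hs⟩, hp, rfl⟩
    · rintro ⟨t, ht, rfl⟩
      exact ⟨t.2, ht⟩
  rw [h, finsum_mem_coe_finset, Finset.sum_map, wsum_eq_sum]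
  rfl

theorem cnt_stubs_of_le (hH : H ≤ G) (p : β × Bool → Prop) :
    (cnt fun s : {s : β × Bool // s.1 ∈ G.edgeSet} => s.1.1 ∈ H.edgeSet ∧ p s.1)
      = {s : β × Bool | s.1 ∈ H.edgeSet ∧ p s}.ncard := by
  rw [cnt_stubs fun s => s.1 ∈ H.edgeSet ∧ p s]
  congr 1
  ext s
  exact and_iff_right_of_imp fun h => hH.edgeSet_mono h.1

theorem wsum_stubs_of_le (hH : H ≤ G) (p : β × Bool → Prop) (g : β × Bool → ℤ) :
    wsum (fun s : {s : β × Bool // s.1 ∈ G.edgeSet} => s.1.1 ∈ H.edgeSet ∧ p s.1)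
      (fun s => g s.1) = ∑ᶠ s ∈ {s : β × Bool | s.1 ∈ H.edgeSet ∧ p s}, g s := by
  have h : {s : β × Bool | s.1 ∈ G.edgeSet ∧ s.1 ∈ H.edgeSet ∧ p s}
      = {s : β × Bool | s.1 ∈ H.edgeSet ∧ p s} := by
    ext s
    exact and_iff_right_of_imp fun h => hH.edgeSet_mono h.1
  rw [wsum_stubs fun s => s.1 ∈ H.edgeSet ∧ p s, h]

theorem cnt_stubs_sgn (h : G.IsEnds ends) (σ : β → ℤˣ) :
    (cnt fun s => (stubs h σ).sgn s = true) = 2 * (G.negEdges σ).ncard := by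
  rw [← ncard_negStubs, ← cnt_stubs]
  exact cnt_congr fun s => by simp [stubs]

theorem deg_stubs (h : G.IsEnds ends) (σ : β → ℤˣ) (hfin : G.edgeSet.Finite)
    (x : {x // x ∈ G.vertexSet}) : (stubs h σ).deg x = G.valency x.1 := by
  rw [valency_eq h hfin, ← cnt_stubs fun s => ends s.1 s.2 = x.1]
  exact cnt_congr fun s => stubs_vert_eq h

theorem IsEulerian.even_deg_stubs (hG : G.IsEulerian) (h : G.IsEnds ends) (σ : β → ℤˣ)
    (x : {x // x ∈ G.vertexSet}) : Even ((stubs h σ).deg x) := by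
  rw [deg_stubs h σ hG.finite_edgeSet]
  exact hG.even_valency _ x.2

end

theorem IsConnected.conn_stubs (hG : G.IsConnected) (h : G.IsEnds ends) (σ : β → ℤˣ) :
    (stubs h σ).Conn := by
  intro Q hv hm s t hs
  have key : ∀ y, Relation.ReflTransGen G.Adj (ends s.1.1 s.1.2) y →
      ∀ u : {s : β × Bool // s.1 ∈ G.edgeSet}, ends u.1.1 u.1.2 = y → Q u := by
    intro y hy
    induction hy with
    | refl => exact fun u hu => hv s u (Subtype.ext hu.symm) hs
    | @tail y z _ hyz ih =>
      intro u hu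
      obtain ⟨e, he⟩ := hyz
      obtain ⟨b, hb, hb'⟩ := h.eq_of_isLink he
      have h1 := hm _ (ih ⟨(e, b), he.edge_mem⟩ hb)
      exact hv ⟨(e, !b), he.edge_mem⟩ u (Subtype.ext (hb'.trans hu.symm)) h1
  exact key _ (hG.2 _ (h.mem s.2 _) _ (h.mem t.2 _)) t rfl

/-! ### Flows on half-edges -/

theorem Orientation.isEnds (O : G.Orientation σ) : G.IsEnds O.ends := O.isLink

section

variable [Fintype {s : β × Bool // s.1 ∈ G.edgeSet}]

/-- The orientation is absorbed into signs on half-edges: plus for outgoing, minus for incoming. -/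
theorem isFlow_iff (O : G.Orientation σ) (ξ : β → ℤ) :
    O.IsFlow ξ ↔ ∀ x, wsum (fun s => (stubs O.isEnds σ).vert s = x)
      (fun s => if O.out s.1.1 s.1.2 = true then ξ s.1.1 else - ξ s.1.1) = 0 := by
  have key : ∀ x : {x // x ∈ G.vertexSet},
      wsum (fun s => (stubs O.isEnds σ).vert s = x)
        (fun s => if O.out s.1.1 s.1.2 = true then ξ s.1.1 else - ξ s.1.1)
      = (∑ᶠ s ∈ O.outHalfEdges x.1, ξ s.1) - ∑ᶠ s ∈ O.inHalfEdges x.1, ξ s.1 := by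
    intro x
    have h1 := wsum_stubs (G := G) (fun s => O.ends s.1 s.2 = x.1 ∧ O.out s.1 s.2 = true)
      (fun s => ξ s.1)
    have h2 := wsum_stubs (G := G) (fun s => O.ends s.1 s.2 = x.1 ∧ O.out s.1 s.2 = false)
      (fun s => ξ s.1)
    rw [← wsum_add_wsum_not _ fun s => O.out s.1.1 s.1.2 = true]
    change _ = (∑ᶠ s ∈ {s : β × Bool | s.1 ∈ G.edgeSet ∧ O.ends s.1 s.2 = x.1 ∧
      O.out s.1 s.2 = true}, ξ s.1) - ∑ᶠ s ∈ {s : β × Bool | s.1 ∈ G.edgeSet ∧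
      O.ends s.1 s.2 = x.1 ∧ O.out s.1 s.2 = false}, ξ s.1
    rw [← h1, ← h2, sub_eq_add_neg, ← wsum_neg]
    congr 1
    · exact wsum_congr (fun s => by rw [stubs_vert_eq]) fun s hs => by simp [hs.2]
    · exact wsum_congr (fun s => by rw [stubs_vert_eq, Bool.not_eq_true])
        fun s hs => by simp [hs.2]
  constructor
  · intro h x
    rw [key]
    exact h x.1 x.2
  · intro h x hx
    rw [← key ⟨x, hx⟩, h]

theorem HasNowhereZeroFlow.exists_stubs {k : ℕ} (h : G.HasNowhereZeroFlow σ k) :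
    ∃ (ends : β → Bool → α) (h : G.IsEnds ends) (f : {s : β × Bool // s.1 ∈ G.edgeSet} → ℤ),
      (∀ s, f ((stubs h σ).mate s) = if (stubs h σ).sgn s then f s else - f s) ∧
      (∀ x, wsum (fun s => (stubs h σ).vert s = x) f = 0) ∧ ∀ s, f s ≠ 0 ∧ |f s| < (k : ℤ) := by
  obtain ⟨O, ξ, hO, hξ⟩ := h
  refine ⟨O.ends, O.isEnds, _, ?_, (isFlow_iff O ξ).1 hO, ?_⟩
  · rintro ⟨⟨e, b⟩, he⟩
    have h1 := O.compatible e he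
    by_cases h2 : σ e = -1
    · have h3 := h1.2 h2
      cases b <;> simp [stubs, h2, h3]
    · have h3 : O.out e false ≠ O.out e true := fun h => h2 (h1.1 h)
      revert h3
      cases b <;> cases hf : O.out e false <;> cases ht : O.out e true <;> simp [stubs, h2, hf, ht]
  · intro s
    have h1 := hξ s.1.1 s.2
    split_ifs
    · exact h1
    · rwa [abs_neg, neg_ne_zero]

/-- Half-edges of positive value are directed out and the others in; the flow value of an edge is
the common absolute value of its halves. -/
theorem hasNowhereZeroFlow_of_stubs {k : ℕ} (h : G.IsEnds ends)
    {f : {s : β × Bool // s.1 ∈ G.edgeSet} → ℤ}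
    (hmate : ∀ s, f ((stubs h σ).mate s) = if (stubs h σ).sgn s then f s else - f s)
    (hbal : ∀ x, wsum (fun s => (stubs h σ).vert s = x) f = 0)
    (hval : ∀ s, f s ≠ 0 ∧ |f s| < (k : ℤ)) : G.HasNowhereZeroFlow σ k := by
  classical
  let F : β → Bool → ℤ := fun e b => if he : e ∈ G.edgeSet then f ⟨(e, b), he⟩ else 0
  have hF : ∀ s : {s : β × Bool // s.1 ∈ G.edgeSet}, F s.1.1 s.1.2 = f s := fun s => by
    simp [F, s.2]
  have hFm : ∀ e ∈ G.edgeSet, F e true = if σ e = -1 then F e false else - F e false := by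
    intro e he
    have h1 := hmate ⟨(e, false), he⟩
    rw [← hF, ← hF] at h1
    simpa [stubs] using h1
  have hF0 : ∀ e ∈ G.edgeSet, F e false ≠ 0 := fun e he => by
    rw [hF ⟨(e, false), he⟩]
    exact (hval _).1
  let O : G.Orientation σ :=
    { ends := ends
      out := fun e b => decide (0 < F e b)
      isLink := h
      compatible := by
        intro e he
        have h1 := hFm e he
        have h2 := hF0 e he
        rw [decide_eq_decide]
        split_ifs at h1 with h3
        · simp [h1, h3]
        · rw [h1]
          constructor
          · intro h4
            omega
          · exact fun h4 => (h3 h4).elim }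
  refine ⟨O, fun e => |F e false|, ?_, fun e he => ?_⟩
  · rw [isFlow_iff]
    intro x
    rw [← hbal x]
    refine wsum_congr (fun s => Iff.rfl) fun s _ => ?_
    rw [← hF s]
    have h1 := hFm s.1.1 s.2
    have h2 : |F s.1.1 false| = |F s.1.1 s.1.2| := by
      cases s.1.2
      · rfl
      · rw [h1]
        split_ifs
        exacts [rfl, (abs_neg _).symm]
    simp only [O, decide_eq_true_eq, h2]
    split_ifs with h3
    · exact abs_of_pos h3
    · rw [abs_of_nonpos (not_lt.1 h3), neg_neg]
  · have h1 := hval ⟨(e, false), he⟩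
    rw [← hF] at h1
    exact ⟨abs_ne_zero.2 h1.1, by rw [abs_abs]; exact h1.2⟩

/-! ### Colourings and triply odd graphs -/

theorem isTriplyOdd_of_good (hG : G.IsEulerian) (h : G.IsEnds ends) (hgood : (stubs h σ).Good) :
    G.IsTriplyOdd σ := by
  classical
  obtain ⟨τ, v, hτ⟩ := hgood
  let H : Fin 3 → Graph α β := fun i =>
    { vertexSet := {x | ∃ s : {s : β × Bool // s.1 ∈ G.edgeSet}, τ s = i ∧ ends s.1.1 s.1.2 = x}
      IsLink := fun e x y => G.IsLink e x y ∧ ∃ he : e ∈ G.edgeSet, τ ⟨(e, false), he⟩ = i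
      edgeSet := {e | ∃ he : e ∈ G.edgeSet, τ ⟨(e, false), he⟩ = i}
      isLink_symm := fun e _ => ⟨fun x y h => ⟨h.1.symm, h.2⟩⟩
      eq_or_eq_of_isLink_of_isLink := fun e x y z w h h' => h.1.left_eq_or_eq h'.1
      edge_mem_iff_exists_isLink := fun e => by
        constructor
        · rintro ⟨he, hi⟩
          obtain ⟨x, y, hxy⟩ := G.exists_isLink_of_mem_edgeSet he
          exact ⟨x, y, hxy, he, hi⟩
        · rintro ⟨x, y, -, he⟩
          exact he
      left_mem_of_isLink := by
        rintro e x y ⟨hxy, he, hi⟩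
        obtain ⟨b, hb, -⟩ := h.eq_of_isLink hxy
        refine ⟨⟨(e, b), he⟩, ?_, hb⟩
        cases b
        · exact hi
        · rw [← hi]
          exact hτ.mate ⟨(e, false), he⟩ }
  have hmem : ∀ s : {s : β × Bool // s.1 ∈ G.edgeSet}, ∀ i, s.1.1 ∈ (H i).edgeSet ↔ τ s = i := by
    rintro ⟨⟨e, b⟩, he⟩ i
    have h1 : τ ⟨(e, b), he⟩ = τ ⟨(e, false), he⟩ := by
      cases b
      · rfl
      · exact hτ.mate ⟨(e, false), he⟩
    rw [h1]
    exact ⟨fun h => h.2, fun h => ⟨he, h⟩⟩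
  have hle : ∀ i, H i ≤ G := fun i => ⟨fun x ⟨s, _, hs⟩ => hs ▸ h.mem s.2 _, fun e x y h => h.1⟩
  have hv : ∀ i, v.1 ∈ (H i).vertexSet := by
    intro i
    by_contra hcon
    -- If colour `i` were absent at `v`, its absence would spread along walks inside colour classes
    -- to all half-edges, making class `i` empty and hence not odd.
    have h1 := hτ.reaches (fun s => τ s ≠ i) (fun s hs hi => hcon ⟨s, hi, (stubs_vert_eq h).1 hs⟩)
      (fun s hs => by rwa [hτ.mate]) (fun s t _ hst hs => by rwa [← hst])
    have h2 := hτ.odd i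
    rw [cnt_eq_zero.2 fun s hs => h1 s hs.2] at h2
    omega
  have hreach : ∀ i, ∀ x ∈ (H i).vertexSet, Relation.ReflTransGen (H i).Adj v.1 x := by
    have h1 := hτ.reaches (fun s => Relation.ReflTransGen (H (τ s)).Adj v.1 (ends s.1.1 s.1.2))
      ?_ ?_ ?_
    · rintro _ _ ⟨s, rfl, rfl⟩
      exact h1 s
    · intro s hs
      rw [(stubs_vert_eq h).1 hs]
    · intro s hs
      rw [hτ.mate]
      exact hs.tail ⟨s.1.1, h.isLink s.2 _, (hmem s _).2 rfl⟩
    · intro s t hst hτst hs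
      have h2 : ends s.1.1 s.1.2 = ends t.1.1 t.1.2 := congrArg Subtype.val hst
      rwa [← h2, ← hτst]
  have heuler : ∀ i, (H i).IsEulerian := by
    intro i
    have hfin : (H i).edgeSet.Finite := hG.finite_edgeSet.subset (hle i).edgeSet_mono
    refine ⟨hG.finite_vertexSet.subset (hle i).vertexSet_mono, hfin, ⟨⟨v, hv i⟩, ?_⟩, ?_⟩
    · intro x hx y hy
      refine Relation.ReflTransGen.trans ?_ (hreach i y hy)
      exact Std.Symm.symm (r := Relation.ReflTransGen (H i).Adj) _ _ (hreach i x hx)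
    · intro x hx
      rw [valency_eq (h.mono (hle i)) hfin, ← cnt_stubs_of_le (hle i) fun s => ends s.1 s.2 = x]
      have h1 := hτ.even ⟨x, (hle i).vertexSet_mono hx⟩ i
      rwa [cnt_congr (q := fun s => s.1.1 ∈ (H i).edgeSet ∧ ends s.1.1 s.1.2 = x)] at h1
      intro s
      rw [hmem, stubs_vert_eq, and_comm]
  refine ⟨H, hle, fun i => ⟨heuler i, ?_⟩, ?_, ?_, v, hv⟩
  · have h1 := hτ.odd i
    rw [cnt_congr (q := fun s => s.1.1 ∈ (H i).edgeSet ∧ σ s.1.1 = -1),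
      cnt_stubs_of_le (hle i) fun s => σ s.1 = -1, ncard_negStubs] at h1
    · rw [Nat.odd_iff]
      omega
    · intro s
      rw [hmem, and_comm]
      simp [stubs]
  · intro i j hij
    rw [Set.disjoint_left]
    rintro e ⟨he, hi⟩ ⟨_, hj⟩
    exact hij (hi.symm.trans hj)
  · ext e
    simp only [Set.mem_iUnion]
    constructor
    · rintro ⟨i, he, -⟩
      exact he
    · exact fun he => ⟨_, (hmem ⟨(e, false), he⟩ _).2 rfl⟩

end

theorem IsConnected.exists_edge_of_mem (hG : G.IsConnected) (h : G.IsEnds ends)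
    (hne : G.edgeSet.Nonempty) {x : α} (hx : x ∈ G.vertexSet) :
    ∃ s : {s : β × Bool // s.1 ∈ G.edgeSet}, ends s.1.1 s.1.2 = x := by
  obtain ⟨e, he⟩ := hne
  have h1 := hG.2 x hx _ (h.mem he false)
  rcases Relation.ReflTransGen.cases_head h1 with h2 | ⟨y, ⟨e', he'⟩, -⟩
  · exact ⟨⟨(e, false), he⟩, h2.symm⟩
  · obtain ⟨b, hb, -⟩ := h.eq_of_isLink he'
    exact ⟨⟨(e', b), he'.edge_mem⟩, hb⟩

open Classical in
/-- An odd eulerian graph has an assignment of values `±1` to its half-edges which is balanced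
except at a given vertex, where it has excess `±2`. -/
theorem IsOddEulerian.exists_excess_two (hH : H.IsOddEulerian σ) (h : H.IsEnds ends) {v : α}
    (hv : v ∈ H.vertexSet) {c : ℤ} (hc : c = 1 ∨ c = -1) : ∃ g : β × Bool → ℤ,
      (∀ e ∈ H.edgeSet, ∀ b, g (e, !b) = if σ e = -1 then g (e, b) else - g (e, b)) ∧
      (∀ e ∈ H.edgeSet, ∀ b, g (e, b) = 1 ∨ g (e, b) = -1) ∧
      ∀ x, x ∈ H.vertexSet → ∑ᶠ s ∈ {s : β × Bool | s.1 ∈ H.edgeSet ∧ ends s.1 s.2 = x}, g s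
        = if x = v then 2 * c else 0 := by
  classical
  have := finite_stubs hH.1.finite_edgeSet
  have := hH.1.finite_vertexSet.to_subtype
  let : Fintype {s : β × Bool // s.1 ∈ H.edgeSet} := Fintype.ofFinite _
  let : Fintype {x // x ∈ H.vertexSet} := Fintype.ofFinite _
  have hne : H.edgeSet.Nonempty := by
    obtain ⟨e, he⟩ := Set.nonempty_of_ncard_ne_zero
      (fun h0 => by have := hH.2; rw [h0] at this; exact absurd this (by decide) :
        (H.negEdges σ).ncard ≠ 0)
    exact ⟨e, he.1⟩
  obtain ⟨s₀, hs₀⟩ := hH.1.isConnected.exists_edge_of_mem h hne hv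
  have hodd : (cnt fun s => (stubs h σ).sgn s = true) % 4 = 2 := by
    have := Nat.odd_iff.1 hH.2
    rw [cnt_stubs_sgn]
    omega
  obtain ⟨f, hmate, hval, hbal, hbal₀⟩ := StubGraph.exists_excess_two
    (hH.1.isConnected.conn_stubs h σ) (hH.1.even_deg_stubs h σ) hodd s₀ hc
  let g : β × Bool → ℤ := fun s => if hs : s.1 ∈ H.edgeSet then f ⟨s, hs⟩ else 0
  have hg : ∀ s : {s : β × Bool // s.1 ∈ H.edgeSet}, g s.1 = f s := fun s => by simp [g, s.2]
  refine ⟨g, ?_, ?_, ?_⟩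
  · intro e he b
    rw [hg ⟨(e, b), he⟩, hg ⟨(e, !b), he⟩]
    simpa [stubs] using hmate ⟨(e, b), he⟩
  · intro e he b
    rw [hg ⟨(e, b), he⟩]
    exact hval _
  · intro x hx
    rw [← wsum_stubs fun s => ends s.1 s.2 = x, wsum_congr (q := fun s => (stubs h σ).vert s = ⟨x, hx⟩)
      (g := f) (fun s => (stubs_vert_eq h).symm) fun s _ => hg s]
    by_cases hxv : x = v
    · subst hxv
      rw [if_pos rfl, ← hbal₀]
      exact wsum_congr (fun s => by
        rw [stubs_vert_eq, stubs_vert_eq]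
        change _ ↔ _ = ends s₀.1.1 s₀.1.2
        rw [hs₀]) fun _ _ => rfl
    · rw [if_neg hxv]
      refine hbal _ fun h1 => hxv ?_
      rw [← hs₀]
      exact congrArg Subtype.val h1

theorem IsTriplyOdd.exists_colour {F : Fin 3 → Graph α β}
    (hU : (⋃ i, (F i).edgeSet) = G.edgeSet)
    (hdisj : Pairwise fun i j => Disjoint (F i).edgeSet (F j).edgeSet) :
    ∃ τ : β → Fin 3, ∀ e ∈ G.edgeSet, ∀ i, τ e = i ↔ e ∈ (F i).edgeSet := by
  have key : ∀ e, ∃ i, e ∈ G.edgeSet → e ∈ (F i).edgeSet := by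
    intro e
    by_cases he : e ∈ G.edgeSet
    · obtain ⟨i, hi⟩ := Set.mem_iUnion.1 (hU ▸ he)
      exact ⟨i, fun _ => hi⟩
    · exact ⟨0, fun h => (he h).elim⟩
  choose τ hτ using key
  refine ⟨τ, fun e he i => ⟨fun h => h ▸ hτ e he, fun hi => ?_⟩⟩
  by_contra hne
  exact Set.disjoint_left.1 (hdisj hne) (hτ e he) hi

/-- A triply odd graph has a nowhere-zero `3`-flow. -/
theorem IsTriplyOdd.hasNowhereZeroFlow (hG : G.IsEulerian) (h : G.IsTriplyOdd σ) :
    G.HasNowhereZeroFlow σ 3 := by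
  classical
  obtain ⟨F, hle, hodd, hdisj, hU, v, hv⟩ := h
  obtain ⟨ends, hends⟩ := exists_isEnds hG.isConnected.1
  have := finite_stubs hG.finite_edgeSet
  let : Fintype {s : β × Bool // s.1 ∈ G.edgeSet} := Fintype.ofFinite _
  obtain ⟨τ, hτ⟩ := IsTriplyOdd.exists_colour hU hdisj
  -- The signs `c` and multipliers `a` are chosen so that the excesses at the common vertex, 2, 2
  -- and 2 · (-2), sum to zero.
  let c : Fin 3 → ℤ := ![1, 1, -1]
  let a : Fin 3 → ℤ := ![1, 1, 2]
  have hc : ∀ i, c i = 1 ∨ c i = -1 := by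
    intro i
    fin_cases i
    exacts [Or.inl rfl, Or.inl rfl, Or.inr rfl]
  have ha : ∀ i, a i = 1 ∨ a i = 2 := by
    intro i
    fin_cases i
    exacts [Or.inl rfl, Or.inl rfl, Or.inr rfl]
  have hex := fun i => (hodd i).exists_excess_two (hends.mono (hle i)) (hv i) (hc i)
  choose g hgm hgv hgb using hex
  have hsum : ∀ i x, ∑ᶠ s ∈ {s : β × Bool | s.1 ∈ (F i).edgeSet ∧ ends s.1 s.2 = x}, g i s
      = if x = v then 2 * c i else 0 := by
    intro i x
    by_cases hx : x ∈ (F i).vertexSet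
    · exact hgb i x hx
    · rw [if_neg]
      · have h1 : {s : β × Bool | s.1 ∈ (F i).edgeSet ∧ ends s.1 s.2 = x} = ∅ := by
          rw [Set.eq_empty_iff_forall_notMem]
          rintro s ⟨hs, rfl⟩
          exact hx ((hends.mono (hle i)).mem hs _)
        rw [h1, finsum_mem_empty]
      · rintro rfl
        exact hx (hv i)
  refine hasNowhereZeroFlow_of_stubs hends
    (f := fun s => a (τ s.1.1) * g (τ s.1.1) s.1) ?_ ?_ ?_
  · rintro ⟨⟨e, b⟩, he⟩
    have h1 := hgm (τ e) e ((hτ e he _).1 rfl) b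
    simp only [stubs, decide_eq_true_eq]
    rw [h1]
    split_ifs <;> ring
  · intro x
    rw [wsum_fiber fun s => τ s.1.1]
    have h1 : ∀ i, wsum (fun s => τ s.1.1 = i ∧ (stubs hends σ).vert s = x)
        (fun s => a (τ s.1.1) * g (τ s.1.1) s.1) = a i * if x.1 = v then 2 * c i else 0 := by
      intro i
      rw [← hsum i x.1, ← wsum_stubs_of_le (hle i) fun s => ends s.1 s.2 = x.1, ← wsum_mul]
      refine wsum_congr (fun s => ?_) fun s hs => ?_
      · rw [hτ _ s.2, stubs_vert_eq]
      · rw [(hτ _ s.2 i).2 hs.1]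
    rw [Finset.sum_congr rfl fun i _ => h1 i, Fin.sum_univ_three]
    split_ifs <;> simp [a, c]
  · rintro ⟨⟨e, b⟩, he⟩
    have h1 := hgv (τ e) e ((hτ e he _).1 rfl) b
    dsimp only
    rcases ha (τ e) with h2 | h2 <;> rcases h1 with h1 | h1 <;> rw [h1, h2] <;> norm_num

theorem IsTriplyOdd.odd_negEdges (hG : G.IsEulerian) (h : G.IsTriplyOdd σ) :
    Odd (G.negEdges σ).ncard := by
  classical
  obtain ⟨F, hle, hodd, hdisj, hU, -⟩ := h
  have := finite_stubs hG.finite_edgeSet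
  let : Fintype {s : β × Bool // s.1 ∈ G.edgeSet} := Fintype.ofFinite _
  obtain ⟨τ, hτ⟩ := IsTriplyOdd.exists_colour hU hdisj
  have h1 := ncard_negStubs G σ
  rw [← cnt_stubs, cnt_fiber fun s => τ s.1.1, Fin.sum_univ_three] at h1
  have h2 : ∀ i, (cnt fun s : {s : β × Bool // s.1 ∈ G.edgeSet} => τ s.1.1 = i ∧ σ s.1.1 = -1)
      = 2 * ((F i).negEdges σ).ncard := by
    intro i
    rw [← ncard_negStubs, ← cnt_stubs_of_le (hle i)]
    exact cnt_congr fun s => by rw [hτ _ s.2]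
  rw [h2, h2, h2] at h1
  have o0 := Nat.odd_iff.1 (hodd 0).2
  have o1 := Nat.odd_iff.1 (hodd 1).2
  have o2 := Nat.odd_iff.1 (hodd 2).2
  rw [Nat.odd_iff]
  omega

/-- Below 3 the only possible values are ±1. -/
theorem HasNowhereZeroFlow.even_negEdges (hG : G.IsEulerian) {k : ℕ} (hk : k < 3)
    (h : G.HasNowhereZeroFlow σ k) : Even (G.negEdges σ).ncard := by
  have := finite_stubs hG.finite_edgeSet
  have := hG.finite_vertexSet.to_subtype
  let : Fintype {s : β × Bool // s.1 ∈ G.edgeSet} := Fintype.ofFinite _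
  let : Fintype {x // x ∈ G.vertexSet} := Fintype.ofFinite _
  obtain ⟨ends, hends, f, hmate, hbal, hval⟩ := h.exists_stubs
  have h1 : (stubs hends σ).IsTwoFlow f := by
    refine ⟨hmate, hbal, fun s => ?_⟩
    obtain ⟨h1, h2⟩ := hval s
    rw [abs_lt] at h2
    omega
  have h2 := h1.cnt_sgn
  rw [cnt_stubs_sgn] at h2
  rw [Nat.even_iff]
  omega

theorem hasNowhereZeroFlow_two (hG : G.IsEulerian) (h : Even (G.negEdges σ).ncard) :
    G.HasNowhereZeroFlow σ 2 := by
  have := finite_stubs hG.finite_edgeSet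
  have := hG.finite_vertexSet.to_subtype
  let : Fintype {s : β × Bool // s.1 ∈ G.edgeSet} := Fintype.ofFinite _
  let : Fintype {x // x ∈ G.vertexSet} := Fintype.ofFinite _
  obtain ⟨ends, hends⟩ := exists_isEnds hG.isConnected.1
  have h1 : (cnt fun s => (stubs hends σ).sgn s = true) % 4 = 0 := by
    rw [Nat.even_iff] at h
    rw [cnt_stubs_sgn]
    omega
  obtain ⟨f, hf⟩ := StubGraph.exists_isTwoFlow _ (stubs hends σ) (Nat.lt_succ_self _)
    (hG.isConnected.conn_stubs hends σ) (hG.even_deg_stubs hends σ) h1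
  refine hasNowhereZeroFlow_of_stubs hends hf.mate hf.bal fun s => ?_
  rcases hf.val s with h2 | h2 <;> rw [h2] <;> norm_num

/-- An odd eulerian graph with a nowhere-zero `3`-flow is triply odd. -/
theorem HasNowhereZeroFlow.isTriplyOdd (hG : G.IsEulerian) (h : G.HasNowhereZeroFlow σ 3)
    (hodd : Odd (G.negEdges σ).ncard) : G.IsTriplyOdd σ := by
  have := finite_stubs hG.finite_edgeSet
  have := hG.finite_vertexSet.to_subtype
  let : Fintype {s : β × Bool // s.1 ∈ G.edgeSet} := Fintype.ofFinite _
  let : Fintype {x // x ∈ G.vertexSet} := Fintype.ofFinite _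
  obtain ⟨ends, hends, f, hmate, hbal, hval⟩ := h.exists_stubs
  have v4 : ∀ s, f s = 1 ∨ f s = -1 ∨ f s = 2 ∨ f s = -2 := by
    intro s
    obtain ⟨h1, h2⟩ := hval s
    rw [abs_lt] at h2
    omega
  have flow : (stubs hends σ).IsThreeFlow f := by
    -- Balance makes the number of values ±1 at `x` even; the valency being even, so is the number
    -- of values ±2.
    refine ⟨hmate, hbal, v4, fun x => ?_⟩
    have h1 := hbal x
    have h2 : (stubs hends σ).deg x = _ := cnt_eq_cnt_add fun s _ => v4 s
    have h3 := hG.even_deg_stubs hends σ x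
    rw [wsum_eq_cnt fun s _ => v4 s] at h1
    rw [cnt_abs_two]
    rw [Nat.even_iff] at h3 ⊢
    omega
  refine isTriplyOdd_of_good hG hends (StubGraph.good_of_isThreeFlow flow
    (hG.isConnected.conn_stubs hends σ) ?_)
  rw [Nat.odd_iff] at hodd
  rw [cnt_stubs_sgn]
  omega

end Graph

theorem mainTheorem3 {α β : Type*} (G : Graph α β) (σ : β → ℤˣ) (hG : G.IsEulerian) :
    G.HasFlowNumber σ 3 ↔ G.IsTriplyOdd σ := by
  constructor
  · rintro ⟨h3, hmin⟩
    refine h3.isTriplyOdd hG ?_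
    rw [← Nat.not_even_iff_odd]
    -- With an even number of negative edges there would be a 2-flow, against minimality.
    intro heven
    have h2 : 3 ≤ 2 := hmin (Graph.hasNowhereZeroFlow_two hG heven)
    omega
  · intro h
    refine ⟨h.hasNowhereZeroFlow hG, fun m hm => ?_⟩
    by_contra hlt
    have h1 := h.odd_negEdges hG
    rw [← Nat.not_even_iff_odd] at h1
    exact h1 (Graph.HasNowhereZeroFlow.even_negEdges hG (by omega) hm)
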